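/- Let $T\subset\mathbb R^3$ be a (nondegenerate) tetrahedron. An integer vector $\boldsymbol r=(r^{\texttt v},r^e,r^f)$ is a smoothness vector if $r^f\ge -1$, $r^e\ge\max\{2r^f,-1\}$ and $r^{\texttt v}\ge\max\{2r^e,-1\}$; put $\boldsymbol r+1:=(r^{\texttt v}+1,r^e+1,r^f+1)$ and $\boldsymbol r\ominus 1:=\max\{\boldsymbol r-1,-1\}$ componentwise, and compare vectors componentwise. A smoothness vector $\boldsymbol r$ satisfies the div-tensor stability condition if either $r^{\texttt v}\ge 2r^e+1$ and $r^e\ge 2(r^f+1)$, or $r^{\texttt v}\ge 0$ and $r^e=r^f=-1$. For an integer $k\ge 0$ let $\mathbb B_k(\boldsymbol r)$ be the space of polynomials $u$ of degree at most $k$ on $T$ such that $\nabla^j u$ vanishes at all vertices of $T$ for $0\le j\le r^{\texttt v}$, on all edges of $T$ for $0\le j\le r^e$, and on all faces of $T$ for $0\le j\le r^f$. Let $\mathbb B_k(\boldsymbol r;\mathbb R^3)$ be the space of vector fields with components in $\mathbb B_k(\boldsymbol r)$, and let $\mathbb B_k^{\operatorname{div}}(\boldsymbol r;\mathbb S\cap\mathbb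 T)$ be the space of symmetric traceless $3\times 3$ matrix fields $\boldsymbol\tau$ with entries in $\mathbb B_k(\boldsymbol r)$ such that $\boldsymbol\tau\boldsymbol n=0$ on every face of $T$, where $\boldsymbol n$ is a unit normal of the face. Let $$\mathrm{CK}=\{(\boldsymbol x\cdot\boldsymbol x)\boldsymbol a-2(\boldsymbol a\cdot\boldsymbol x)\boldsymbol x+b\boldsymbol x+\boldsymbol c\times\boldsymbol x+\boldsymbol d:\ \boldsymbol a,\boldsymbol c,\boldsymbol d\in\mathbb R^3,\ b\in\mathbb R\}$$ be the space of conformal Killing fields, and let $\mathbb B_k(\boldsymbol r;\mathbb R^3)/\mathrm{CK}$ denote the subspace of those $\boldsymbol v\in\mathbb B_k(\boldsymbol r;\mathbb R^3)$ with $\int_T\boldsymbol v\cdot\boldsymbol q\,dx=0$ for all $\boldsymbol q\in\mathrm{CK}$. Let $\boldsymbol r\ge(4,1,-1)$ be a smoothness vector such that $\boldsymbol r$ and $\boldsymbol r+1$ both satisfy the div-tensor stability condition, and let $k\ge 2r^{\texttt v}+2$. Then, with the divergence taken row-wise, $$\operatorname{div}\,\mathbb B^{\operatorname{div}}_k(\boldsymbol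 r;\mathbb S\cap\mathbb T)=\mathbb B_{k-1}(\boldsymbol r\ominus 1;\mathbb R^3)/\mathrm{CK}.$$ -/

import Mathlib

open MvPolynomial Matrix MeasureTheory

/-! Spaces `V / CK` are realised, as is usual for bubble complexes, as the `L²(T)`-orthogonal
complement of `CK` inside `V`.  Points and vectors of `ℝ³` are functions `Fin 3 → ℝ`, with the
Euclidean dot product `⬝ᵥ`; the only measure used is Lebesgue measure. -/

/-- An integer vector `(r^v, r^e, r^f)`. -/
@[ext]
structure SmoothVec where
  v : ℤ
  e : ℤ
  f : ℤ

namespace SmoothVec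

/-- `r` is a three-dimensional smoothness vector. -/
def IsSmoothness (r : SmoothVec) : Prop :=
  -1 ≤ r.f ∧ max (2 * r.f) (-1) ≤ r.e ∧ max (2 * r.e) (-1) ≤ r.v

/-- The vector `r + m`. -/
def shift (r : SmoothVec) (m : ℤ) : SmoothVec := ⟨r.v + m, r.e + m, r.f + m⟩

/-- The vector `r ⊖ m = max {r - m, -1}`. -/
def ominus (r : SmoothVec) (m : ℕ) : SmoothVec :=
  ⟨max (r.v - m) (-1), max (r.e - m) (-1), max (r.f - m) (-1)⟩

/-- The componentwise order. -/
instance : LE SmoothVec := ⟨fun r s => r.v ≤ s.v ∧ r.e ≤ s.e ∧ r.f ≤ s.f⟩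

/-- The smoothness vector `r` satisfies the div-tensor stability condition. -/
def DivTensorStable (r : SmoothVec) : Prop :=
  r.IsSmoothness ∧
    ((2 * r.e + 1 ≤ r.v ∧ 2 * (r.f + 1) ≤ r.e) ∨ (0 ≤ r.v ∧ r.e = -1 ∧ r.f = -1))

end SmoothVec

/-- Real polynomials in three variables. -/
abbrev Poly3 := MvPolynomial (Fin 3) ℝ

/-- The iterated partial derivative `∂_{i₁} ⋯ ∂_{iⱼ}` for a list `[i₁, …, iⱼ]` of directions;
the lists of length `j` give the components of `∇ʲ`. -/
noncomputable def iterPartial (l : List (Fin 3)) : Poly3 →ₗ[ℝ] Poly3 :=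
  (l.map fun i => ((pderiv i : Derivation ℝ Poly3 Poly3) : Module.End ℝ Poly3)).prod

/-- The polynomials `u` such that `∇ʲ u` vanishes on `F` for `j = 0, …, m`
(no condition if `m = -1`). -/
noncomputable def vanishing (F : Set (Fin 3 → ℝ)) (m : ℤ) : Submodule ℝ Poly3 where
  carrier := {u | ∀ l : List (Fin 3), (l.length : ℤ) ≤ m → ∀ x ∈ F, eval x (iterPartial l u) = 0}
  zero_mem' := fun l _ x _ => by simp
  add_mem' := fun {u w} hu hw l hl x hx => by simp [hu l hl x hx, hw l hl x hx]
  smul_mem' := fun c u hu l hl x hx => by simp [hu l hl x hx]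

section Tetrahedron

/-- The (closed) tetrahedron with vertices `p 0, …, p 3`. -/
def tetra (p : Fin 4 → Fin 3 → ℝ) : Set (Fin 3 → ℝ) := convexHull ℝ (Set.range p)

/-- The (closed) face of the tetrahedron opposite to the vertex `p i`. -/
def tetraFace (p : Fin 4 → Fin 3 → ℝ) (i : Fin 4) : Set (Fin 3 → ℝ) :=
  convexHull ℝ (p '' {j | j ≠ i})

/-- `n` is a unit normal vector of the face opposite to the vertex `p i`. -/
def IsUnitNormal (p : Fin 4 → Fin 3 → ℝ) (i : Fin 4) (n : Fin 3 → ℝ) : Prop :=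
  n ⬝ᵥ n = 1 ∧ ∀ j k, j ≠ i → k ≠ i → n ⬝ᵥ (p j - p k) = 0

/-- The bubble space `𝔹ₖ(T; r)`. -/
noncomputable def bubble (p : Fin 4 → Fin 3 → ℝ) (k : ℕ) (r : SmoothVec) : Submodule ℝ Poly3 :=
  restrictTotalDegree (Fin 3) ℝ k ⊓
    (⨅ i : Fin 4, vanishing {p i} r.v) ⊓
    (⨅ (i : Fin 4) (j : Fin 4) (_ : i ≠ j), vanishing (segment ℝ (p i) (p j)) r.e) ⊓
    (⨅ i : Fin 4, vanishing (tetraFace p i) r.f)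

/-- The vector bubble space `𝔹ₖ(T; r; ℝ³)`. -/
noncomputable def bubbleVec (p : Fin 4 → Fin 3 → ℝ) (k : ℕ) (r : SmoothVec) :
    Submodule ℝ (Fin 3 → Poly3) where
  carrier := {u | ∀ a, u a ∈ bubble p k r}
  zero_mem' := fun _ => Submodule.zero_mem _
  add_mem' := fun hu hw a => Submodule.add_mem _ (hu a) (hw a)
  smul_mem' := fun c _ hu a => Submodule.smul_mem _ c (hu a)

/-- The bubble space `𝔹ₖ(T; r; 𝕊 ∩ 𝕋)` of symmetric and traceless tensors. -/
noncomputable def bubbleST (p : Fin 4 → Fin 3 → ℝ) (k : ℕ) (r : SmoothVec) :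
    Submodule ℝ (Matrix (Fin 3) (Fin 3) Poly3) where
  carrier := {τ | (∀ a b, τ a b ∈ bubble p k r) ∧ τ.IsSymm ∧ τ.trace = 0}
  zero_mem' := ⟨fun _ _ => Submodule.zero_mem _, Matrix.isSymm_zero, Matrix.trace_zero _ _⟩
  add_mem' := fun hτ hσ => ⟨fun a b => Submodule.add_mem _ (hτ.1 a b) (hσ.1 a b),
    hτ.2.1.add hσ.2.1, by rw [Matrix.trace_add, hτ.2.2, hσ.2.2, add_zero]⟩
  smul_mem' := fun c _ hτ => ⟨fun a b => Submodule.smul_mem _ c (hτ.1 a b),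
    hτ.2.1.smul c, by rw [Matrix.trace_smul, hτ.2.2, smul_zero]⟩

/-- The bubble space `𝔹ₖ^div(T; r; 𝕊 ∩ 𝕋)`: the tensors `τ` in `𝔹ₖ(T; r; 𝕊 ∩ 𝕋)` with
`τ n = 0` on every face of `T`. -/
noncomputable def bubbleDivST (p : Fin 4 → Fin 3 → ℝ) (k : ℕ) (r : SmoothVec) :
    Submodule ℝ (Matrix (Fin 3) (Fin 3) Poly3) where
  carrier := {τ | τ ∈ bubbleST p k r ∧ ∀ i n, IsUnitNormal p i n → ∀ x ∈ tetraFace p i,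
    τ.map (eval x) *ᵥ n = 0}
  zero_mem' := ⟨Submodule.zero_mem _, fun _ _ _ _ _ => by simp⟩
  add_mem' := fun {τ σ} hτ hσ => ⟨Submodule.add_mem _ hτ.1 hσ.1, fun i n hn x hx => by
    rw [Matrix.map_add _ (map_add _), Matrix.add_mulVec, hτ.2 i n hn x hx, hσ.2 i n hn x hx,
      add_zero]⟩
  smul_mem' := fun c τ hτ => ⟨Submodule.smul_mem _ c hτ.1, fun i n hn x hx => by
    have h : (c • τ).map (eval x) = c • τ.map (eval x) := by
      ext a b
      simp
    rw [h, Matrix.smul_mulVec, hτ.2 i n hn x hx, smul_zero]⟩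

/-- The row-wise divergence of a tensor. -/
noncomputable def rowDiv : Matrix (Fin 3) (Fin 3) Poly3 →ₗ[ℝ] (Fin 3 → Poly3) where
  toFun τ := fun a => ∑ b, pderiv b (τ a b)
  map_add' τ σ := by
    funext a
    simp [Finset.sum_add_distrib]
  map_smul' c τ := by
    funext a
    simp [Finset.smul_sum]

/-- The space `CK` of conformal Killing fields on `ℝ³`. -/
def conformalKilling : Set ((Fin 3 → ℝ) → Fin 3 → ℝ) :=
  {q | ∃ (a c d : Fin 3 → ℝ) (b : ℝ), ∀ x,
    q x = (x ⬝ᵥ x) • a - (2 * (a ⬝ᵥ x)) • x + b • x + crossProduct c x + d}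

/-- The vector of values at `x` of a polynomial vector field. -/
noncomputable def evalVec (u : Fin 3 → Poly3) (x : Fin 3 → ℝ) : Fin 3 → ℝ := fun a => eval x (u a)

/-- `𝔹ₖ(T; r; ℝ³) / CK`: the fields in `𝔹ₖ(T; r; ℝ³)` that are `L²(T)`-orthogonal to `CK`. -/
noncomputable def bubbleVecModCK (p : Fin 4 → Fin 3 → ℝ) (k : ℕ) (r : SmoothVec) :
    Set (Fin 3 → Poly3) :=
  {u | u ∈ bubbleVec p k r ∧
    ∀ q ∈ conformalKilling, ∫ x in tetra p, evalVec u x ⬝ᵥ q x = 0}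

end Tetrahedron

/-! The proof is by duality in the Bernstein basis. Let `λᵢ` be the barycentric coordinates and let
`normMonomial β` be `λ^β / β!`. For an edge vector `t = pᵢ - pⱼ` with `βᵢ, βⱼ ≥ 1`, the tensor `(λ^β
/ β!) t tᵀ` has vanishing normal component on every face, and its divergence is the difference of
the normalised monomials with exponents `β - eᵢ` and `β - eⱼ`, times `t`. Combining two edges
removes the trace.

Hence, if a functional annihilates all divergences, its values `q(α)` on the vector Bernstein basis
satisfy `(q(β - eᵢ) - q(β - eⱼ)) · (pᵢ - pⱼ) = μ(β) |pᵢ - pⱼ|²`: they form a discrete conformal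
Killing field on a lattice (`Bary.confAt_bernsteinDual`). The classification
`SimField.exists_discCK` shows that such a `q` is one of the fields `discCK`. These are the moments
of genuine conformal Killing fields against the basis (`Bary.integral_mul_ckPoly`), because the
integral of `λ^α / α!` depends only on the degree of `α`. So the functional is an `L²` pairing with
CK and kills the orthogonal complement of CK, which proves surjectivity (`Bary.exists_rowDiv_eq`).

The classification is a discrete Liouville theorem. In dimension three the third differences of a
conformal Killing field vanish (`conformal_cubic_eq_zero`), so the field is determined by a small
tetrahedron in the middle of the lattice, and this propagates over a core. For small smoothness the
core misses exponents near edges and vertices; these are reached by an edge rule and by linear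
systems governed by the Gram determinant of three edges.

Conversely, a tensor bubble is a combination of edge tensors whose coefficients vanish on the two
faces opposite to the ends of the edge (`Bary.exists_edgeTensor_eq`). Zero trace then cancels the
conformal factors, so its divergence is orthogonal to CK (`Bary.rowDiv_mem`). -/

section

/-! ### Barycentric coordinates and jets of conformal Killing fields -/

/-- `x ↦ G i ⬝ᵥ x + h i` are the barycentric coordinates of the simplex `p`. -/
structure Bary (p : Fin 4 → Fin 3 → ℝ) (G : Fin 4 → Fin 3 → ℝ) (h : Fin 4 → ℝ) : Prop where
  dual : ∀ i j, G i ⬝ᵥ p j + h i = if i = j then 1 else 0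
  sum_grad : ∀ k, ∑ i, G i k = 0
  sum_const : ∑ i, h i = 1
  moment : ∀ k l, ∑ i, G i k * p i l = if k = l then 1 else 0
  moment_const : ∀ l, ∑ i, h i * p i l = 0

theorem exists_bary (p : Fin 4 → Fin 3 → ℝ) (hp : AffineIndependent ℝ p) :
    ∃ G h, Bary p G h := by
  -- The rows of `M` are the homogeneous coordinates `(pᵢ, 1)`. The columns of the inverse are the
  -- gradients and constants, and the five identities are the entries of `M * M⁻¹ = 1` and `M⁻¹ * M
  -- = 1`.
  let M : Matrix (Fin 4) (Fin 4) ℝ := Matrix.of fun i => Fin.snoc (p i) 1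
  have hM1 : ∀ i (l : Fin 3), M i l.castSucc = p i l := fun i l =>
    Fin.snoc_castSucc (α := fun _ => ℝ) 1 (p i) l
  have hM2 : ∀ i, M i (Fin.last 3) = 1 := fun i => Fin.snoc_last (α := fun _ => ℝ) 1 (p i)
  have hM : LinearIndependent ℝ M.row := by
    rw [Fintype.linearIndependent_iff]
    intro c hc
    rw [affineIndependent_iff] at hp
    have hc' : ∀ j, ∑ i, c i * M i j = 0 := fun j => by
      simpa only [Matrix.row, Finset.sum_apply, Pi.smul_apply, smul_eq_mul, Pi.zero_apply] using
        congrFun hc j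
    have h1 : ∑ i, c i = 0 := by simpa only [hM2, mul_one] using hc' (Fin.last 3)
    have h2 : ∑ i, c i • p i = 0 := by
      ext l
      simpa only [hM1, Finset.sum_apply, Pi.smul_apply, smul_eq_mul, Pi.zero_apply] using
        hc' l.castSucc
    intro i
    exact hp Finset.univ c h1 h2 i (Finset.mem_univ i)
  have hdet : IsUnit M.det := by
    rw [← Matrix.isUnit_iff_isUnit_det]
    exact Matrix.linearIndependent_rows_iff_isUnit.mp hM
  have hl := Matrix.mul_nonsing_inv M hdet
  have hr := Matrix.nonsing_inv_mul M hdet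
  set N := M⁻¹ with hN
  refine ⟨fun i l => N l.castSucc i, fun i => N (Fin.last 3) i, ?_, ?_, ?_, ?_, ?_⟩
  · intro i j
    have := congrFun (congrFun hl j) i
    rw [Matrix.mul_apply, Fin.sum_univ_castSucc] at this
    simp only [hM1, hM2, one_mul, Matrix.one_apply] at this
    rw [dotProduct, ← show (if j = i then (1 : ℝ) else 0) = if i = j then 1 else 0 by
      simp [eq_comm], ← this]
    simp [mul_comm]
  · intro l
    have := congrFun (congrFun hr l.castSucc) (Fin.last 3)
    rw [Matrix.mul_apply] at this
    simp only [hM2, mul_one] at this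
    rw [this]
    exact Matrix.one_apply_ne (Fin.castSucc_ne_last l)
  · have := congrFun (congrFun hr (Fin.last 3)) (Fin.last 3)
    rw [Matrix.mul_apply] at this
    simp only [hM2, mul_one] at this
    rw [this]
    exact Matrix.one_apply_eq _
  · intro k l
    have := congrFun (congrFun hr k.castSucc) l.castSucc
    rw [Matrix.mul_apply] at this
    simpa [hM1, Matrix.one_apply] using this
  · intro l
    have := congrFun (congrFun hr (Fin.last 3)) l.castSucc
    rw [Matrix.mul_apply] at this
    simpa [hM1, Matrix.one_apply, Fin.ext_iff, l.2.ne'] using this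

namespace Bary

variable {p : Fin 4 → Fin 3 → ℝ} {G : Fin 4 → Fin 3 → ℝ} {h : Fin 4 → ℝ}

theorem grad_dot_sub (hb : Bary p G h) (i j l : Fin 4) :
    G i ⬝ᵥ (p j - p l) = (if i = j then 1 else 0) - (if i = l then 1 else 0) := by
  rw [dotProduct_sub, ← hb.dual i j, ← hb.dual i l]
  ring

theorem moment_sub (hb : Bary p G h) (o : Fin 4) (k l : Fin 3) :
    ∑ i, G i k * (p i - p o) l = if k = l then 1 else 0 := by
  simp only [Pi.sub_apply, mul_sub, Finset.sum_sub_distrib, hb.moment, ← Finset.sum_mul,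
    hb.sum_grad, zero_mul, sub_zero]

theorem eq_zero_of_dot (hb : Bary p G h) (o : Fin 4) (x : Fin 3 → ℝ)
    (hx : ∀ i, x ⬝ᵥ (p i - p o) = 0) : x = 0 := by
  ext k
  have : ∑ i, G i k * (x ⬝ᵥ (p i - p o)) = x k := by
    simp only [dotProduct, Finset.mul_sum]
    rw [Finset.sum_comm]
    calc _ = ∑ l, x l * ∑ i, G i k * (p i - p o) l := by
          simp only [Finset.mul_sum]
          exact Finset.sum_congr rfl fun _ _ => Finset.sum_congr rfl fun _ _ => by ring
      _ = x k := by simp only [hb.moment_sub o]; simp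
  rw [← this]
  simp [hx]

theorem edge_sq_ne_zero (hb : Bary p G h) {i j : Fin 4} (hij : i ≠ j) :
    (p i - p j) ⬝ᵥ (p i - p j) ≠ 0 := by
  intro h0
  have := hb.grad_dot_sub i i j
  rw [dotProduct_self_eq_zero.mp h0] at this
  simp [hij] at this

/-- Reconstruction of a value from differences along the gradients. -/
theorem sum_grad_dot (hb : Bary p G h) (o a : Fin 4) (w : Fin 4 → ℝ) :
    ∑ k, (p a - p o) k * ∑ i, G i k * w i = w a - w o := by
  simp only [Finset.mul_sum]
  rw [Finset.sum_comm]
  have : ∀ i, ∑ k, (p a - p o) k * (G i k * w i) = (G i ⬝ᵥ (p a - p o)) * w i := fun i => by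
    rw [dotProduct, Finset.sum_mul]
    exact Finset.sum_congr rfl fun _ _ => by ring
  simp only [this, hb.grad_dot_sub, sub_mul, Finset.sum_sub_distrib]
  simp

/-- An infinitesimal similarity of the vertices has conformal gradient. -/
theorem conformal_grad (hb : Bary p G h) (w : Fin 4 → Fin 3 → ℝ) (μ : ℝ)
    (hw : ∀ i j, (w i - w j) ⬝ᵥ (p i - p j) = μ * ((p i - p j) ⬝ᵥ (p i - p j))) (m n : Fin 3) :
    ∑ c, G c m * w c n + ∑ c, G c n * w c m = if m = n then 2 * μ else 0 := by
  -- Polarisation: the hypothesis on the three edges of the triangle `0, c, d` gives the symmetric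
  -- bilinear identity.
  have hpol : ∀ c d, (w c - w 0) ⬝ᵥ (p d - p 0) + (w d - w 0) ⬝ᵥ (p c - p 0) =
      2 * μ * ((p c - p 0) ⬝ᵥ (p d - p 0)) := by
    intro c d
    have h1 := hw c 0
    have h2 := hw d 0
    have h3 := hw c d
    simp only [dotProduct_sub, sub_dotProduct] at h1 h2 h3 ⊢
    rw [dotProduct_comm (p d) (p c)] at h3
    rw [dotProduct_comm (p 0) (p c)] at h1
    rw [dotProduct_comm (p 0) (p d)] at h2
    rw [dotProduct_comm (p 0) (p d)]
    linear_combination h1 + h2 - h3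
  -- Gradients and edges from vertex 0 are dual, so contraction with gradients turns dot products
  -- with edges into components.
  have key : ∀ (u : Fin 4 → Fin 3 → ℝ) (m n : Fin 3),
      ∑ c, ∑ d, G c m * G d n * (u c ⬝ᵥ (p d - p 0)) = ∑ c, G c m * u c n := by
    intro u m n
    refine Finset.sum_congr rfl fun c _ => ?_
    calc _ = G c m * ∑ l, u c l * ∑ d, G d n * (p d - p 0) l := by
          simp only [dotProduct, Finset.mul_sum]
          rw [Finset.sum_comm]
          exact Finset.sum_congr rfl fun _ _ => Finset.sum_congr rfl fun _ _ => by ring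
      _ = _ := by simp only [hb.moment_sub 0]; simp
  have hs : ∑ c, ∑ d, G c m * G d n * ((w c - w 0) ⬝ᵥ (p d - p 0) +
      (w d - w 0) ⬝ᵥ (p c - p 0)) = 2 * μ * ∑ c, ∑ d, G c m * G d n *
        ((p c - p 0) ⬝ᵥ (p d - p 0)) := by
    simp only [hpol, Finset.mul_sum]
    exact Finset.sum_congr rfl fun _ _ => Finset.sum_congr rfl fun _ _ => by ring
  have hsub : ∀ m n, ∑ c, G c m * (w c - w 0) n = ∑ c, G c m * w c n := by
    intro m n
    simp only [Pi.sub_apply, mul_sub, Finset.sum_sub_distrib, ← Finset.sum_mul, hb.sum_grad,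
      zero_mul, sub_zero]
  have h2 : ∑ c, ∑ d, G c m * G d n * ((w d - w 0) ⬝ᵥ (p c - p 0)) =
      ∑ c, G c n * (w c - w 0) m := by
    rw [Finset.sum_comm, ← key (fun c => w c - w 0) n m]
    exact Finset.sum_congr rfl fun _ _ => Finset.sum_congr rfl fun _ _ => by ring
  have h3 := key (fun c => p c - p 0) m n
  simp only [mul_add, Finset.sum_add_distrib] at hs
  rw [h2, key (fun c => w c - w 0) m n, h3, hsub, hsub, hb.moment_sub 0] at hs
  rw [hs]
  split_ifs <;> simp

end Bary

/-- A third-order jet of a conformal Killing field in dimension three vanishes. -/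
theorem conformal_cubic_eq_zero (X : Fin 3 → Fin 3 → Fin 3 → Fin 3 → ℝ)
    (h1 : ∀ k l m n, X k l m n = X l k m n) (h2 : ∀ k l m n, X k l m n = X k m l n)
    (H : Fin 3 → Fin 3 → ℝ)
    (h3 : ∀ k l m n, X k l m n + X k l n m = if m = n then 2 * H k l else 0) (k l m n : Fin 3) :
    X k l m n = 0 := by
  -- As for Christoffel symbols: the cyclic instances of `h3` in the last three indices, with
  -- symmetry in `l, m`, determine `X` from its trace part `H`.
  have hX : ∀ k l m n, X k l m n = (if m = n then H k l else 0) + (if l = n then H k m else 0) -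
      (if l = m then H k n else 0) := by
    intro k l m n
    have e1 := h3 k l m n
    have e2 := h3 k m l n
    have e3 := h3 k n l m
    rw [h2 k m l n, h2 k m n l] at e2
    rw [h2 k n l m] at e3
    split_ifs at e1 e2 e3 ⊢ <;> linarith
  have hH : ∀ a b c d, (if c = d then H a b else 0) + (if b = d then H a c else 0) -
      (if b = c then H a d else 0) = (if c = d then H b a else 0) + (if a = d then H b c else 0) -
      (if a = c then H b d else 0) := by
    intro a b c d
    rw [← hX, ← hX, h1]
  have hsym : ∀ a b, H a b = H b a := by
    intro a b
    have := h3 a b 0 0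
    rw [h1 a b] at this
    have h' := h3 b a 0 0
    simp only [if_true] at this h'
    linarith
  -- Symmetry in the first two indices now forces `H = 0`. Dimension three enters here: off-diagonal
  -- entries need a third index, and on the diagonal `H a a + H b b = 0` must hold for three pairs.
  have hod : ∀ a b c, a ≠ b → b ≠ c → a ≠ c → H a c = 0 := by
    intro a b c hab hbc hac
    have := hH a b c b
    simp [hab, hbc, hac, hbc.symm] at this
    exact this
  have hdg : ∀ a b, a ≠ b → H a a + H b b = 0 := by
    intro a b hab
    have := hH a b a b
    simp [hab, hab.symm] at this
    linarith
  have h01 := hdg 0 1 (by decide)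
  have h02 := hdg 0 2 (by decide)
  have h12 := hdg 1 2 (by decide)
  have hz : ∀ a c, H a c = 0 := by
    intro a c
    fin_cases a <;> fin_cases c
    · simp only [Fin.zero_eta]; linarith
    · exact hod 0 2 1 (by decide) (by decide) (by decide)
    · exact hod 0 1 2 (by decide) (by decide) (by decide)
    · exact hod 1 2 0 (by decide) (by decide) (by decide)
    · simp only [Fin.mk_one]; linarith
    · exact hod 1 0 2 (by decide) (by decide) (by decide)
    · exact hod 2 1 0 (by decide) (by decide) (by decide)
    · exact hod 2 0 1 (by decide) (by decide) (by decide)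
    · simp only [Fin.reduceFinMk]; linarith
  rw [hX]
  simp [hz]

/-- A second-order jet of a conformal Killing field. -/
theorem conformal_quadratic_eq (X : Fin 3 → Fin 3 → Fin 3 → ℝ)
    (h1 : ∀ k l n, X k l n = X l k n) (ν : Fin 3 → ℝ)
    (h2 : ∀ k m n, X k m n + X k n m = if m = n then 2 * ν k else 0) (k l n : Fin 3) :
    X k l n = (if l = n then ν k else 0) + (if k = n then ν l else 0) -
      (if k = l then ν n else 0) := by
  have e1 := h2 k l n
  have e2 := h2 l k n
  have e3 := h2 n k l
  rw [h1 l k n, h1 l n k] at e2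
  rw [h1 n k l] at e3
  split_ifs at e1 e2 e3 ⊢ <;> linarith [h1 n l k]
end

/-! ### Discrete conformal Killing fields on small lattice tetrahedra -/

section

namespace Bary

variable {p : Fin 4 → Fin 3 → ℝ} {G : Fin 4 → Fin 3 → ℝ} {h : Fin 4 → ℝ}

/-- On a lattice tetrahedron with four points per edge, a discrete conformal Killing field that
vanishes on a subtetrahedron with three points per edge vanishes. -/
theorem cubic_extension (hb : Bary p G h) (w : Fin 4 → Fin 4 → Fin 4 → Fin 3 → ℝ)
    (h1 : ∀ a b c, w a b c = w b a c) (h2 : ∀ a b c, w a b c = w a c b)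
    (hw : ∀ a b, ∃ μ : ℝ, ∀ i j, (w a b i - w a b j) ⬝ᵥ (p i - p j) =
      μ * ((p i - p j) ⬝ᵥ (p i - p j)))
    (o : Fin 4) (ho : ∀ a b, w a b o = 0) (a b c : Fin 4) : w a b c = 0 := by
  choose μ hμ using hw
  -- The tensor of third differences; it satisfies the hypotheses of the third-order jet lemma and
  -- hence vanishes.
  let X : Fin 3 → Fin 3 → Fin 3 → Fin 3 → ℝ := fun k l m n =>
    ∑ a, G a k * ∑ b, G b l * ∑ c, G c m * w a b c n
  have hX : ∀ k l m n, X k l m n = 0 := by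
    apply conformal_cubic_eq_zero X (H := fun k l => ∑ a, G a k * ∑ b, G b l * μ a b)
    · intro k l m n
      simp only [X, Finset.mul_sum]
      rw [Finset.sum_comm]
      refine Finset.sum_congr rfl fun a _ => Finset.sum_congr rfl fun b _ =>
        Finset.sum_congr rfl fun c _ => ?_
      rw [h1]
      ring
    · intro k l m n
      simp only [X, Finset.mul_sum]
      refine Finset.sum_congr rfl fun a _ => ?_
      rw [Finset.sum_comm]
      refine Finset.sum_congr rfl fun b _ => Finset.sum_congr rfl fun c _ => ?_
      rw [h2]
      ring
    · intro k l m n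
      simp only [X]
      rw [← Finset.sum_add_distrib]
      simp only [← mul_add, ← Finset.sum_add_distrib]
      simp only [Finset.sum_add_distrib, hb.conformal_grad _ _ (hμ _ _)]
      split_ifs
      · simp only [Finset.mul_sum]
        exact Finset.sum_congr rfl fun _ _ => Finset.sum_congr rfl fun _ _ => by ring
      · simp
  -- By symmetry `w` vanishes as soon as one index is `o`, so expanding around `o` in each index
  -- leaves only third differences.
  have ho2 : ∀ a c, w a o c = 0 := fun a c => by rw [h2, ho]
  have ho1 : ∀ b c, w o b c = 0 := fun b c => by rw [h1, ho2]
  ext n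
  have e1 : ∀ a b, w a b c n = ∑ m, (p c - p o) m * ∑ c, G c m * w a b c n := fun a b => by
    rw [hb.sum_grad_dot o c fun c => w a b c n, ho, Pi.zero_apply, sub_zero]
  have e2 : ∀ (m : Fin 3) a, ∑ c, G c m * w a b c n =
      ∑ l, (p b - p o) l * ∑ b, G b l * ∑ c, G c m * w a b c n := fun m a => by
    rw [hb.sum_grad_dot o b fun b => ∑ c, G c m * w a b c n]
    simp [ho2]
  have e3 : ∀ (l m : Fin 3), ∑ b, G b l * ∑ c, G c m * w a b c n =
      ∑ k, (p a - p o) k * ∑ a, G a k * ∑ b, G b l * ∑ c, G c m * w a b c n := fun l m => by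
    rw [hb.sum_grad_dot o a fun a => ∑ b, G b l * ∑ c, G c m * w a b c n]
    simp [ho1]
  rw [e1]
  simp only [e2 _ a, e3]
  change ∑ m, _ * ∑ l, _ * ∑ k, _ * X k l m n = _
  simp [hX]

/-- The two-jet of a discrete conformal Killing field on a lattice tetrahedron with three points
per edge. -/
theorem quadratic_jet (hb : Bary p G h) (w : Fin 4 → Fin 4 → Fin 3 → ℝ)
    (h1 : ∀ a b, w a b = w b a)
    (hw : ∀ a, ∃ μ : ℝ, ∀ i j, (w a i - w a j) ⬝ᵥ (p i - p j) =
      μ * ((p i - p j) ⬝ᵥ (p i - p j))) :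
    ∃ (u ν : Fin 3 → ℝ) (L : Fin 3 → Fin 3 → ℝ) (s : ℝ),
      (∀ m n, L m n + L n m = if m = n then 2 * s else 0) ∧
      ∀ a b n, w a b n = u n + ∑ k, (p a - p 0 + (p b - p 0)) k * L k n +
        ((ν ⬝ᵥ (p a - p 0)) * (p b - p 0) n + (ν ⬝ᵥ (p b - p 0)) * (p a - p 0) n -
          ν n * ((p a - p 0) ⬝ᵥ (p b - p 0))) := by
  choose μ hμ using hw
  let X : Fin 3 → Fin 3 → Fin 3 → ℝ := fun k l n => ∑ a, G a k * ∑ b, G b l * w a b n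
  let ν : Fin 3 → ℝ := fun k => ∑ a, G a k * μ a
  have hX : ∀ k l n, X k l n = (if l = n then ν k else 0) + (if k = n then ν l else 0) -
      (if k = l then ν n else 0) := by
    apply conformal_quadratic_eq
    · intro k l n
      simp only [X, Finset.mul_sum]
      rw [Finset.sum_comm]
      refine Finset.sum_congr rfl fun a _ => Finset.sum_congr rfl fun b _ => ?_
      rw [h1]
      ring
    · intro k m n
      simp only [X, ν]
      rw [← Finset.sum_add_distrib]
      simp only [← mul_add, hb.conformal_grad _ _ (hμ _)]
      split_ifs
      · simp only [Finset.mul_sum]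
        exact Finset.sum_congr rfl fun _ _ => by ring
      · simp
  refine ⟨w 0 0, ν, fun k n => ∑ b, G b k * w 0 b n, μ 0,
    fun m n => hb.conformal_grad _ _ (hμ 0) m n, fun a b n => ?_⟩
  have e1 : ∀ a b, w a b n = w a 0 n + ∑ l, (p b - p 0) l * ∑ b, G b l * w a b n := fun a b => by
    rw [hb.sum_grad_dot 0 b fun b => w a b n]
    ring
  have e2 : ∀ l : Fin 3, ∑ b, G b l * w a b n = ∑ b, G b l * w 0 b n +
      ∑ k, (p a - p 0) k * X k l n := fun l => by
    rw [hb.sum_grad_dot 0 a fun a => ∑ b, G b l * w a b n]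
    ring
  have e3 := e1 0 a
  rw [h1 0 a] at e3
  rw [e1 a b, e3]
  simp only [e2, hX]
  generalize ht : p a - p 0 = t
  generalize hs : p b - p 0 = t'
  simp only [dotProduct, Fin.sum_univ_three, Pi.add_apply]
  fin_cases n <;> simp <;> ring

end Bary

/-- `q` is an infinitesimal similarity on the lattice simplex with vertices `β - eᵢ`. -/
def ConfAt (p : Fin 4 → Fin 3 → ℝ) (q : (Fin 4 → ℤ) → Fin 3 → ℝ) (β : Fin 4 → ℤ) : Prop :=
  ∃ μ : ℝ, ∀ i j, 1 ≤ β i → 1 ≤ β j →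
    (q (β - Pi.single i 1) - q (β - Pi.single j 1)) ⬝ᵥ (p i - p j) =
      μ * ((p i - p j) ⬝ᵥ (p i - p j))

theorem ConfAt.sub {p : Fin 4 → Fin 3 → ℝ} {q q' : (Fin 4 → ℤ) → Fin 3 → ℝ} {β : Fin 4 → ℤ}
    (h : ConfAt p q β) (h' : ConfAt p q' β) : ConfAt p (q - q') β := by
  obtain ⟨μ, hμ⟩ := h
  obtain ⟨μ', hμ'⟩ := h'
  refine ⟨μ - μ', fun i j hi hj => ?_⟩
  rw [sub_mul, ← hμ i j hi hj, ← hμ' i j hi hj, ← sub_dotProduct]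
  congr 1
  simp only [Pi.sub_apply]
  abel

/-- The first moment of the exponent `α`. -/
def moment₁ (p : Fin 4 → Fin 3 → ℝ) (α : Fin 4 → ℤ) (k : Fin 3) : ℝ :=
  ∑ i, ((α i : ℝ) + 1) * p i k

/-- The second moment of the exponent `α`. -/
def moment₂ (p : Fin 4 → Fin 3 → ℝ) (α : Fin 4 → ℤ) (k l : Fin 3) : ℝ :=
  moment₁ p α k * moment₁ p α l + ∑ i, ((α i : ℝ) + 1) * (p i k * p i l)

/-- The conformal Killing fields on the lattice. -/
def discCK (p : Fin 4 → Fin 3 → ℝ) (a c d : Fin 3 → ℝ) (b : ℝ) (α : Fin 4 → ℤ) : Fin 3 → ℝ :=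
  fun n => (∑ l, moment₂ p α l l) * a n - 2 * ∑ l, moment₂ p α n l * a l + b * moment₁ p α n +
    crossProduct c (moment₁ p α) n + d n

theorem moment₁_sub_single (p : Fin 4 → Fin 3 → ℝ) (α : Fin 4 → ℤ) (i : Fin 4) (k : Fin 3) :
    moment₁ p (α - Pi.single i 1) k = moment₁ p α k - p i k := by
  have : ∀ j, ((Pi.single i (1 : ℤ) : Fin 4 → ℤ) j : ℝ) = if j = i then 1 else 0 := fun j => by
    rw [Pi.single_apply]; split_ifs <;> simp
  simp only [moment₁, Pi.sub_apply, Int.cast_sub, this]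
  rw [eq_sub_iff_add_eq, ← Fintype.sum_ite_eq i (fun j => p j k), ← Finset.sum_add_distrib]
  refine Finset.sum_congr rfl fun j _ => ?_
  simp only [eq_comm (a := i)]
  split_ifs <;> ring

theorem moment₂_sub_single (p : Fin 4 → Fin 3 → ℝ) (α : Fin 4 → ℤ) (i : Fin 4) (k l : Fin 3) :
    moment₂ p (α - Pi.single i 1) k l =
      moment₂ p α k l - (moment₁ p α k * p i l + p i k * moment₁ p α l) := by
  have : ∀ j, ((Pi.single i (1 : ℤ) : Fin 4 → ℤ) j : ℝ) = if j = i then 1 else 0 := fun j => by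
    rw [Pi.single_apply]; split_ifs <;> simp
  have h2 : ∑ j, (((α - Pi.single i 1 : Fin 4 → ℤ) j : ℝ) + 1) * (p j k * p j l) =
      ∑ j, ((α j : ℝ) + 1) * (p j k * p j l) - p i k * p i l := by
    simp only [Pi.sub_apply, Int.cast_sub, this]
    rw [eq_sub_iff_add_eq, ← Fintype.sum_ite_eq i (fun j => p j k * p j l),
      ← Finset.sum_add_distrib]
    refine Finset.sum_congr rfl fun j _ => ?_
    simp only [eq_comm (a := i)]
    split_ifs <;> ring
  rw [moment₂, h2, moment₁_sub_single, moment₁_sub_single, moment₂]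
  ring

theorem discCK_sub_single (p : Fin 4 → Fin 3 → ℝ) (a c d : Fin 3 → ℝ) (b : ℝ) (α : Fin 4 → ℤ)
    (i : Fin 4) (n : Fin 3) :
    discCK p a c d b (α - Pi.single i 1) n = discCK p a c d b α n -
      (2 * (moment₁ p α ⬝ᵥ p i) * a n - 2 * (moment₁ p α n * (p i ⬝ᵥ a) +
        p i n * (moment₁ p α ⬝ᵥ a)) + b * p i n + crossProduct c (p i) n) := by
  have : moment₁ p (α - Pi.single i 1) = moment₁ p α - p i := by
    ext k; exact moment₁_sub_single p α i k
  simp only [discCK, moment₂_sub_single, this, map_sub, Pi.sub_apply]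
  simp only [dotProduct, Fin.sum_univ_three]
  ring

theorem confAt_discCK (p : Fin 4 → Fin 3 → ℝ) (a c d : Fin 3 → ℝ) (b : ℝ) (β : Fin 4 → ℤ) :
    ConfAt p (discCK p a c d b) β := by
  -- The continuous field has conformal factor `b - 2 a · x`; lowering `βᵢ` moves the moment by
  -- `-pᵢ`, which reverses the sign.
  refine ⟨2 * (moment₁ p β ⬝ᵥ a) - b, fun i j _ _ => ?_⟩
  have : discCK p a c d b (β - Pi.single i 1) - discCK p a c d b (β - Pi.single j 1) = fun n =>
      -(2 * (moment₁ p β ⬝ᵥ (p i - p j)) * a n - 2 * (moment₁ p β n * ((p i - p j) ⬝ᵥ a) +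
        (p i - p j) n * (moment₁ p β ⬝ᵥ a)) + b * (p i - p j) n +
        crossProduct c (p i - p j) n) := by
    ext n
    rw [Pi.sub_apply, discCK_sub_single, discCK_sub_single]
    simp only [map_sub, Pi.sub_apply, dotProduct_sub, sub_dotProduct]
    ring
  rw [this]
  generalize p i - p j = t
  simp only [dotProduct, Fin.sum_univ_three, cross_apply]
  simp
  ring

/-- Every discrete conformal Killing field agrees with one of the fields `discCK` on a lattice
tetrahedron with three points per edge. -/
theorem exists_discCK_fit {p G : Fin 4 → Fin 3 → ℝ} {h : Fin 4 → ℝ} (hb : Bary p G h)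
    (q : (Fin 4 → ℤ) → Fin 3 → ℝ) (δ : Fin 4 → ℤ)
    (hpos : ∀ a i, 1 ≤ (δ - Pi.single a 1 : Fin 4 → ℤ) i)
    (hq : ∀ a, ConfAt p q (δ - Pi.single a 1)) :
    ∃ a c d b, ∀ i j, q (δ - Pi.single i 1 - Pi.single j 1) =
      discCK p a c d b (δ - Pi.single i 1 - Pi.single j 1) := by
  obtain ⟨u, ν, L, s, hL, hw⟩ := hb.quadratic_jet
    (fun i j => q (δ - Pi.single i 1 - Pi.single j 1))
    (fun i j => by congr 1; abel)
    (fun i => by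
      obtain ⟨μ, hμ⟩ := hq i
      exact ⟨μ, fun a b => hμ a b (hpos i a) (hpos i b)⟩)
  -- The second difference of `discCK` along edges `t, t'` is `2 (t · t') a - 2 (t · a) t' - 2 (t' ·
  -- a) t`, so `a = -ν / 2`. Then `b` and `c` match the scalar and skew parts of `L`, corrected by
  -- the first differences of the `a`-terms at `y`, and `d` matches the value at one corner.
  let y : Fin 3 → ℝ := fun k => moment₁ p δ k - p 0 k
  let a : Fin 3 → ℝ := fun n => -(ν n / 2)
  let b : ℝ := 2 * (y ⬝ᵥ a) - s
  let c : Fin 3 → ℝ := ![2 * (y 2 * a 1 - y 1 * a 2) - L 1 2, 2 * (y 0 * a 2 - y 2 * a 0) - L 2 0,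
    2 * (y 1 * a 0 - y 0 * a 1) - L 0 1]
  refine ⟨a, c, u - discCK p a c 0 b (δ - Pi.single 0 1 - Pi.single 0 1), b, fun i j => ?_⟩
  ext n
  rw [hw]
  have hd : ∀ α d, discCK p a c d b α n = discCK p a c 0 b α n + d n := fun α d => by
    simp [discCK]
  rw [hd]
  simp only [discCK_sub_single, moment₁_sub_single, Pi.sub_apply]
  have h00 := hL 0 0
  have h11 := hL 1 1
  have h22 := hL 2 2
  have h01 := hL 0 1
  have h02 := hL 0 2
  have h12 := hL 1 2
  simp only [Fin.isValue, if_true, Fin.reduceEq, if_false] at h00 h11 h22 h01 h02 h12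
  have h00' : L 0 0 = s := by linarith
  have h11' : L 1 1 = s := by linarith
  have h22' : L 2 2 = s := by linarith
  have h10' : L 1 0 = - L 0 1 := by linarith
  have h20' : L 0 2 = - L 2 0 := by linarith
  have h21' : L 2 1 = - L 1 2 := by linarith
  have hm : ∀ i : Fin 4, moment₁ p (δ - Pi.single i 1) = fun k => moment₁ p δ k - p i k :=
    fun i => by ext k; exact moment₁_sub_single p δ i k
  simp only [hm]
  have hc : ∀ t, crossProduct c t n = (![c 1 * t 2 - c 2 * t 1, c 2 * t 0 - c 0 * t 2,
      c 0 * t 1 - c 1 * t 0] : Fin 3 → ℝ) n := fun t => by rw [cross_apply]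
  simp only [hc]
  have hc0 : c 0 = 2 * (y 2 * a 1 - y 1 * a 2) - L 1 2 := rfl
  have hc1 : c 1 = 2 * (y 0 * a 2 - y 2 * a 0) - L 2 0 := rfl
  have hc2 : c 2 = 2 * (y 1 * a 0 - y 0 * a 1) - L 0 1 := rfl
  simp only [hc0, hc1, hc2, b, dotProduct, Fin.sum_univ_three]
  simp only [y, a, Pi.add_apply, Pi.sub_apply]
  fin_cases n <;> simp [h00', h11', h22', h10', h20', h21'] <;> ring
end

/-! ### The core of the lattice and propagation inside it -/

section

/-- The exponents of degree `k` whose entries are at least `F`, whose sums of two entries are at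
least `E`, and whose sums of three entries are at least `V`. -/
def IsAdm (k F E V : ℤ) (β : Fin 4 → ℤ) : Prop :=
  ∑ i, β i = k ∧ (∀ i, F ≤ β i) ∧ (∀ i j, i ≠ j → E ≤ β i + β j) ∧ ∀ i, β i ≤ k - V

theorem single_one_bounds (a i : Fin 4) :
    0 ≤ (Pi.single a 1 : Fin 4 → ℤ) i ∧ (Pi.single a 1 : Fin 4 → ℤ) i ≤ 1 := by
  rw [Pi.single_apply]
  split_ifs <;> simp

theorem single_one_add_le (a : Fin 4) {i j : Fin 4} (hij : i ≠ j) :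
    (Pi.single a 1 : Fin 4 → ℤ) i + (Pi.single a 1 : Fin 4 → ℤ) j ≤ 1 := by
  rw [Pi.single_apply, Pi.single_apply]
  split_ifs with h1 h2 <;> simp_all

theorem sum_single_one (a : Fin 4) : ∑ i, (Pi.single a 1 : Fin 4 → ℤ) i = 1 := by simp

variable {k F E V : ℤ}

theorem IsAdm.sub_single {γ : Fin 4 → ℤ} (h : IsAdm k F E V γ) (a : Fin 4) :
    IsAdm (k - 1) (F - 1) (E - 1) (V - 1) (γ - Pi.single a 1) := by
  obtain ⟨h1, h2, h3, h4⟩ := h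
  refine ⟨?_, fun i => ?_, fun i j hij => ?_, fun i => ?_⟩
  · simp only [Pi.sub_apply, Finset.sum_sub_distrib, h1, sum_single_one]
  · have := h2 i
    have := single_one_bounds a i
    simp only [Pi.sub_apply]
    omega
  · have := h3 i j hij
    have := single_one_add_le a hij
    simp only [Pi.sub_apply]
    omega
  · have := h4 i
    have := single_one_bounds a i
    simp only [Pi.sub_apply]
    omega

theorem IsAdm.mono {F' E' V' : ℤ} {γ : Fin 4 → ℤ} (h : IsAdm k F E V γ) (hF : F' ≤ F)
    (hE : E' ≤ E) (hV : V' ≤ V) : IsAdm k F' E' V' γ := by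
  obtain ⟨h1, h2, h3, h4⟩ := h
  exact ⟨h1, fun i => hF.trans (h2 i), fun i j hij => hE.trans (h3 i j hij),
    fun i => (h4 i).trans (by omega)⟩

/-- The exponents from which three unit steps lead into the domain of a discrete field. -/
abbrev IsCore (k F E V : ℤ) (γ : Fin 4 → ℤ) : Prop :=
  IsAdm (k + 2) (max F 1 + 2) (E + 2) (V + 2) γ

theorem IsCore.sub_sub {γ : Fin 4 → ℤ} (h : IsCore k F E V γ) (a b : Fin 4) :
    IsAdm k (max F 1) E V (γ - Pi.single a 1 - Pi.single b 1) := by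
  have h2 := (h.sub_single a).sub_single b
  rw [show k + 2 - 1 - 1 = k by ring] at h2
  exact h2.mono (by omega) (by omega) (by omega)

/-- A unit moved from a larger entry to a smaller one makes the exponent more balanced, which cannot
break any of the bounds. -/
theorem IsCore.move {γ : Fin 4 → ℤ} (h : IsCore k F E V γ) {i j : Fin 4} (hij : γ j < γ i) :
    IsCore k F E V (γ - Pi.single i 1 + Pi.single j 1) := by
  obtain ⟨h1, h2, h3, h4⟩ := h
  refine ⟨?_, fun l => ?_, fun l m hlm => ?_, fun l => ?_⟩
  · simp only [Pi.sub_apply, Pi.add_apply, Finset.sum_sub_distrib, Finset.sum_add_distrib, h1,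
      sum_single_one]
    ring
  · have e1 := h2 l
    have e2 := h2 j
    simp only [Pi.sub_apply, Pi.add_apply, Pi.single_apply]
    split_ifs <;> subst_vars <;> omega
  · have e1 := h3 l m hlm
    have e2 := h3 l j
    have e3 := h3 m j
    simp only [Pi.sub_apply, Pi.add_apply, Pi.single_apply]
    split_ifs <;> subst_vars <;> omega
  · have e1 := h4 l
    have e2 := h4 i
    simp only [Pi.sub_apply, Pi.add_apply, Pi.single_apply]
    split_ifs <;> subst_vars <;> omega

/-- After two steps down from a core exponent all entries are still at least one, so every lattice
simplex involved is complete and `Bary.cubic_extension` applies. -/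
theorem core_extension {p G : Fin 4 → Fin 3 → ℝ} {h : Fin 4 → ℝ} (hb : Bary p G h)
    {q : (Fin 4 → ℤ) → Fin 3 → ℝ}
    (hq : ∀ β, IsAdm k F E V β → ConfAt p q β) {γ : Fin 4 → ℤ} (hγ : IsCore k F E V γ) (o : Fin 4)
    (ho : ∀ a b, q (γ - Pi.single o 1 - Pi.single a 1 - Pi.single b 1) = 0) (a b c : Fin 4) :
    q (γ - Pi.single a 1 - Pi.single b 1 - Pi.single c 1) = 0 := by
  refine hb.cubic_extension (fun a b c => q (γ - Pi.single a 1 - Pi.single b 1 - Pi.single c 1))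
    (fun a b c => ?_) (fun a b c => ?_) (fun a b => ?_) o (fun a b => ?_) a b c
  · congr 1; abel
  · congr 1; abel
  · have hβ := hγ.sub_sub a b
    obtain ⟨μ, hμ⟩ := hq _ (hβ.mono (le_max_left _ _) le_rfl le_rfl)
    have hpos : ∀ i, 1 ≤ (γ - Pi.single a 1 - Pi.single b 1 : Fin 4 → ℤ) i := fun i =>
      (le_max_right _ _).trans (hβ.2.1 i)
    exact ⟨μ, fun i j => hμ i j (hpos i) (hpos j)⟩
  · rw [← ho a b]; congr 1; abel

/-- Induction on the `ℓ¹` distance to a balanced exponent `γ₀`. Some `γ i` is too large and some `γ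
j` too small; `γ` and its neighbour `γ - eᵢ + eⱼ`, which is closer to `γ₀`, share the subtetrahedron
below `γ - eᵢ`. -/
theorem core_vanish {p G : Fin 4 → Fin 3 → ℝ} {h : Fin 4 → ℝ} (hb : Bary p G h)
    {q : (Fin 4 → ℤ) → Fin 3 → ℝ}
    (hq : ∀ β, IsAdm k F E V β → ConfAt p q β) (γ₀ : Fin 4 → ℤ) (hγ₀ : IsCore k F E V γ₀)
    (hbal : ∀ i j, γ₀ i ≤ γ₀ j + 1)
    (h0 : ∀ a b, q (γ₀ - Pi.single 0 1 - Pi.single a 1 - Pi.single b 1) = 0)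
    (n : ℕ) : ∀ γ : Fin 4 → ℤ, IsCore k F E V γ → ∑ i, |γ i - γ₀ i| < n → ∀ a b c,
      q (γ - Pi.single a 1 - Pi.single b 1 - Pi.single c 1) = 0 := by
  induction n with
  | zero =>
    intro γ _ hlt
    exact absurd hlt (not_lt.mpr (Finset.sum_nonneg fun _ _ => abs_nonneg _))
  | succ n ih =>
    intro γ hγ hlt
    by_cases heq : γ = γ₀
    · subst heq
      exact core_extension hb hq hγ 0 h0
    have hsum : ∑ i, γ i = ∑ i, γ₀ i := hγ.1.trans hγ₀.1.symm
    obtain ⟨i, hi⟩ : ∃ i, γ₀ i < γ i := by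
      by_contra! hle
      refine heq (funext fun l => ?_)
      exact (Finset.sum_eq_sum_iff_of_le fun l _ => hle l).mp hsum l (Finset.mem_univ l)
    obtain ⟨j, hj⟩ : ∃ j, γ j < γ₀ j := by
      by_contra! hle
      refine heq (funext fun l => ?_)
      exact ((Finset.sum_eq_sum_iff_of_le fun l _ => hle l).mp hsum.symm l
        (Finset.mem_univ l)).symm
    have hij : γ j < γ i := by
      have := hbal j i
      omega
    have hne : i ≠ j := by rintro rfl; omega
    refine core_extension hb hq hγ i fun a b => ?_
    have := ih _ (hγ.move hij) ?_ j a b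
    · rw [← this]; congr 1; abel
    · refine lt_of_lt_of_le (Finset.sum_lt_sum (g := fun l => |γ l - γ₀ l|) (fun l _ => ?_)
        ⟨i, Finset.mem_univ i, ?_⟩) (by push_cast at hlt; omega)
      · simp only [Pi.sub_apply, Pi.add_apply, Pi.single_apply]
        split_ifs with e1 e2 e2
        · subst e1; exact absurd e2 hne
        · subst e1; simp only [abs_le, le_abs]; grind
        · subst e2; grind
        · simp
      · simp only [Pi.sub_apply, Pi.add_apply, Pi.single_apply, if_true, if_neg hne]
        grind

/-- The floors of `(k + 2 + i) / 4` for `i = 0, …, 3` sum to `k + 2` and differ by at most one, so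
this is the most balanced exponent of degree `k + 2`. -/
theorem isCore_center (hF : 0 ≤ F) (hE : 2 * F + 2 ≤ E) (hV : 2 * E + 1 ≤ V) (hk : 2 * V ≤ k) :
    IsCore k F E V fun i => (k + 2 + (i : ℕ)) / 4 := by
  refine ⟨?_, fun i => ?_, fun i j _ => ?_, fun i => ?_⟩
  · rw [Fin.sum_univ_four]
    simp
    omega
  · have := i.2
    simp only
    omega
  · have := i.2
    have := j.2
    simp only
    omega
  · have := i.2
    simp only
    omega

/-- After subtraction of one of the fields `discCK`, a discrete conformal Killing field vanishes
at all exponents that are covered by the core. -/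
theorem exists_discCK_core {p G : Fin 4 → Fin 3 → ℝ} {h : Fin 4 → ℝ} (hb : Bary p G h)
    {q : (Fin 4 → ℤ) → Fin 3 → ℝ} (hF : 0 ≤ F) (hE : 2 * F + 2 ≤ E) (hV : 2 * E + 1 ≤ V)
    (hk : 2 * V ≤ k) (hq : ∀ β, IsAdm k F E V β → ConfAt p q β) :
    ∃ a c d b, ∀ γ : Fin 4 → ℤ, IsCore k F E V γ → ∀ i j l,
      (q - discCK p a c d b) (γ - Pi.single i 1 - Pi.single j 1 - Pi.single l 1) = 0 := by
  have hγ₀ := isCore_center hF hE hV hk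
  set γ₀ : Fin 4 → ℤ := fun i => (k + 2 + (i : ℕ)) / 4
  obtain ⟨a, c, d, b, hfit⟩ := exists_discCK_fit hb q (γ₀ - Pi.single 0 1)
    (fun a i => (le_max_right _ _).trans ((hγ₀.sub_sub 0 a).2.1 i))
    (fun a => hq _ ((hγ₀.sub_sub 0 a).mono (le_max_left _ _) le_rfl le_rfl))
  refine ⟨a, c, d, b, fun γ hγ => ?_⟩
  refine core_vanish hb (fun β hβ => (hq β hβ).sub (confAt_discCK p a c d b β)) γ₀ hγ₀
    (fun i j => ?_) (fun i j => ?_) ((∑ i, |γ i - γ₀ i|).toNat + 1) γ hγ ?_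
  · have := i.2
    have := j.2
    simp only [γ₀]
    omega
  · rw [Pi.sub_apply, hfit, sub_self]
  · push_cast
    rw [Int.toNat_of_nonneg (Finset.sum_nonneg fun _ _ => abs_nonneg _)]
    omega
end

/-! ### Exponents covered by the core, and local rules at edges and vertices -/

section

variable {k F E V : ℤ}

theorem isAdm_iff {β : Fin 4 → ℤ} : IsAdm k F E V β ↔ β 0 + β 1 + β 2 + β 3 = k ∧
    (F ≤ β 0 ∧ F ≤ β 1 ∧ F ≤ β 2 ∧ F ≤ β 3) ∧
    (E ≤ β 0 + β 1 ∧ E ≤ β 0 + β 2 ∧ E ≤ β 0 + β 3 ∧ E ≤ β 1 + β 2 ∧ E ≤ β 1 + β 3 ∧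
      E ≤ β 2 + β 3) ∧
    (β 0 ≤ k - V ∧ β 1 ≤ k - V ∧ β 2 ≤ k - V ∧ β 3 ≤ k - V) := by
  rw [IsAdm, Fin.sum_univ_four, Fin.forall_fin_succ, Fin.forall_fin_succ, Fin.forall_fin_succ]
  simp only [Fin.forall_fin_succ, IsEmpty.forall_iff, Fin.succ_zero_eq_one, Fin.succ_one_eq_two,
    Fin.isValue, Fin.reduceSucc, ne_eq, Fin.reduceEq, not_true_eq_false, not_false_eq_true,
    forall_const, and_true, true_and]
  constructor
  · rintro ⟨h1, h2, h3, h4⟩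
    refine ⟨h1, h2, ?_, h4⟩
    omega
  · rintro ⟨h1, h2, h3, h4⟩
    refine ⟨h1, h2, ?_, h4⟩
    omega

theorem IsAdm.comp_perm {β : Fin 4 → ℤ} (h : IsAdm k F E V β) (σ : Equiv.Perm (Fin 4)) :
    IsAdm k F E V (β ∘ σ) :=
  ⟨(Equiv.sum_comp σ β).trans h.1, fun _ => h.2.1 _,
    fun _ _ hij => h.2.2.1 _ _ (σ.injective.ne hij), fun _ => h.2.2.2 _⟩

theorem Bary.comp_perm {p G : Fin 4 → Fin 3 → ℝ} {h : Fin 4 → ℝ} (hb : Bary p G h)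
    (σ : Equiv.Perm (Fin 4)) : Bary (p ∘ σ) (G ∘ σ) (h ∘ σ) where
  dual i j := by simpa [σ.injective.eq_iff] using hb.dual (σ i) (σ j)
  sum_grad l := (Equiv.sum_comp σ fun i => G i l).trans (hb.sum_grad l)
  sum_const := (Equiv.sum_comp σ h).trans hb.sum_const
  moment m l := (Equiv.sum_comp σ fun i => G i m * p i l).trans (hb.moment m l)
  moment_const l := (Equiv.sum_comp σ fun i => h i * p i l).trans (hb.moment_const l)

theorem sub_single_comp_symm (σ : Equiv.Perm (Fin 4)) (β : Fin 4 → ℤ) (i : Fin 4) :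
    (β - Pi.single i 1) ∘ σ.symm = β ∘ σ.symm - Pi.single (σ i) 1 := by
  ext l
  simp [Pi.single_apply, Equiv.symm_apply_eq]

theorem ConfAt.comp_perm {p : Fin 4 → Fin 3 → ℝ} {q : (Fin 4 → ℤ) → Fin 3 → ℝ}
    (σ : Equiv.Perm (Fin 4)) {β : Fin 4 → ℤ} (h : ConfAt p q (β ∘ σ.symm)) :
    ConfAt (p ∘ σ) (fun α => q (α ∘ σ.symm)) β := by
  obtain ⟨μ, hμ⟩ := h
  refine ⟨μ, fun i j hi hj => ?_⟩
  simp only [sub_single_comp_symm]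
  exact hμ (σ i) (σ j) (by simpa using hi) (by simpa using hj)

theorem exists_sorted (α : Fin 4 → ℤ) : ∃ σ : Equiv.Perm (Fin 4),
    α (σ 0) ≤ α (σ 1) ∧ α (σ 1) ≤ α (σ 2) ∧ α (σ 2) ≤ α (σ 3) := by
  have h := Tuple.monotone_sort α
  exact ⟨Tuple.sort α, h (by decide : (0 : Fin 4) ≤ 1), h (by decide : (1 : Fin 4) ≤ 2),
    h (by decide : (2 : Fin 4) ≤ 3)⟩

/-- The three units are given to the smallest entries. As core entries are at least 3, the two
smallest entries of `α` must sum to at least 3 and the three smallest to at least 6; `4 ≤ E`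
guarantees this, and otherwise it is assumed in `hc`. -/
theorem exists_core_of_sorted (hF : 0 ≤ F) (hE : 2 * F + 2 ≤ E) (hV : 2 * E + 1 ≤ V)
    (hk : 2 * V ≤ k) {α : Fin 4 → ℤ}
    (hα : IsAdm (k - 1) (max (F - 1) 0) (E - 1) (V - 1) α)
    (h01 : α 0 ≤ α 1) (h12 : α 1 ≤ α 2) (h23 : α 2 ≤ α 3)
    (hc : 4 ≤ E ∨ (3 ≤ α 0 + α 1 ∧ α 3 ≤ k - 7)) :
    ∃ i j l, IsCore k F E V (α + Pi.single i 1 + Pi.single j 1 + Pi.single l 1) := by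
  simp only [IsCore]
  simp only [isAdm_iff] at hα ⊢
  obtain ⟨h1, ⟨h2, -, -, -⟩, ⟨h3, -, -, -, -, -⟩, -, -, -, h4⟩ := hα
  by_cases hg : α 0 + 2 ≤ α 1
  · refine ⟨0, 0, 0, ?_⟩
    simp
    omega
  · by_cases hg' : α 2 = α 0
    · refine ⟨0, 1, 2, ?_⟩
      simp
      omega
    · refine ⟨0, 0, 1, ?_⟩
      simp
      omega

theorem exists_core (hF : 0 ≤ F) (hE : 2 * F + 2 ≤ E) (hV : 2 * E + 1 ≤ V) (hk : 2 * V ≤ k)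
    {α : Fin 4 → ℤ} (hα : IsAdm (k - 1) (max (F - 1) 0) (E - 1) (V - 1) α)
    (hc : 4 ≤ E ∨ ((∀ i j, i ≠ j → 3 ≤ α i + α j) ∧ ∀ i, α i ≤ k - 7)) :
    ∃ γ, IsCore k F E V γ ∧ ∃ i j l, α = γ - Pi.single i 1 - Pi.single j 1 - Pi.single l 1 := by
  obtain ⟨σ, h01, h12, h23⟩ := exists_sorted α
  obtain ⟨i, j, l, hγ⟩ := exists_core_of_sorted hF hE hV hk (hα.comp_perm σ) h01 h12 h23
    (hc.imp_right fun h => ⟨h.1 _ _ (σ.injective.ne (by decide)), h.2 _⟩)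
  refine ⟨_, hγ.comp_perm σ.symm, σ i, σ j, σ l, ?_⟩
  ext m
  simp only [Function.comp_apply, Pi.sub_apply, Pi.add_apply, Equiv.apply_symm_apply,
    Pi.single_apply, Equiv.symm_apply_eq]
  ring

/-! ### The neighbourhood of an edge -/

theorem vec_sub_single₀ (a b c d : ℤ) :
    (![a, b, c, d] - Pi.single 0 1 : Fin 4 → ℤ) = ![a - 1, b, c, d] := by
  ext i; fin_cases i <;> simp

theorem vec_sub_single₁ (a b c d : ℤ) :
    (![a, b, c, d] - Pi.single 1 1 : Fin 4 → ℤ) = ![a, b - 1, c, d] := by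
  ext i; fin_cases i <;> simp

theorem vec_sub_single₂ (a b c d : ℤ) :
    (![a, b, c, d] - Pi.single 2 1 : Fin 4 → ℤ) = ![a, b, c - 1, d] := by
  ext i; fin_cases i <;> simp

theorem vec_sub_single₃ (a b c d : ℤ) :
    (![a, b, c, d] - Pi.single 3 1 : Fin 4 → ℤ) = ![a, b, c, d - 1] := by
  ext i; fin_cases i <;> simp

/-- A value of a discrete conformal Killing field at the fourth vertex. -/
theorem edge_rule {p G : Fin 4 → Fin 3 → ℝ} {h : Fin 4 → ℝ} (hb : Bary p G h)
    {q : (Fin 4 → ℤ) → Fin 3 → ℝ} {a b c d : ℤ} (ha : 0 ≤ a) (hb0 : 0 ≤ b) (hc : 1 ≤ c)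
    (hd : 1 ≤ d) (h0 : ConfAt p q ![a + 1, b, c, d]) (h1 : ConfAt p q ![a, b + 1, c, d])
    (q02 : q ![a + 1, b, c - 1, d] = 0) (q03 : q ![a + 1, b, c, d - 1] = 0)
    (q12 : q ![a, b + 1, c - 1, d] = 0) (q13 : q ![a, b + 1, c, d - 1] = 0) :
    q ![a, b, c, d] = 0 := by
  obtain ⟨μ, hμ⟩ := h0
  obtain ⟨ν, hν⟩ := h1
  have e1 := hμ 2 3 (by simpa using hc) (by simpa using hd)
  have e2 := hν 2 3 (by simpa using hc) (by simpa using hd)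
  have f2 := hμ 0 2 (by simpa using ha) (by simpa using hc)
  have f3 := hμ 0 3 (by simpa using ha) (by simpa using hd)
  have g2 := hν 1 2 (by simpa using hb0) (by simpa using hc)
  have g3 := hν 1 3 (by simpa using hb0) (by simpa using hd)
  simp only [vec_sub_single₀, vec_sub_single₁, vec_sub_single₂, vec_sub_single₃, q02, q03, q12,
    q13, sub_zero, zero_dotProduct, add_sub_cancel_right] at e1 e2 f2 f3 g2 g3
  -- In both simplices the field vanishes at the two ends of the edge between vertices 2 and 3, so
  -- both conformal factors are zero.
  have hμ0 : μ = 0 := 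
    (mul_eq_zero.mp e1.symm).resolve_right (hb.edge_sq_ne_zero (by decide))
  have hν0 : ν = 0 := 
    (mul_eq_zero.mp e2.symm).resolve_right (hb.edge_sq_ne_zero (by decide))
  rw [hμ0, zero_mul, dotProduct_sub] at f2 f3
  rw [hν0, zero_mul, dotProduct_sub] at g2 g3
  -- The remaining value is orthogonal to `p 0 - p 2`, `p 0 - p 3` and `p 1 - p 2`, which span the
  -- space.
  refine hb.eq_zero_of_dot 2 _ fun i => ?_
  rw [dotProduct_sub]
  fin_cases i
  · simpa using f2
  · simpa using g2
  · simp
  · simp only [Fin.reduceFinMk]; linarith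

/-! ### The neighbourhood of a vertex -/

/-- The relations at the lattice simplex below `(a, b, c, d)` when the field vanishes at its
vertex opposite to the face of constant last entry. -/
def VertexSim (g : Fin 3 → Fin 3 → ℝ) (Q : Fin 3 → ℤ → ℤ → ℤ → ℝ) (a b c : ℤ) : Prop :=
  ∃ μ : ℝ, (1 ≤ a → Q 0 (a - 1) b c = μ * g 0 0) ∧ (1 ≤ b → Q 1 a (b - 1) c = μ * g 1 1) ∧
    (1 ≤ c → Q 2 a b (c - 1) = μ * g 2 2) ∧
    (1 ≤ a → 1 ≤ b → Q 1 (a - 1) b c + Q 0 a (b - 1) c = 2 * μ * g 0 1) ∧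
    (1 ≤ a → 1 ≤ c → Q 2 (a - 1) b c + Q 0 a b (c - 1) = 2 * μ * g 0 2) ∧
    (1 ≤ b → 1 ≤ c → Q 2 a (b - 1) c + Q 1 a b (c - 1) = 2 * μ * g 1 2)

theorem ConfAt.vertexSim {p : Fin 4 → Fin 3 → ℝ} {q : (Fin 4 → ℤ) → Fin 3 → ℝ} {a b c d : ℤ}
    (h : ConfAt p q ![a, b, c, d]) (hd : 1 ≤ d) (h0 : q ![a, b, c, d - 1] = 0) :
    VertexSim (fun i j => (p i.castSucc - p 3) ⬝ᵥ (p j.castSucc - p 3))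
      (fun i a b c => q ![a, b, c, d] ⬝ᵥ (p i.castSucc - p 3)) a b c := by
  obtain ⟨μ, hμ⟩ := h
  have h3 : 1 ≤ (![a, b, c, d] : Fin 4 → ℤ) 3 := hd
  have e0 := fun ha => hμ 0 3 ha h3
  have e1 := fun ha => hμ 1 3 ha h3
  have e2 := fun ha => hμ 2 3 ha h3
  have e01 := hμ 0 1
  have e02 := hμ 0 2
  have e12 := hμ 1 2
  simp only [vec_sub_single₀, vec_sub_single₁, vec_sub_single₂, vec_sub_single₃, h0, sub_zero]
    at e0 e1 e2 e01 e02 e12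
  -- Polarisation again, now with the origin at the vertex where the field vanishes.
  have key : ∀ x y t s r : Fin 3 → ℝ, x ⬝ᵥ (t - r) = μ * ((t - r) ⬝ᵥ (t - r)) →
      y ⬝ᵥ (s - r) = μ * ((s - r) ⬝ᵥ (s - r)) →
      (x - y) ⬝ᵥ (t - s) = μ * ((t - s) ⬝ᵥ (t - s)) →
      x ⬝ᵥ (s - r) + y ⬝ᵥ (t - r) = 2 * μ * ((t - r) ⬝ᵥ (s - r)) := by
    intro x y t s r h1 h2 h3
    simp only [dotProduct, Fin.sum_univ_three, Pi.sub_apply] at h1 h2 h3 ⊢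
    linear_combination h1 + h2 - h3
  exact ⟨μ, e0, e1, e2, fun ha hb => key _ _ _ _ _ (e0 ha) (e1 hb) (e01 ha hb),
    fun ha hc => key _ _ _ _ _ (e0 ha) (e2 hc) (e02 ha hc),
    fun hb hc => key _ _ _ _ _ (e1 hb) (e2 hc) (e12 hb hc)⟩

/-- The determinant of a symmetric matrix. -/
def symDet (g : Fin 3 → Fin 3 → ℝ) : ℝ :=
  g 0 0 * g 1 1 * g 2 2 + 2 * (g 1 2 * g 0 2 * g 0 1) - g 0 0 * g 1 2 ^ 2 - g 1 1 * g 0 2 ^ 2 -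
    g 2 2 * g 0 1 ^ 2

/-- This is the Gram determinant of the three edges at vertex 3, hence the square of their
determinant. -/
theorem Bary.symDet_ne_zero {p G : Fin 4 → Fin 3 → ℝ} {h : Fin 4 → ℝ} (hb : Bary p G h) :
    symDet (fun i j => (p i.castSucc - p 3) ⬝ᵥ (p j.castSucc - p 3)) ≠ 0 := by
  let T : Matrix (Fin 3) (Fin 3) ℝ := Matrix.of fun i => p i.castSucc - p 3
  let S : Matrix (Fin 3) (Fin 3) ℝ := Matrix.of fun i => G i.castSucc
  have hST : S * Tᵀ = 1 := by
    ext i j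
    rw [Matrix.mul_apply]
    change G i.castSucc ⬝ᵥ (p j.castSucc - p 3) = _
    have h3 : i.castSucc ≠ (3 : Fin 4) := Fin.castSucc_ne_last i
    rw [hb.grad_dot_sub, if_neg h3, sub_zero, Matrix.one_apply]
    simp
  have hdet : T.det ≠ 0 := by
    intro h0
    have := congrArg Matrix.det hST
    rw [Matrix.det_mul, Matrix.det_transpose, h0] at this
    simp at this
  have : symDet (fun i j => (p i.castSucc - p 3) ⬝ᵥ (p j.castSucc - p 3)) = T.det ^ 2 := by
    have hT : ∀ i j, T i j = (p i.castSucc - p 3) j := fun _ _ => rfl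
    rw [Matrix.det_fin_three]
    simp only [hT, symDet, dotProduct, Fin.sum_univ_three]
    ring
  rw [this]
  exact pow_ne_zero 2 hdet
end

/-! ### The linear systems for the conformal factors near a vertex -/

section

/-- The unknowns are conformal factors of eight lattice simplices; `a, b, c` are the diagonal and
`x, y, z` the off-diagonal entries of the Gram matrix, and `hd` says that its determinant is
nonzero. -/
theorem vertex_system_five {a b c x y z : ℝ} (ha : a ≠ 0) (hb : b ≠ 0) (hc : c ≠ 0)
    (hd : a * b * c + 2 * (x * y * z) - a * x ^ 2 - b * y ^ 2 - c * z ^ 2 ≠ 0)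
    {A B C D E F s t : ℝ} (i1 : b * D + a * B = 2 * z * s) (i2 : c * F + a * A = 2 * y * s)
    (i3 : c * E + b * C = 2 * x * s) (j1 : 2 * z * A - b * C = 2 * y * B - c * E)
    (j2 : 2 * z * C - a * A = 2 * x * D - c * F) (j3 : 2 * y * E - a * B = 2 * x * F - b * D)
    (l1 : 2 * x * A - c * B = b * t) (l2 : 2 * x * C + 2 * y * A - 2 * c * s = 2 * z * t) :
    A = 0 ∧ B = 0 ∧ C = 0 ∧ D = 0 ∧ E = 0 ∧ F = 0 ∧ s = 0 := by
  -- The residuals `a A - y s`, `a B - z s`, `b C - x s` solve a homogeneous system whose matrix is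
  -- the Gram matrix up to order and signs. The multipliers below are rows of its adjugate;
  -- eliminating `t` from `l1` and `l2` then gives `s = 0`.
  have r1 : b * (a * A - y * s) - x * (a * B - z * s) - z * (b * C - x * s) = 0 := by
    linear_combination (-b * j2 + b * i2 - 2 * x * i1) / 2
  have r2 : -x * (a * A - y * s) + c * (a * B - z * s) + y * (b * C - x * s) = 0 := by
    linear_combination (-c * j3 + c * i1 - 2 * x * i2 + 2 * y * i3) / 2
  have r3 : -z * (a * A - y * s) + y * (a * B - z * s) + a * (b * C - x * s) = 0 := by
    linear_combination (-a * j1 + a * i3) / 2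
  have hA : a * A - y * s = 0 := by
    refine (mul_eq_zero.mp ?_).resolve_left hd
    linear_combination (a * c - y ^ 2) * r1 + (x * a - y * z) * r2 + (z * c - x * y) * r3
  have hB : a * B - z * s = 0 := by
    refine (mul_eq_zero.mp ?_).resolve_left hd
    linear_combination (x * a - y * z) * r1 + (a * b - z ^ 2) * r2 + (x * z - b * y) * r3
  have hC : b * C - x * s = 0 := by
    refine (mul_eq_zero.mp ?_).resolve_left hd
    linear_combination (z * c - x * y) * r1 + (x * z - b * y) * r2 + (b * c - x ^ 2) * r3
  have hs : s = 0 := by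
    refine (mul_eq_zero.mp ?_).resolve_left hd
    linear_combination -(a * b / 2) * l2 + a * z * l1 + a * x * hC + (b * y - 2 * x * z) * hA +
      c * z * hB
  subst hs
  simp only [mul_zero, sub_zero] at hA hB hC
  rw [hB, add_zero, mul_zero] at i1
  rw [hA, add_zero, mul_zero] at i2
  rw [hC, add_zero, mul_zero] at i3
  simp_all

theorem vertex_system_four {a b c x y z : ℝ} (ha : a ≠ 0) (hb : b ≠ 0) (hc : c ≠ 0)
    (hd : a * b * c + 2 * (x * y * z) - a * x ^ 2 - b * y ^ 2 - c * z ^ 2 ≠ 0)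
    {m0 m1 m2 n0 n1 n2 w01 w02 w10 w12 w20 w21 : ℝ}
    (C0 : b * m1 + a * m0 = 2 * z * n2) (C1 : c * m2 + a * m0 = 2 * y * n1)
    (C2 : c * m2 + b * m1 = 2 * x * n0)
    (D01 : c * n0 + a * w01 = 2 * y * n2) (D10 : c * n1 + b * w10 = 2 * x * n2)
    (D02 : b * n0 + a * w02 = 2 * z * n1) (D20 : b * n2 + c * w20 = 2 * x * n1)
    (D12 : a * n1 + b * w12 = 2 * z * n0) (D21 : a * n2 + c * w21 = 2 * y * n0)
    (B0 : b * w01 + c * w02 = 2 * x * m0) (B1 : a * w10 + c * w12 = 2 * y * m1)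
    (B2 : a * w20 + b * w21 = 2 * z * m2) :
    (m0 = 0 ∧ m1 = 0 ∧ m2 = 0) ∧ (n0 = 0 ∧ n1 = 0 ∧ n2 = 0) ∧
      (w01 = 0 ∧ w02 = 0 ∧ w10 = 0 ∧ w12 = 0 ∧ w20 = 0 ∧ w21 = 0) := by
  -- `R0`, `R1`, `R2` say that the adjugate of the Gram matrix kills `(n0, n1, n2)`; multiplying by
  -- the Gram matrix leaves its determinant times each `n`.
  have R0 : (b * c - x ^ 2) * n0 - (b * y - x * z) * n2 - (c * z - x * y) * n1 = 0 := by
    linear_combination (-a * B0 + b * D01 + c * D02 - x * (C0 + C1 - C2)) / 2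
  have R1 : (a * c - y ^ 2) * n1 - (a * x - y * z) * n2 - (c * z - x * y) * n0 = 0 := by
    linear_combination (-b * B1 + a * D10 + c * D12 - y * (C0 + C2 - C1)) / 2
  have R2 : (a * b - z ^ 2) * n2 - (a * x - y * z) * n1 - (b * y - x * z) * n0 = 0 := by
    linear_combination (-c * B2 + a * D20 + b * D21 - z * (C1 + C2 - C0)) / 2
  have h0 : n0 = 0 := by
    refine (mul_eq_zero.mp ?_).resolve_left hd
    linear_combination a * R0 + z * R1 + y * R2
  have h1 : n1 = 0 := by
    refine (mul_eq_zero.mp ?_).resolve_left hd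
    linear_combination z * R0 + b * R1 + x * R2
  have h2 : n2 = 0 := by
    refine (mul_eq_zero.mp ?_).resolve_left hd
    linear_combination y * R0 + x * R1 + c * R2
  subst h0 h1 h2
  have k0 : a * m0 = 0 := by linear_combination (C0 + C1 - C2) / 2
  have k1 : b * m1 = 0 := by linear_combination (C0 + C2 - C1) / 2
  have k2 : c * m2 = 0 := by linear_combination (C1 + C2 - C0) / 2
  simp_all

theorem vertexSim_layer_five {g : Fin 3 → Fin 3 → ℝ} (h0 : g 0 0 ≠ 0) (h1 : g 1 1 ≠ 0)
    (h2 : g 2 2 ≠ 0) (hd : symDet g ≠ 0) {Q : Fin 3 → ℤ → ℤ → ℤ → ℝ}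
    (s321 : VertexSim g Q 3 2 1) (s312 : VertexSim g Q 3 1 2) (s231 : VertexSim g Q 2 3 1)
    (s132 : VertexSim g Q 1 3 2) (s213 : VertexSim g Q 2 1 3) (s123 : VertexSim g Q 1 2 3)
    (s222 : VertexSim g Q 2 2 2) (s330 : VertexSim g Q 3 3 0) :
    ∀ i, Q i 0 2 3 = 0 ∧ Q i 1 1 3 = 0 ∧ Q i 1 2 2 = 0 := by
  obtain ⟨A, A1, A2, A3, A4, A5, A6⟩ := s321
  obtain ⟨B, B1, B2, B3, B4, B5, B6⟩ := s312
  obtain ⟨C, C1, C2, C3, C4, C5, C6⟩ := s231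
  obtain ⟨D, D1, D2, D3, D4, D5, D6⟩ := s132
  obtain ⟨E, E1, E2, E3, E4, E5, E6⟩ := s213
  obtain ⟨F, F1, F2, F3, F4, F5, F6⟩ := s123
  obtain ⟨s, S1, S2, S3, S4, S5, S6⟩ := s222
  obtain ⟨t, T1, T2, -, T4, -, -⟩ := s330
  simp only [Int.reduceSub, Int.reduceLE, forall_const] at *
  rw [symDet] at hd
  -- Each equation of the system comes from eliminating the field values shared by neighbouring
  -- simplices. Once the conformal factors vanish, so do the field values.
  obtain ⟨rfl, rfl, rfl, rfl, rfl, rfl, rfl⟩ := vertex_system_five (A := A) (B := B) (C := C)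
    (D := D) (E := E) (F := F) (s := s) (t := t) h0 h1 h2 hd (by linarith) (by linarith)
    (by linarith) (by linarith) (by linarith) (by linarith) (by linarith) (by linarith)
  intro i
  fin_cases i <;> simp only [Fin.zero_eta, Fin.mk_one, Fin.reduceFinMk] <;>
    refine ⟨?_, ?_, ?_⟩ <;> linarith

theorem vertexSim_layer_four {g : Fin 3 → Fin 3 → ℝ} (h0 : g 0 0 ≠ 0) (h1 : g 1 1 ≠ 0)
    (h2 : g 2 2 ≠ 0) (hd : symDet g ≠ 0) {Q : Fin 3 → ℤ → ℤ → ℤ → ℝ}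
    (s311 : VertexSim g Q 3 1 1) (s131 : VertexSim g Q 1 3 1) (s113 : VertexSim g Q 1 1 3)
    (s221 : VertexSim g Q 2 2 1) (s212 : VertexSim g Q 2 1 2) (s122 : VertexSim g Q 1 2 2)
    (s320 : VertexSim g Q 3 2 0) (s302 : VertexSim g Q 3 0 2) (s230 : VertexSim g Q 2 3 0)
    (s032 : VertexSim g Q 0 3 2) (s203 : VertexSim g Q 2 0 3) (s023 : VertexSim g Q 0 2 3) :
    ∀ i, Q i 0 1 3 = 0 ∧ Q i 0 2 2 = 0 ∧ Q i 1 1 2 = 0 := by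
  obtain ⟨m0, A1, A2, A3, A4, A5, A6⟩ := s311
  obtain ⟨m1, B1, B2, B3, B4, B5, B6⟩ := s131
  obtain ⟨m2, C1, C2, C3, C4, C5, C6⟩ := s113
  obtain ⟨n2, D1, D2, D3, D4, D5, D6⟩ := s221
  obtain ⟨n1, E1, E2, E3, E4, E5, E6⟩ := s212
  obtain ⟨n0, F1, F2, F3, F4, F5, F6⟩ := s122
  obtain ⟨w01, G1, G2, -, G4, -, -⟩ := s320
  obtain ⟨w02, H1, -, H3, -, H5, -⟩ := s302
  obtain ⟨w10, I1, I2, -, I4, -, -⟩ := s230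
  obtain ⟨w12, -, J2, J3, -, -, J6⟩ := s032
  obtain ⟨w20, K1, -, K3, -, K5, -⟩ := s203
  obtain ⟨w21, -, L2, L3, -, -, L6⟩ := s023
  simp only [Int.reduceSub, Int.reduceLE, forall_const] at *
  rw [symDet] at hd
  obtain ⟨⟨rfl, rfl, rfl⟩, ⟨rfl, rfl, rfl⟩, rfl, rfl, rfl, rfl, rfl, rfl⟩ := vertex_system_four
    (m0 := m0) (m1 := m1) (m2 := m2) (n0 := n0) (n1 := n1) (n2 := n2) (w01 := w01) (w02 := w02)
    (w10 := w10) (w12 := w12) (w20 := w20) (w21 := w21) h0 h1 h2 hd (by linarith) (by linarith)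
    (by linarith) (by linarith) (by linarith) (by linarith) (by linarith) (by linarith)
    (by linarith) (by linarith) (by linarith) (by linarith)
  intro i
  fin_cases i <;> simp only [Fin.zero_eta, Fin.mk_one, Fin.reduceFinMk] <;>
    refine ⟨?_, ?_, ?_⟩ <;> linarith
end

/-! ### Descent to the boundary layers and the classification -/

section

variable {k F E V : ℤ}

theorem isAdm_vec {a b c d : ℤ} : IsAdm k F E V ![a, b, c, d] ↔ a + b + c + d = k ∧
    (F ≤ a ∧ F ≤ b ∧ F ≤ c ∧ F ≤ d) ∧
    (E ≤ a + b ∧ E ≤ a + c ∧ E ≤ a + d ∧ E ≤ b + c ∧ E ≤ b + d ∧ E ≤ c + d) ∧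
    (a ≤ k - V ∧ b ≤ k - V ∧ c ≤ k - V ∧ d ≤ k - V) :=
  isAdm_iff

theorem eq_vec (α : Fin 4 → ℤ) : α = ![α 0, α 1, α 2, α 3] := by
  ext i; fin_cases i <;> rfl

theorem exists_perm_pair : ∀ i j : Fin 4, i ≠ j → ∃ σ : Equiv.Perm (Fin 4), σ 0 = i ∧ σ 1 = j := by
  decide

/-- A discrete conformal Killing field with respect to a nondegenerate simplex. -/
structure SimField (k F E V : ℤ) (p : Fin 4 → Fin 3 → ℝ) (q : (Fin 4 → ℤ) → Fin 3 → ℝ) :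
    Prop where
  bary : ∃ G h, Bary p G h
  conf : ∀ β, IsAdm k F E V β → ConfAt p q β

theorem SimField.comp_perm {p : Fin 4 → Fin 3 → ℝ} {q : (Fin 4 → ℤ) → Fin 3 → ℝ}
    (hq : SimField k F E V p q) (σ : Equiv.Perm (Fin 4)) :
    SimField k F E V (p ∘ σ) (fun α => q (α ∘ σ.symm)) where
  bary := by
    obtain ⟨G, h, hb⟩ := hq.bary
    exact ⟨_, _, hb.comp_perm σ⟩
  conf β hβ := ConfAt.comp_perm σ (hq.conf _ (hβ.comp_perm σ.symm))

theorem comp_comp_symm (α : Fin 4 → ℤ) (σ : Equiv.Perm (Fin 4)) : (α ∘ σ) ∘ σ.symm = α := by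
  ext i; simp

/-- An exponent with a pair sum below `s` lies next to an edge; after a permutation the small pair
has indices 0 and 1, and `edge_rule` obtains its value from exponents with pair sum `s`. The bound
on `W` keeps the other two entries positive. -/
theorem SimField.edge_step {p : Fin 4 → Fin 3 → ℝ} {q : (Fin 4 → ℤ) → Fin 3 → ℝ}
    (hq : SimField k 0 E V p q) {s W : ℤ} (hE : E ≤ s) (hs : s ≤ 3) (hW : 6 ≤ W)
    (hVW : V ≤ W + 1) (h : ∀ α, IsAdm (k - 1) 0 s W α → q α = 0)
    {α : Fin 4 → ℤ} (hα : IsAdm (k - 1) 0 (s - 1) W α) : q α = 0 := by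
  by_cases hp : ∀ i j, i ≠ j → s ≤ α i + α j
  · exact h α ⟨hα.1, hα.2.1, hp, hα.2.2.2⟩
  push Not at hp
  obtain ⟨i, j, hij, hlt⟩ := hp
  obtain ⟨σ, rfl, rfl⟩ := exists_perm_pair i j hij
  have hq' := hq.comp_perm σ
  have hα' := hα.comp_perm σ
  have h' : ∀ β, IsAdm (k - 1) 0 s W β → q (β ∘ σ.symm) = 0 := fun β hβ =>
    h _ (hβ.comp_perm σ.symm)
  rw [← comp_comp_symm α σ]
  change (fun α => q (α ∘ σ.symm)) (α ∘ σ) = 0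
  rw [eq_vec (α ∘ σ)] at hα' ⊢
  change (α ∘ σ) 0 + (α ∘ σ) 1 < s at hlt
  generalize (α ∘ σ) 0 = a at *
  generalize (α ∘ σ) 1 = b at *
  generalize (α ∘ σ) 2 = c at *
  generalize (α ∘ σ) 3 = d at *
  rw [isAdm_vec] at hα'
  obtain ⟨G, g, hb⟩ := hq'.bary
  refine edge_rule hb (by omega) (by omega) (by omega) (by omega)
    (hq'.conf _ (isAdm_vec.mpr (by omega))) (hq'.conf _ (isAdm_vec.mpr (by omega)))
    (h' _ (isAdm_vec.mpr (by omega))) (h' _ (isAdm_vec.mpr (by omega)))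
    (h' _ (isAdm_vec.mpr (by omega))) (h' _ (isAdm_vec.mpr (by omega)))

theorem Bary.eq_zero_of_castSucc {p G : Fin 4 → Fin 3 → ℝ} {h : Fin 4 → ℝ} (hb : Bary p G h)
    (x : Fin 3 → ℝ) (hx : ∀ i : Fin 3, x ⬝ᵥ (p i.castSucc - p 3) = 0) : x = 0 := by
  refine hb.eq_zero_of_dot 3 x fun i => ?_
  induction i using Fin.lastCases with
  | last => simp [show Fin.last 3 = (3 : Fin 4) from rfl]
  | cast i => exact hx i

/-- The simplices below `(a, b, c, k - 6)` with `a + b + c = 6` have one vertex in the layer where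
the field is known to vanish and the others in the layer `a + b + c = 5`. -/
theorem SimField.layer_five {p : Fin 4 → Fin 3 → ℝ} {q : (Fin 4 → ℤ) → Fin 3 → ℝ}
    (hq : SimField k 0 2 V p q) (hV : V ≤ 6) (hk : 10 ≤ k)
    (h : ∀ α, IsAdm (k - 1) 0 1 6 α → q α = 0) :
    q ![0, 2, 3, k - 6] = 0 ∧ q ![1, 1, 3, k - 6] = 0 ∧ q ![1, 2, 2, k - 6] = 0 := by
  obtain ⟨G, g, hb⟩ := hq.bary
  have hs : ∀ a b c : ℤ, a + b + c = 6 → 0 ≤ a → 0 ≤ b → 0 ≤ c → a ≤ 3 → b ≤ 3 → c ≤ 3 →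
      2 ≤ a + b → 2 ≤ a + c → 2 ≤ b + c → VertexSim _ _ a b c := fun a b c _ _ _ _ _ _ _ _ _ _ =>
    (hq.conf ![a, b, c, k - 6] (isAdm_vec.mpr (by omega))).vertexSim (by omega)
      (h _ (isAdm_vec.mpr (by omega)))
  have hz := vertexSim_layer_five (hb.edge_sq_ne_zero (by decide))
    (hb.edge_sq_ne_zero (by decide)) (hb.edge_sq_ne_zero (by decide)) hb.symDet_ne_zero
    (hs 3 2 1 (by norm_num) (by norm_num) (by norm_num) (by norm_num) (by norm_num) (by norm_num)
      (by norm_num) (by norm_num) (by norm_num) (by norm_num))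
    (hs 3 1 2 (by norm_num) (by norm_num) (by norm_num) (by norm_num) (by norm_num) (by norm_num)
      (by norm_num) (by norm_num) (by norm_num) (by norm_num))
    (hs 2 3 1 (by norm_num) (by norm_num) (by norm_num) (by norm_num) (by norm_num) (by norm_num)
      (by norm_num) (by norm_num) (by norm_num) (by norm_num))
    (hs 1 3 2 (by norm_num) (by norm_num) (by norm_num) (by norm_num) (by norm_num) (by norm_num)
      (by norm_num) (by norm_num) (by norm_num) (by norm_num))
    (hs 2 1 3 (by norm_num) (by norm_num) (by norm_num) (by norm_num) (by norm_num) (by norm_num)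
      (by norm_num) (by norm_num) (by norm_num) (by norm_num))
    (hs 1 2 3 (by norm_num) (by norm_num) (by norm_num) (by norm_num) (by norm_num) (by norm_num)
      (by norm_num) (by norm_num) (by norm_num) (by norm_num))
    (hs 2 2 2 (by norm_num) (by norm_num) (by norm_num) (by norm_num) (by norm_num) (by norm_num)
      (by norm_num) (by norm_num) (by norm_num) (by norm_num))
    (hs 3 3 0 (by norm_num) (by norm_num) (by norm_num) (by norm_num) (by norm_num) (by norm_num)
      (by norm_num) (by norm_num) (by norm_num) (by norm_num))
  exact ⟨hb.eq_zero_of_castSucc _ fun i => (hz i).1, hb.eq_zero_of_castSucc _ fun i => (hz i).2.1,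
    hb.eq_zero_of_castSucc _ fun i => (hz i).2.2⟩

theorem SimField.layer_five_corner {p : Fin 4 → Fin 3 → ℝ} {q : (Fin 4 → ℤ) → Fin 3 → ℝ}
    (hq : SimField k 0 2 V p q) (hV : V ≤ 6) (hk : 10 ≤ k)
    (h : ∀ α, IsAdm (k - 1) 0 1 6 α → q α = 0) : q ![0, 1, 4, k - 6] = 0 := by
  obtain ⟨G, g, hb⟩ := hq.bary
  obtain ⟨h1, h2, -⟩ := hq.layer_five hV hk h
  have h12 : q ![1, 1, 4, k - 7] = 0 ∧ q ![0, 2, 4, k - 7] = 0 := by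
    -- For `k = 10` the third entry 4 equals `k - 6`, so these exponents lie in the unknown layer of
    -- vertex 2; swapping vertices 2 and 3 reduces them to `layer_five`.
    rcases hk.eq_or_lt with rfl | hk'
    · obtain ⟨h3, h4, -⟩ := (hq.comp_perm (Equiv.swap 2 3)).layer_five hV hk fun α hα =>
        h _ (hα.comp_perm _)
      have hsw : ∀ a b c d : ℤ, ![a, b, c, d] ∘ (Equiv.swap (2 : Fin 4) 3).symm = ![a, b, d, c] := by
        intro a b c d
        ext i
        fin_cases i <;> rfl
      simp only [hsw] at h3 h4
      exact ⟨h4, h3⟩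
    · exact ⟨h _ (isAdm_vec.mpr (by omega)), h _ (isAdm_vec.mpr (by omega))⟩
  rw [show k - 7 = k - 6 - 1 by ring] at h12
  exact edge_rule hb (by norm_num) (by norm_num) (by norm_num) (by omega)
    (hq.conf _ (isAdm_vec.mpr (by omega))) (hq.conf _ (isAdm_vec.mpr (by omega)))
    h2 h12.1 h1 h12.2

theorem SimField.layer_five_step {p : Fin 4 → Fin 3 → ℝ} {q : (Fin 4 → ℤ) → Fin 3 → ℝ}
    (hq : SimField k 0 2 V p q) (hV : V ≤ 6) (hk : 10 ≤ k)
    (h : ∀ α, IsAdm (k - 1) 0 1 6 α → q α = 0) {α : Fin 4 → ℤ} (hα : IsAdm (k - 1) 0 1 5 α) :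
    q α = 0 := by
  obtain ⟨σ, h01, h12, h23⟩ := exists_sorted α
  have hq' := hq.comp_perm σ
  have hα' := hα.comp_perm σ
  have h' : ∀ β, IsAdm (k - 1) 0 1 6 β → q (β ∘ σ.symm) = 0 := fun β hβ =>
    h _ (hβ.comp_perm σ.symm)
  obtain ⟨e1, e2, e3⟩ := hq'.layer_five hV hk h'
  have e4 := hq'.layer_five_corner hV hk h'
  rw [← comp_comp_symm α σ]
  rw [eq_vec (α ∘ σ)] at hα' ⊢
  change (α ∘ σ) 0 ≤ (α ∘ σ) 1 at h01
  change (α ∘ σ) 1 ≤ (α ∘ σ) 2 at h12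
  change (α ∘ σ) 2 ≤ (α ∘ σ) 3 at h23
  generalize (α ∘ σ) 0 = a at *
  generalize (α ∘ σ) 1 = b at *
  generalize (α ∘ σ) 2 = c at *
  generalize (α ∘ σ) 3 = d at *
  by_cases hd : d ≤ k - 7
  · exact h' _ (by rw [isAdm_vec] at hα' ⊢; omega)
  rw [isAdm_vec] at hα'
  obtain rfl : d = k - 6 := by omega
  -- Up to order these are all triples of sum 5 with pair sums at least one.
  have : (a = 0 ∧ b = 1 ∧ c = 4) ∨ (a = 0 ∧ b = 2 ∧ c = 3) ∨ (a = 1 ∧ b = 1 ∧ c = 3) ∨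
      (a = 1 ∧ b = 2 ∧ c = 2) := by omega
  rcases this with ⟨rfl, rfl, rfl⟩ | ⟨rfl, rfl, rfl⟩ | ⟨rfl, rfl, rfl⟩ | ⟨rfl, rfl, rfl⟩
  · exact e4
  · exact e1
  · exact e2
  · exact e3

theorem SimField.layer_four {p : Fin 4 → Fin 3 → ℝ} {q : (Fin 4 → ℤ) → Fin 3 → ℝ}
    (hq : SimField k 0 2 V p q) (hV : V ≤ 5) (hk : 10 ≤ k)
    (h : ∀ α, IsAdm (k - 1) 0 1 5 α → q α = 0) :
    q ![0, 1, 3, k - 5] = 0 ∧ q ![0, 2, 2, k - 5] = 0 ∧ q ![1, 1, 2, k - 5] = 0 := by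
  obtain ⟨G, g, hb⟩ := hq.bary
  have hs : ∀ a b c : ℤ, a + b + c = 5 → 0 ≤ a → 0 ≤ b → 0 ≤ c → a ≤ 3 → b ≤ 3 → c ≤ 3 →
      VertexSim _ _ a b c := fun a b c _ _ _ _ _ _ _ =>
    (hq.conf ![a, b, c, k - 5] (isAdm_vec.mpr (by omega))).vertexSim (by omega)
      (h _ (isAdm_vec.mpr (by omega)))
  have hz := vertexSim_layer_four (hb.edge_sq_ne_zero (by decide))
    (hb.edge_sq_ne_zero (by decide)) (hb.edge_sq_ne_zero (by decide)) hb.symDet_ne_zero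
    (hs 3 1 1 (by norm_num) (by norm_num) (by norm_num) (by norm_num) (by norm_num) (by norm_num)
      (by norm_num))
    (hs 1 3 1 (by norm_num) (by norm_num) (by norm_num) (by norm_num) (by norm_num) (by norm_num)
      (by norm_num))
    (hs 1 1 3 (by norm_num) (by norm_num) (by norm_num) (by norm_num) (by norm_num) (by norm_num)
      (by norm_num))
    (hs 2 2 1 (by norm_num) (by norm_num) (by norm_num) (by norm_num) (by norm_num) (by norm_num)
      (by norm_num))
    (hs 2 1 2 (by norm_num) (by norm_num) (by norm_num) (by norm_num) (by norm_num) (by norm_num)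
      (by norm_num))
    (hs 1 2 2 (by norm_num) (by norm_num) (by norm_num) (by norm_num) (by norm_num) (by norm_num)
      (by norm_num))
    (hs 3 2 0 (by norm_num) (by norm_num) (by norm_num) (by norm_num) (by norm_num) (by norm_num)
      (by norm_num))
    (hs 3 0 2 (by norm_num) (by norm_num) (by norm_num) (by norm_num) (by norm_num) (by norm_num)
      (by norm_num))
    (hs 2 3 0 (by norm_num) (by norm_num) (by norm_num) (by norm_num) (by norm_num) (by norm_num)
      (by norm_num))
    (hs 0 3 2 (by norm_num) (by norm_num) (by norm_num) (by norm_num) (by norm_num) (by norm_num)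
      (by norm_num))
    (hs 2 0 3 (by norm_num) (by norm_num) (by norm_num) (by norm_num) (by norm_num) (by norm_num)
      (by norm_num))
    (hs 0 2 3 (by norm_num) (by norm_num) (by norm_num) (by norm_num) (by norm_num) (by norm_num)
      (by norm_num))
  exact ⟨hb.eq_zero_of_castSucc _ fun i => (hz i).1, hb.eq_zero_of_castSucc _ fun i => (hz i).2.1,
    hb.eq_zero_of_castSucc _ fun i => (hz i).2.2⟩

theorem SimField.layer_four_step {p : Fin 4 → Fin 3 → ℝ} {q : (Fin 4 → ℤ) → Fin 3 → ℝ}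
    (hq : SimField k 0 2 V p q) (hV : V ≤ 5) (hk : 10 ≤ k)
    (h : ∀ α, IsAdm (k - 1) 0 1 5 α → q α = 0) {α : Fin 4 → ℤ} (hα : IsAdm (k - 1) 0 1 4 α) :
    q α = 0 := by
  obtain ⟨σ, h01, h12, h23⟩ := exists_sorted α
  have hq' := hq.comp_perm σ
  have hα' := hα.comp_perm σ
  have h' : ∀ β, IsAdm (k - 1) 0 1 5 β → q (β ∘ σ.symm) = 0 := fun β hβ =>
    h _ (hβ.comp_perm σ.symm)
  obtain ⟨e1, e2, e3⟩ := hq'.layer_four hV hk h'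
  rw [← comp_comp_symm α σ]
  rw [eq_vec (α ∘ σ)] at hα' ⊢
  change (α ∘ σ) 0 ≤ (α ∘ σ) 1 at h01
  change (α ∘ σ) 1 ≤ (α ∘ σ) 2 at h12
  change (α ∘ σ) 2 ≤ (α ∘ σ) 3 at h23
  generalize (α ∘ σ) 0 = a at *
  generalize (α ∘ σ) 1 = b at *
  generalize (α ∘ σ) 2 = c at *
  generalize (α ∘ σ) 3 = d at *
  by_cases hd : d ≤ k - 6
  · exact h' _ (by rw [isAdm_vec] at hα' ⊢; omega)
  rw [isAdm_vec] at hα'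
  obtain rfl : d = k - 5 := by omega
  have : (a = 0 ∧ b = 1 ∧ c = 3) ∨ (a = 0 ∧ b = 2 ∧ c = 2) ∨ (a = 1 ∧ b = 1 ∧ c = 2) := by omega
  rcases this with ⟨rfl, rfl, rfl⟩ | ⟨rfl, rfl, rfl⟩ | ⟨rfl, rfl, rfl⟩
  · exact e1
  · exact e2
  · exact e3

/-- Classification of the discrete conformal Killing fields. -/
theorem SimField.exists_discCK {p : Fin 4 → Fin 3 → ℝ} {q : (Fin 4 → ℤ) → Fin 3 → ℝ}
    (hq : SimField k F E V p q) (hF : 0 ≤ F) (hE : 2 * F + 2 ≤ E) (hV : 2 * E + 1 ≤ V)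
    (hk : 2 * V ≤ k) : ∃ a c d b, ∀ α, IsAdm (k - 1) (max (F - 1) 0) (E - 1) (V - 1) α →
      q α = discCK p a c d b α := by
  obtain ⟨G, g, hb⟩ := hq.bary
  obtain ⟨a, c, d, b, hcore⟩ := exists_discCK_core hb hF hE hV hk hq.conf
  have hq' : SimField k F E V p (q - discCK p a c d b) :=
    ⟨hq.bary, fun β hβ => (hq.conf β hβ).sub (confAt_discCK p a c d b β)⟩
  refine ⟨a, c, d, b, fun α hα => sub_eq_zero.mp ?_⟩
  change (q - discCK p a c d b) α = 0
  generalize q - discCK p a c d b = q at hq' hcore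
  -- For `4 ≤ E` the core reaches every exponent. Otherwise `F = 0` and `E` is 2 or 3: the core
  -- reaches pair sums at least 3 and triple sums at least 6, and the missing layers are added one
  -- at a time, first at edges and then at vertices. Vertex layers are needed only for `E = 2` and
  -- `V` equal to 5 or 6.
  by_cases hE4 : 4 ≤ E
  · obtain ⟨γ, hγ, i, j, l, rfl⟩ := exists_core hF hE hV hk hα (.inl hE4)
    exact hcore γ hγ i j l
  obtain rfl : F = 0 := by omega
  rw [show max ((0 : ℤ) - 1) 0 = 0 by norm_num] at hα
  have s3 : ∀ α, IsAdm (k - 1) 0 3 (max 6 (V - 1)) α → q α = 0 := by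
    intro α hα
    obtain ⟨γ, hγ, i, j, l, rfl⟩ := exists_core hF hE hV hk
      (hα.mono (by norm_num) (by omega) (le_max_right _ _))
      (.inr ⟨hα.2.2.1, fun i => (hα.2.2.2 i).trans (by omega)⟩)
    exact hcore γ hγ i j l
  have s2 : ∀ α, IsAdm (k - 1) 0 2 (max 6 (V - 1)) α → q α = 0 := fun α hα =>
    hq'.edge_step (s := 3) (by omega) (by norm_num) (le_max_left _ _) (by omega) s3 hα
  by_cases hE3 : E = 3
  · exact s2 α (hα.mono le_rfl (by omega) (by omega))
  obtain rfl : E = 2 := by omega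
  have s1 : ∀ α, IsAdm (k - 1) 0 1 (max 6 (V - 1)) α → q α = 0 := fun α hα =>
    hq'.edge_step (s := 2) le_rfl (by norm_num) (le_max_left _ _) (by omega) s2 hα
  by_cases hV7 : 7 ≤ V
  · exact s1 α (hα.mono le_rfl (by norm_num) (by omega))
  rw [show max 6 (V - 1) = 6 by omega] at s1
  have t5 : ∀ α, IsAdm (k - 1) 0 1 5 α → q α = 0 := fun α hα =>
    hq'.layer_five_step (by omega) (by omega) s1 hα
  by_cases hV6 : V = 6
  · exact t5 α (hα.mono le_rfl (by norm_num) (by omega))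
  exact hq'.layer_four_step (by omega) (by omega) t5 (hα.mono le_rfl (by norm_num) (by omega))
end

/-! ### Polynomials in barycentric coordinates -/

section

/-- The barycentric coordinates as polynomials. -/
noncomputable def baryPoly (G : Fin 4 → Fin 3 → ℝ) (h : Fin 4 → ℝ) (i : Fin 4) : Poly3 :=
  ∑ k, C (G i k) * X k + C (h i)

/-- Substitution of the barycentric coordinates. -/
noncomputable def baryHom (G : Fin 4 → Fin 3 → ℝ) (h : Fin 4 → ℝ) :
    MvPolynomial (Fin 4) ℝ →ₐ[ℝ] Poly3 :=
  aeval (baryPoly G h)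

section BaryHom

variable {p G : Fin 4 → Fin 3 → ℝ} {h : Fin 4 → ℝ}

theorem eval_baryPoly (x : Fin 3 → ℝ) (i : Fin 4) :
    eval x (baryPoly G h i) = G i ⬝ᵥ x + h i := by
  simp [baryPoly, dotProduct]

theorem eval_baryHom (x : Fin 3 → ℝ) (U : MvPolynomial (Fin 4) ℝ) :
    eval x (baryHom G h U) = eval (fun i => G i ⬝ᵥ x + h i) U := by
  induction U using MvPolynomial.induction_on with
  | C a => simp [baryHom]
  | add p q hp hq => simp [hp, hq]
  | mul_X p i hp => rw [map_mul, map_mul, map_mul, hp, baryHom, aeval_X, eval_X, eval_baryPoly]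

theorem pderiv_baryHom (k : Fin 3) (U : MvPolynomial (Fin 4) ℝ) :
    pderiv k (baryHom G h U) = ∑ i, G i k • baryHom G h (pderiv i U) := by
  have hl : ∀ j, pderiv k (baryPoly G h j) = C (G j k) := fun j => by
    simp [baryPoly, pderiv_X, Pi.single_apply]
  induction U using MvPolynomial.induction_on with
  | C a => simp [baryHom]
  | add p q hp hq => simp [hp, hq, Finset.sum_add_distrib]
  | mul_X p j hp =>
    have hX : baryHom G h (X j) = baryPoly G h j := by simp [baryHom]
    rw [map_mul, hX, Derivation.leibniz, hp, hl]
    simp only [Derivation.leibniz, pderiv_X, map_add, smul_add, Finset.sum_add_distrib,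
      smul_eq_mul, map_mul, hX]
    congr 1
    · rw [Finset.sum_eq_single j]
      · simp [smul_eq_C_mul, mul_comm]
      · intro i _ hij
        simp [hij]
      · simp
    · simp [Finset.mul_sum]

theorem Bary.sum_baryPoly (hb : Bary p G h) : ∑ i, baryPoly G h i = 1 := by
  simp only [baryPoly, Finset.sum_add_distrib]
  rw [Finset.sum_comm]
  simp only [← Finset.sum_mul, ← map_sum, hb.sum_grad, hb.sum_const]
  simp

theorem Bary.sum_smul_baryPoly (hb : Bary p G h) (l : Fin 3) :
    ∑ i, p i l • baryPoly G h i = X l := by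
  simp only [baryPoly, smul_add, Finset.sum_add_distrib, Finset.smul_sum]
  rw [Finset.sum_comm]
  have h1 : ∀ k, ∑ i, p i l • (C (G i k) * X k : Poly3) = C (if k = l then (1 : ℝ) else 0) * X k :=
    fun k => by
      rw [← hb.moment k l, map_sum, Finset.sum_mul]
      exact Finset.sum_congr rfl fun i _ => by
        rw [smul_eq_C_mul, ← mul_assoc, ← C_mul, mul_comm (p i l)]
  have h2 : ∑ i, p i l • (C (h i) : Poly3) = 0 := by
    rw [← C_0, ← hb.moment_const l, map_sum]
    exact Finset.sum_congr rfl fun i _ => by rw [smul_eq_C_mul, ← C_mul, mul_comm (p i l)]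
  rw [h2, add_zero]
  simp only [h1]
  simp [apply_ite C, ite_mul]

/-- The derivative along an edge. -/
theorem Bary.sum_pderiv_edge (hb : Bary p G h) (i j : Fin 4) (U : MvPolynomial (Fin 4) ℝ) :
    ∑ k, (p i - p j) k • pderiv k (baryHom G h U) =
      baryHom G h (pderiv i U - pderiv j U) := by
  simp only [pderiv_baryHom, Finset.smul_sum, smul_smul]
  rw [Finset.sum_comm]
  have : ∀ l, ∑ k, ((p i - p j) k * G l k) • baryHom G h (pderiv l U) =
      ((if l = i then (1 : ℝ) else 0) - (if l = j then 1 else 0)) • baryHom G h (pderiv l U) :=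
    fun l => by
      rw [← hb.grad_dot_sub l i j, ← Finset.sum_smul, dotProduct]
      simp only [mul_comm]
  simp only [this, sub_smul, Finset.sum_sub_distrib, map_sub]
  simp

/-- Substitute `∑ pᵢ λᵢ` for the coordinates and fill each monomial up to degree `k` with powers of
`∑ λᵢ = 1`. -/
theorem Bary.exists_homogeneous (hb : Bary p G h) {k : ℕ} {u : Poly3} (hu : u.totalDegree ≤ k) :
    ∃ U : MvPolynomial (Fin 4) ℝ, U.IsHomogeneous k ∧ baryHom G h U = u := by
  refine ⟨∑ s ∈ u.support, C (coeff s u) * (∏ l, (∑ i, C (p i l) * X i) ^ s l) *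
    (∑ i, X i) ^ (k - ∑ l, s l), ?_, ?_⟩
  · refine IsHomogeneous.sum _ _ _ fun s hs => ?_
    have hle : ∑ l, s l ≤ k := by
      refine le_trans ?_ hu
      have := le_totalDegree hs
      rwa [Finsupp.sum_fintype _ _ fun _ => rfl] at this
    have h1 : (∏ l, (∑ i, C (p i l) * X i : MvPolynomial (Fin 4) ℝ) ^ s l).IsHomogeneous
        (∑ l, s l) := by
      refine IsHomogeneous.prod _ _ _ fun l _ => ?_
      have : (∑ i, C (p i l) * X i : MvPolynomial (Fin 4) ℝ).IsHomogeneous 1 :=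
        IsHomogeneous.sum _ _ _ fun i _ => isHomogeneous_C_mul_X _ _
      simpa using this.pow (s l)
    have h2 : ((∑ i, X i : MvPolynomial (Fin 4) ℝ) ^ (k - ∑ l, s l)).IsHomogeneous
        (k - ∑ l, s l) := by
      have : (∑ i, X i : MvPolynomial (Fin 4) ℝ).IsHomogeneous 1 :=
        IsHomogeneous.sum _ _ _ fun i _ => isHomogeneous_X _ _
      simpa using this.pow (k - ∑ l, s l)
    have := ((isHomogeneous_C (Fin 4) (coeff s u)).mul h1).mul h2
    rwa [zero_add, Nat.add_sub_cancel' hle] at this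
  · have hX : ∀ i, baryHom G h (X i) = baryPoly G h i := fun i => by simp [baryHom]
    have hC : ∀ c, baryHom G h (C c) = C c := fun c => by simp [baryHom]
    have hS : ∀ l, baryHom G h (∑ i, C (p i l) * X i) = X l := fun l => by
      simp only [map_sum, map_mul, hC, hX, ← hb.sum_smul_baryPoly l, smul_eq_C_mul]
    have h1 : baryHom G h (∑ i, X i) = 1 := by simp only [map_sum, hX, hb.sum_baryPoly]
    rw [map_sum]
    conv_rhs => rw [u.as_sum]
    refine Finset.sum_congr rfl fun s _ => ?_
    rw [map_mul, map_mul, hC, map_prod, map_pow, h1, one_pow, mul_one, monomial_eq,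
      Finsupp.prod_fintype _ _ fun _ => pow_zero _]
    simp only [map_pow, hS]

end BaryHom

/-! ### Vanishing of polynomials on faces -/

theorem mem_vanishing_of_neg {F : Set (Fin 3 → ℝ)} {m : ℤ} (hm : m < 0) (u : Poly3) :
    u ∈ vanishing F m := fun l hl => by omega

theorem pderiv_mem_vanishing {F : Set (Fin 3 → ℝ)} {m : ℤ} {u : Poly3} (hu : u ∈ vanishing F m)
    (i : Fin 3) : pderiv i u ∈ vanishing F (m - 1) := by
  intro l hl x hx
  have := hu (l ++ [i]) (by simp; omega) x hx
  simpa [iterPartial] using this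

theorem mem_vanishing_succ {F : Set (Fin 3 → ℝ)} {m : ℕ} {u : Poly3}
    (h0 : ∀ x ∈ F, eval x u = 0) (h1 : ∀ i, pderiv i u ∈ vanishing F (m - 1)) :
    u ∈ vanishing F m := by
  intro l hl x hx
  induction l using List.reverseRecOn with
  | nil => simpa [iterPartial] using h0 x hx
  | append_singleton l i _ =>
    have := h1 i l (by simp at hl; omega) x hx
    simpa [iterPartial] using this

theorem eval_eq_zero_of_mem_vanishing {F : Set (Fin 3 → ℝ)} {m : ℤ} (hm : 0 ≤ m) {u : Poly3}
    (hu : u ∈ vanishing F m) {x : Fin 3 → ℝ} (hx : x ∈ F) : eval x u = 0 := by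
  simpa [iterPartial] using hu [] (by simpa using hm) x hx
end

/-! ### Vanishing orders as conditions on Bernstein exponents -/

section Support

variable {p G : Fin 4 → Fin 3 → ℝ} {h : Fin 4 → ℝ}

theorem Bary.coord_eq_zero (hb : Bary p G h) {S : Finset (Fin 4)} {j : Fin 4} (hj : j ∉ S)
    {x : Fin 3 → ℝ} (hx : x ∈ convexHull ℝ (p '' S)) : G j ⬝ᵥ x + h j = 0 := by
  have hconv : Convex ℝ {x : Fin 3 → ℝ | G j ⬝ᵥ x + h j = 0} := by
    intro x hx y hy a b _ _ hab
    simp only [Set.mem_ofPred_eq] at hx hy ⊢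
    rw [dotProduct_add, dotProduct_smul, dotProduct_smul, smul_eq_mul, smul_eq_mul]
    linear_combination a * hx + b * hy - h j * hab
  refine convexHull_min ?_ hconv hx
  rintro _ ⟨i, hi, rfl⟩
  have hne : j ≠ i := fun e => hj (e ▸ hi)
  simp [hb.dual, hne]

theorem Bary.coord_sum_smul (hb : Bary p G h) (t : Fin 4 → ℝ) (ht : ∑ i, t i = 1) (j : Fin 4) :
    G j ⬝ᵥ (∑ i, t i • p i) + h j = t j := by
  have : ∑ i, t i * (G j ⬝ᵥ p i + h j) = t j := by simp [hb.dual]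
  rw [← this]
  simp only [mul_add, Finset.sum_add_distrib, ← Finset.sum_mul, ht, one_mul]
  rw [dotProduct_sum]
  simp [dotProduct_smul]

theorem sum_eq_of_mem_support {U : MvPolynomial (Fin 4) ℝ} {k : ℕ} (hU : U.IsHomogeneous k)
    {d : Fin 4 →₀ ℕ} (hd : d ∈ U.support) : ∑ i, d i = k := by
  rw [hU.degree_eq_sum_deg_support hd]
  exact (Finset.sum_subset (Finset.subset_univ _) fun i _ hi => by simpa using hi).symm

theorem pderiv_isHomogeneous {U : MvPolynomial (Fin 4) ℝ} {k : ℕ} (hU : U.IsHomogeneous k)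
    (i : Fin 4) : (pderiv i U).IsHomogeneous (k - 1) := by
  intro d hd
  rw [coeff_pderiv] at hd
  have := hU (left_ne_zero_of_mul hd)
  rw [map_add] at this
  simp only [Finsupp.weight_single, Pi.one_apply, smul_eq_mul, mul_one] at this
  omega

/-- A homogeneous form that vanishes on a face of the simplex has no monomial supported there. -/
theorem Bary.one_le_of_eval_eq_zero (hb : Bary p G h) {S : Finset (Fin 4)} (hS : S.Nonempty)
    {k : ℕ} {U : MvPolynomial (Fin 4) ℝ} (hU : U.IsHomogeneous k)
    (h0 : ∀ x ∈ convexHull ℝ (p '' S), eval x (baryHom G h U) = 0) {β : Fin 4 →₀ ℕ}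
    (hβ : β ∈ U.support) : 1 ≤ ∑ j ∈ Sᶜ, β j := by
  by_contra hlt
  have hβ0 : ∀ j ∈ Sᶜ, β j = 0 := by
    rw [← Finset.sum_eq_zero_iff]
    omega
  -- `W` collects the monomials supported on the face. Positive arguments suffice to show `W = 0`;
  -- by homogeneity they can be rescaled to sum one, hence to points of the face.
  let W : MvPolynomial (Fin 4) ℝ :=
    ∑ d ∈ U.support with ∀ j ∈ Sᶜ, d j = 0, monomial d (coeff d U)
  have hW : W = 0 := by
    refine funext_set (fun _ => Set.Ioi (0 : ℝ)) (fun _ => Set.Ioi_infinite 0) fun t ht => ?_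
    have htpos : ∀ i, 0 < t i := fun i => ht i (Set.mem_univ i)
    let t' : Fin 4 → ℝ := fun i => if i ∈ S then t i else 0
    have hWU : eval t W = eval t' U := by
      rw [eval_eq' t' U, map_sum, Finset.sum_filter]
      refine Finset.sum_congr rfl fun d _ => ?_
      split_ifs with hd
      · rw [eval_monomial, Finsupp.prod_fintype _ _ fun _ => pow_zero _]
        congr 1
        refine Finset.prod_congr rfl fun i _ => ?_
        by_cases hi : i ∈ S
        · simp [t', hi]
        · simp [hd i (Finset.mem_compl.mpr hi)]
      · push Not at hd
        obtain ⟨j, hj, hdj⟩ := hd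
        rw [Finset.prod_eq_zero (Finset.mem_univ j), mul_zero]
        simp [t', Finset.mem_compl.mp hj, hdj]
    have hsum : 0 < ∑ i, t' i := by
      rw [Finset.sum_ite_mem, Finset.univ_inter]
      exact Finset.sum_pos (fun i _ => htpos i) hS
    set s := ∑ i, t' i
    have hs1 : ∑ i, s⁻¹ * t' i = 1 := by rw [← Finset.mul_sum, inv_mul_cancel₀ hsum.ne']
    have hx : ∑ i, (s⁻¹ * t' i) • p i ∈ convexHull ℝ (p '' S) := by
      have : ∑ i, (s⁻¹ * t' i) • p i = ∑ i ∈ S, (s⁻¹ * t' i) • p i := by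
        refine (Finset.sum_subset (Finset.subset_univ S) fun i _ hi => ?_).symm
        simp [t', hi]
      rw [this]
      refine (convex_convexHull ℝ _).sum_mem (fun i hi => ?_) ?_ fun i hi =>
        subset_convexHull ℝ _ ⟨i, hi, rfl⟩
      · have : 0 ≤ t' i := by simp only [t', if_pos hi]; exact (htpos i).le
        positivity
      · rw [← hs1]
        refine Finset.sum_subset (Finset.subset_univ S) fun i _ hi => ?_
        simp [t', hi]
    have he := h0 _ hx
    rw [eval_baryHom] at he
    simp only [hb.coord_sum_smul _ hs1] at he
    have hsc : eval (fun i => s⁻¹ * t' i) U = s⁻¹ ^ k * eval t' U := by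
      rw [eval_eq', eval_eq', Finset.mul_sum]
      refine Finset.sum_congr rfl fun d hd => ?_
      simp only [mul_pow, Finset.prod_mul_distrib, Finset.prod_pow_eq_pow_sum]
      rw [sum_eq_of_mem_support hU hd]
      ring
    rw [hsc] at he
    rw [hWU, map_zero]
    exact (mul_eq_zero.mp he).resolve_left (pow_ne_zero _ (inv_ne_zero hsum.ne'))
  have hc : coeff β W = coeff β U := by
    simp only [W, coeff_sum, coeff_monomial]
    rw [Finset.sum_ite_eq' , if_pos]
    exact Finset.mem_filter.mpr ⟨hβ, hβ0⟩
  rw [hW, coeff_zero] at hc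
  exact mem_support_iff.mp hβ hc.symm

/-- Take a monomial `d` of least degree in the variables off `S` and differentiate along an edge
from `i ∈ S` to `j ∉ S` with `d j ≠ 0`. This lowers both the vanishing order and that degree by one;
the only term that could cancel `d - eⱼ` comes from an exponent of smaller degree off `S`, which
minimality excludes. -/
theorem Bary.le_of_mem_vanishing (hb : Bary p G h) {S : Finset (Fin 4)} (hS : S.Nonempty)
    (m : ℕ) : ∀ {k : ℕ} {U : MvPolynomial (Fin 4) ℝ}, U.IsHomogeneous k →
    baryHom G h U ∈ vanishing (convexHull ℝ (p '' S)) m →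
    ∀ β ∈ U.support, m + 1 ≤ ∑ j ∈ Sᶜ, β j := by
  induction m with
  | zero =>
    intro k U hU hv β hβ
    simpa using hb.one_le_of_eval_eq_zero hS hU
      (fun x hx => eval_eq_zero_of_mem_vanishing le_rfl hv hx) hβ
  | succ m ih =>
    intro k U hU hv β hβ
    have h1 : ∀ β ∈ U.support, 1 ≤ ∑ j ∈ Sᶜ, β j := fun β hβ =>
      hb.one_le_of_eval_eq_zero hS hU
        (fun x hx => eval_eq_zero_of_mem_vanishing (by omega) hv hx) hβ
    obtain ⟨d, hd, hmin⟩ := Finset.exists_min_image U.support (fun d => ∑ j ∈ Sᶜ, d j) ⟨β, hβ⟩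
    refine le_trans ?_ (hmin β hβ)
    obtain ⟨j, hj, hdj⟩ : ∃ j ∈ Sᶜ, d j ≠ 0 := by
      by_contra! hall
      have := h1 d hd
      rw [Finset.sum_eq_zero hall] at this
      omega
    obtain ⟨i, hi⟩ := hS
    have hjS := Finset.mem_compl.mp hj
    have hij : i ≠ j := fun e => hjS (e ▸ hi)
    have hW : (pderiv j U - pderiv i U).IsHomogeneous (k - 1) :=
      (pderiv_isHomogeneous hU j).sub (pderiv_isHomogeneous hU i)
    have hWv : baryHom G h (pderiv j U - pderiv i U) ∈ vanishing (convexHull ℝ (p '' S)) m := by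
      rw [← hb.sum_pderiv_edge]
      refine Submodule.sum_mem _ fun l _ => Submodule.smul_mem _ _ ?_
      have := pderiv_mem_vanishing hv l
      rwa [Nat.cast_succ, add_sub_cancel_right] at this
    have hle : Finsupp.single j 1 ≤ d := Finsupp.single_le_iff.mpr (Nat.one_le_iff_ne_zero.mpr hdj)
    have hsumd : ∑ l ∈ Sᶜ, (d - Finsupp.single j 1 : Fin 4 →₀ ℕ) l + 1 = ∑ l ∈ Sᶜ, d l := by
      conv_rhs => rw [← tsub_add_cancel_of_le hle]
      simp only [Finsupp.add_apply, Finset.sum_add_distrib]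
      congr 1
      simp [Finsupp.single_apply, hjS]
    have hmem : d - Finsupp.single j 1 ∈ (pderiv j U - pderiv i U).support := by
      rw [mem_support_iff, coeff_sub, coeff_pderiv, coeff_pderiv, tsub_add_cancel_of_le hle]
      have hz : coeff (d - Finsupp.single j 1 + Finsupp.single i 1) U = 0 := by
        by_contra hne
        have := hmin _ (mem_support_iff.mpr hne)
        simp only [Finsupp.add_apply, Finset.sum_add_distrib] at this
        have h0 : ∑ l ∈ Sᶜ, (Finsupp.single i 1 : Fin 4 →₀ ℕ) l = 0 := by
          simp [Finsupp.single_apply, hi]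
        omega
      rw [hz, zero_mul, sub_zero]
      exact mul_ne_zero (mem_support_iff.mp hd) (by positivity)
    have := ih hW hWv _ hmem
    omega

theorem Bary.mem_vanishing_of_le (hb : Bary p G h) {S : Finset (Fin 4)} (m : ℕ) :
    ∀ {U : MvPolynomial (Fin 4) ℝ}, (∀ β ∈ U.support, m + 1 ≤ ∑ j ∈ Sᶜ, β j) →
    baryHom G h U ∈ vanishing (convexHull ℝ (p '' S)) m := by
  have h0 : ∀ {U : MvPolynomial (Fin 4) ℝ}, (∀ β ∈ U.support, 1 ≤ ∑ j ∈ Sᶜ, β j) →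
      ∀ x ∈ convexHull ℝ (p '' S), eval x (baryHom G h U) = 0 := by
    intro U hU x hx
    rw [eval_baryHom, eval_eq']
    refine Finset.sum_eq_zero fun d hd => ?_
    obtain ⟨j, hj, hdj⟩ : ∃ j ∈ Sᶜ, d j ≠ 0 := by
      by_contra! hall
      have := hU d hd
      rw [Finset.sum_eq_zero hall] at this
      omega
    rw [Finset.prod_eq_zero (Finset.mem_univ j), mul_zero]
    rw [hb.coord_eq_zero (Finset.mem_compl.mp hj) hx, zero_pow hdj]
  induction m with
  | zero =>
    intro U hU
    exact mem_vanishing_succ (h0 (by simpa using hU)) fun i => mem_vanishing_of_neg (by simp) _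
  | succ m ih =>
    intro U hU
    refine mem_vanishing_succ (h0 fun β hβ => (hU β hβ).trans' (by omega)) fun i => ?_
    rw [pderiv_baryHom, Nat.cast_succ, add_sub_cancel_right]
    refine Submodule.sum_mem _ fun l _ => Submodule.smul_mem _ _ (ih fun β hβ => ?_)
    rw [mem_support_iff, coeff_pderiv] at hβ
    have := hU _ (mem_support_iff.mpr (left_ne_zero_of_mul hβ))
    simp only [Finsupp.add_apply, Finset.sum_add_distrib] at this
    have h1 : ∑ j ∈ Sᶜ, (Finsupp.single l 1 : Fin 4 →₀ ℕ) j ≤ 1 := by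
      simp only [Finsupp.single_apply, Finset.sum_ite_eq]
      split_ifs <;> simp
    omega

theorem Bary.mem_vanishing_iff (hb : Bary p G h) {S : Finset (Fin 4)} (hS : S.Nonempty) (m : ℤ)
    {k : ℕ} {U : MvPolynomial (Fin 4) ℝ} (hU : U.IsHomogeneous k) :
    baryHom G h U ∈ vanishing (convexHull ℝ (p '' S)) m ↔
      ∀ β ∈ U.support, m + 1 ≤ ∑ j ∈ Sᶜ, (β j : ℤ) := by
  rcases lt_or_ge m 0 with hm | hm
  · refine ⟨fun _ β _ => ?_, fun _ => mem_vanishing_of_neg hm _⟩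
    exact le_trans (by omega) (Finset.sum_nonneg fun _ _ => Int.natCast_nonneg _)
  · lift m to ℕ using hm
    constructor
    · intro hv β hβ
      exact_mod_cast hb.le_of_mem_vanishing hS m hU hv β hβ
    · intro hv
      exact hb.mem_vanishing_of_le m fun β hβ => by exact_mod_cast hv β hβ

theorem totalDegree_baryHom_le {k : ℕ} {U : MvPolynomial (Fin 4) ℝ}
    (hU : U.IsHomogeneous k) : (baryHom G h U).totalDegree ≤ k := by
  have hl : ∀ i, (baryPoly G h i).totalDegree ≤ 1 := fun i => by
    refine (totalDegree_add _ _).trans (max_le ?_ (by simp))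
    refine (totalDegree_finsetSum _ _).trans (Finset.sup_le fun k _ => ?_)
    refine (totalDegree_mul _ _).trans ?_
    simp
  conv_lhs => rw [U.as_sum, map_sum]
  refine (totalDegree_finsetSum _ _).trans (Finset.sup_le fun d hd => ?_)
  rw [baryHom, aeval_monomial, Finsupp.prod_fintype _ _ fun _ => pow_zero _]
  refine (totalDegree_mul _ _).trans ?_
  rw [algebraMap_eq, totalDegree_C, zero_add]
  refine (totalDegree_finsetProd _ _).trans ?_
  rw [← sum_eq_of_mem_support hU hd]
  refine Finset.sum_le_sum fun i _ => (totalDegree_pow _ _).trans ?_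
  exact (Nat.mul_le_mul_left _ (hl i)).trans (by simp)

theorem exists_compl_pair : ∀ a b : Fin 4, a ≠ b →
    ∃ i j, i ≠ j ∧ ({i, j} : Finset (Fin 4))ᶜ = {a, b} := by decide

/-- The Bernstein description of the bubble space. -/
theorem Bary.mem_bubble_iff (hb : Bary p G h) {k : ℕ} (r : SmoothVec)
    {U : MvPolynomial (Fin 4) ℝ} (hU : U.IsHomogeneous k) :
    baryHom G h U ∈ bubble p k r ↔
      ∀ β ∈ U.support, IsAdm k (r.f + 1) (r.e + 1) (r.v + 1) (fun i => (β i : ℤ)) := by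
  have hv : ∀ i, baryHom G h U ∈ vanishing {p i} r.v ↔
      ∀ β ∈ U.support, r.v + 1 ≤ ∑ j ∈ ({i} : Finset (Fin 4))ᶜ, (β j : ℤ) := fun i => by
    have := hb.mem_vanishing_iff (Finset.singleton_nonempty i) r.v hU
    simpa only [Finset.coe_singleton, Set.image_singleton, convexHull_singleton] using this
  have he : ∀ i j, baryHom G h U ∈ vanishing (segment ℝ (p i) (p j)) r.e ↔
      ∀ β ∈ U.support, r.e + 1 ≤ ∑ l ∈ ({i, j} : Finset (Fin 4))ᶜ, (β l : ℤ) := fun i j => by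
    have := hb.mem_vanishing_iff (Finset.insert_nonempty i {j}) r.e hU
    simpa only [Finset.coe_pair, Set.image_pair, convexHull_pair] using this
  have hf : ∀ i, baryHom G h U ∈ vanishing (tetraFace p i) r.f ↔
      ∀ β ∈ U.support, r.f + 1 ≤ (β i : ℤ) := fun i => by
    have hne : ({i} : Finset (Fin 4))ᶜ.Nonempty := by
      rw [← Finset.card_pos, Finset.card_compl]
      simp
    have := hb.mem_vanishing_iff hne r.f hU
    rw [tetraFace, ← Set.compl_singleton_eq]
    simpa only [Finset.coe_compl, Finset.coe_singleton, compl_compl, Finset.sum_singleton]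
      using this
  have hsum : ∀ β ∈ U.support, ∑ i, (β i : ℤ) = k := fun β hβ => by
    exact_mod_cast sum_eq_of_mem_support hU hβ
  have hcompl : ∀ β ∈ U.support, ∀ i, ∑ j ∈ ({i} : Finset (Fin 4))ᶜ, (β j : ℤ) = k - β i :=
    fun β hβ i => by
      have := Finset.sum_add_sum_compl {i} fun j => (β j : ℤ)
      rw [hsum β hβ, Finset.sum_singleton] at this
      omega
  simp only [bubble, Submodule.mem_inf, Submodule.mem_iInf, mem_restrictTotalDegree, hv, he, hf]
  constructor
  · rintro ⟨⟨⟨-, h1⟩, h2⟩, h3⟩ β hβ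
    refine ⟨hsum β hβ, fun i => h3 i β hβ, fun a b hab => ?_, fun i => ?_⟩
    · obtain ⟨i, j, hij, hc⟩ := exists_compl_pair a b hab
      have := h2 i j hij β hβ
      rwa [hc, Finset.sum_pair hab] at this
    · have := h1 i β hβ
      rw [hcompl β hβ] at this
      simp only
      omega
  · intro hA
    refine ⟨⟨⟨totalDegree_baryHom_le hU, fun i β hβ => ?_⟩, fun i j hij β hβ => ?_⟩,
      fun i β hβ => (hA β hβ).2.1 i⟩
    · have : (β i : ℤ) ≤ _ := (hA β hβ).2.2.2 i
      rw [hcompl β hβ]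
      omega
    · obtain ⟨a, b, hab, hc⟩ := exists_compl_pair i j hij
      rw [← hc, compl_compl, Finset.sum_pair hab]
      exact (hA β hβ).2.2.1 a b hab

/-- Homogeneity is essential, since `∑ λᵢ - 1` is in the kernel. The whole simplex is treated as a
face with empty complement. -/
theorem Bary.baryHom_injOn (hb : Bary p G h) {k : ℕ} {U : MvPolynomial (Fin 4) ℝ}
    (hU : U.IsHomogeneous k) (h0 : baryHom G h U = 0) : U = 0 := by
  by_contra hne
  obtain ⟨β, hβ⟩ := support_nonempty.mpr hne
  have := hb.one_le_of_eval_eq_zero Finset.univ_nonempty hU (fun x _ => by rw [h0, map_zero]) hβ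
  simp at this

end Support

/-! ### Integrals of Bernstein monomials and moments of conformal Killing fields -/

section Integral

variable {p G : Fin 4 → Fin 3 → ℝ} {h : Fin 4 → ℝ}

theorem Bary.sum_coord (hb : Bary p G h) (x : Fin 3 → ℝ) : ∑ i, (G i ⬝ᵥ x + h i) = 1 := by
  have := congrArg (eval x) hb.sum_baryPoly
  simpa [eval_baryPoly] using this

theorem Bary.sum_coord_smul (hb : Bary p G h) (x : Fin 3 → ℝ) :
    ∑ i, (G i ⬝ᵥ x + h i) • p i = x := by
  ext l
  have := congrArg (eval x) (hb.sum_smul_baryPoly l)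
  simp only [map_sum, smul_eval, eval_baryPoly, eval_X] at this
  simpa [Finset.sum_apply, mul_comm] using this

theorem Bary.mem_tetra_iff (hb : Bary p G h) {x : Fin 3 → ℝ} :
    x ∈ tetra p ↔ ∀ i, 0 ≤ G i ⬝ᵥ x + h i := by
  constructor
  · intro hx i
    have hconv : Convex ℝ {x : Fin 3 → ℝ | 0 ≤ G i ⬝ᵥ x + h i} := by
      intro x hx y hy a b ha hb' hab
      simp only [Set.mem_ofPred_eq] at hx hy ⊢
      rw [dotProduct_add, dotProduct_smul, dotProduct_smul, smul_eq_mul, smul_eq_mul]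
      have : a * (G i ⬝ᵥ x) + b * (G i ⬝ᵥ y) + h i =
          a * (G i ⬝ᵥ x + h i) + b * (G i ⬝ᵥ y + h i) := by
        linear_combination -h i * hab
      rw [this]
      positivity
    refine convexHull_min ?_ hconv hx
    rintro _ ⟨j, rfl⟩
    simp only [Set.mem_ofPred_eq, hb.dual]
    split_ifs <;> simp
  · intro hx
    rw [← hb.sum_coord_smul x]
    exact (convex_convexHull ℝ _).sum_mem (fun i _ => hx i) (hb.sum_coord x)
      fun i _ => subset_convexHull ℝ _ ⟨i, rfl⟩

theorem isCompact_tetra (p : Fin 4 → Fin 3 → ℝ) : IsCompact (tetra p) :=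
  (Set.finite_range p).isCompact_convexHull ℝ

theorem integrableOn_tetra (p : Fin 4 → Fin 3 → ℝ) (u : Poly3) :
    IntegrableOn (fun x => eval x u) (tetra p) :=
  (MvPolynomial.continuous_eval u).continuousOn.integrableOn_compact (isCompact_tetra p)

/-- Integration over the tetrahedron as a linear functional. -/
noncomputable def tetraIntegral (p : Fin 4 → Fin 3 → ℝ) : Poly3 →ₗ[ℝ] ℝ where
  toFun u := ∫ x in tetra p, eval x u
  map_add' u v := by
    simp only [map_add]
    exact integral_add (integrableOn_tetra p u) (integrableOn_tetra p v)
  map_smul' c u := by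
    simp only [smul_eval]
    exact integral_const_mul c _

theorem tetraIntegral_one_ne_zero (hb : Bary p G h) : tetraIntegral p 1 ≠ 0 := by
  have hpos : 0 < volume (tetra p) := by
    let U : Set (Fin 3 → ℝ) := ⋂ i, {x | 0 < G i ⬝ᵥ x + h i}
    have hU : IsOpen U := isOpen_iInter_of_finite fun i =>
      isOpen_lt continuous_const (by unfold dotProduct; fun_prop)
    have hne : U.Nonempty := by
      refine ⟨∑ i, (1 / 4 : ℝ) • p i, Set.mem_iInter.mpr fun i => ?_⟩
      change 0 < G i ⬝ᵥ (∑ i, (1 / 4 : ℝ) • p i) + h i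
      rw [hb.coord_sum_smul (fun _ => 1 / 4) (by simp)]
      norm_num
    exact (hU.measure_pos volume hne).trans_le (measure_mono fun x hx =>
      hb.mem_tetra_iff.mpr fun i => (Set.mem_iInter.mp hx i).le)
  change ∫ x in tetra p, eval x (1 : Poly3) ≠ 0
  simp only [map_one, integral_const, smul_eq_mul, mul_one]
  rw [Measure.real, ENNReal.toReal_ne_zero]
  simp [hpos.ne', (isCompact_tetra p).measure_lt_top.ne]

theorem hasDerivAt_eval {v : ℝ → Fin 4 → ℝ} {v' : Fin 4 → ℝ} {s : ℝ}
    (hv : ∀ l, HasDerivAt (fun s => v s l) (v' l) s) (U : MvPolynomial (Fin 4) ℝ) :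
    HasDerivAt (fun s => eval (v s) U) (∑ l, v' l * eval (v s) (pderiv l U)) s := by
  induction U using MvPolynomial.induction_on with
  | C a => simpa using hasDerivAt_const s a
  | add p q hp hq =>
    simp only [map_add, mul_add, Finset.sum_add_distrib]
    exact hp.add hq
  | mul_X p i hp =>
    have : HasDerivAt (fun s => eval (v s) p * v s i) _ s := hp.mul (hv i)
    simp only [map_mul, eval_X]
    refine this.congr_deriv ?_
    simp only [Derivation.leibniz, pderiv_X, smul_eq_mul, map_add, map_mul, eval_X, mul_add,
      Finset.sum_add_distrib]
    rw [add_comm]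
    congr 1
    · rw [Finset.sum_eq_single i]
      · simp [mul_comm]
      · intro j _ hj
        simp [hj]
      · simp
    · rw [Finset.sum_mul]
      exact Finset.sum_congr rfl fun _ _ => by ring

/-- Barycentric coordinates as a function of three of them. -/
def baryOfFree (y : Fin 3 → ℝ) : Fin 4 → ℝ := ![y 0, y 1, y 2, 1 - y 0 - y 1 - y 2]

theorem sum_baryOfFree (y : Fin 3 → ℝ) : ∑ i, baryOfFree y i = 1 := by
  simp [baryOfFree, Fin.sum_univ_four]

/-- With `λ₁` and `λ₂` fixed, the slice is a segment with ends on `λ₀ = 0` and `λ₃ = 0`, and the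
integrand is the derivative of `U` along it. -/
theorem setIntegral_deriv_line_eq_zero {U : MvPolynomial (Fin 4) ℝ}
    (hU : ∀ w : Fin 4 → ℝ, w 0 = 0 ∨ w 3 = 0 → eval w U = 0) (y : Fin 2 → ℝ) :
    ∫ s : ℝ, Set.indicator {x | ∀ i, 0 ≤ baryOfFree x i}
      (fun x => eval (baryOfFree x) (pderiv 0 U - pderiv 3 U)) (Fin.cons s y : Fin 3 → ℝ) = 0 := by
  let v : ℝ → Fin 4 → ℝ := fun s => ![s, y 0, y 1, 1 - y 0 - y 1 - s]
  have hv : ∀ s, baryOfFree (Fin.cons s y : Fin 3 → ℝ) = v s := by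
    intro s
    ext i
    fin_cases i
    · rfl
    · rfl
    · rfl
    · change 1 - s - y 0 - y 1 = 1 - y 0 - y 1 - s
      ring
  have hind : ∀ s, Set.indicator {x | ∀ i, 0 ≤ baryOfFree x i}
      (fun x => eval (baryOfFree x) (pderiv 0 U - pderiv 3 U)) (Fin.cons s y : Fin 3 → ℝ) =
      Set.indicator {s | ∀ i, 0 ≤ v s i} (fun s => eval (v s) (pderiv 0 U - pderiv 3 U)) s := by
    intro s
    simp only [Set.indicator_apply, Set.mem_ofPred_eq, hv]
  simp only [hind]
  have hset : {s | ∀ i, 0 ≤ v s i} =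
      if 0 ≤ y 0 ∧ 0 ≤ y 1 then Set.Icc 0 (1 - y 0 - y 1) else ∅ := by
    ext s
    simp only [Set.mem_ofPred_eq, Fin.forall_fin_succ, v]
    split_ifs with hy
    · simp [hy.1, hy.2]
    · simp
      intro _ h1 h2
      exact absurd ⟨h1, h2⟩ hy
  have hmeas : MeasurableSet {s | ∀ i, 0 ≤ v s i} := by
    rw [hset]
    split_ifs
    · exact measurableSet_Icc
    · exact MeasurableSet.empty
  rw [integral_indicator hmeas, hset]
  split_ifs with hy
  swap
  · simp
  rcases lt_or_ge (1 - y 0 - y 1) 0 with hm | hm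
  · rw [Set.Icc_eq_empty (not_le.mpr hm)]
    simp
  have hvd : ∀ s l, HasDerivAt (fun s => v s l) ((![1, 0, 0, -1] : Fin 4 → ℝ) l) s := by
    intro s l
    fin_cases l
    · exact hasDerivAt_id s
    · exact hasDerivAt_const s _
    · exact hasDerivAt_const s _
    · exact (hasDerivAt_id s).const_sub _
  have hd : ∀ s, HasDerivAt (fun s => eval (v s) U) (eval (v s) (pderiv 0 U - pderiv 3 U)) s := by
    intro s
    have := hasDerivAt_eval (hvd s) U
    simpa [Fin.sum_univ_four, sub_eq_add_neg] using this
  have hcont : Continuous fun s => eval (v s) (pderiv 0 U - pderiv 3 U) :=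
    (MvPolynomial.continuous_eval _).comp (continuous_pi fun l =>
      continuous_iff_continuousAt.mpr fun s => (hvd s l).continuousAt)
  rw [integral_Icc_eq_integral_Ioc, ← intervalIntegral.integral_of_le hm,
    intervalIntegral.integral_eq_sub_of_hasDerivAt (fun s _ => hd s)
      (hcont.intervalIntegrable _ _),
    hU _ (.inr (by simp [v])), hU _ (.inl (by simp [v])), sub_zero]

theorem setIntegral_free_eq_zero {U : MvPolynomial (Fin 4) ℝ}
    (hU : ∀ w : Fin 4 → ℝ, w 0 = 0 ∨ w 3 = 0 → eval w U = 0) :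
    ∫ x in {x : Fin 3 → ℝ | ∀ i, 0 ≤ baryOfFree x i},
      eval (baryOfFree x) (pderiv 0 U - pderiv 3 U) = 0 := by
  have hc : Continuous baryOfFree := by
    refine continuous_pi fun i => ?_
    unfold baryOfFree
    fin_cases i <;> simp <;> fun_prop
  have hmeas : MeasurableSet {x : Fin 3 → ℝ | ∀ i, 0 ≤ baryOfFree x i} := by
    have : {x : Fin 3 → ℝ | ∀ i, 0 ≤ baryOfFree x i} = ⋂ i, {x | 0 ≤ baryOfFree x i} := by
      ext; simp
    rw [this]
    exact MeasurableSet.iInter fun i =>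
      (isClosed_le continuous_const ((continuous_apply i).comp hc)).measurableSet
  rw [← integral_indicator hmeas]
  rw [← (volume_preserving_piFinSuccAbove (fun _ : Fin 3 => ℝ) 0).symm.integral_comp'
    (g := Set.indicator _ _)]
  set g := fun z : ℝ × (Fin 2 → ℝ) => Set.indicator {x : Fin 3 → ℝ | ∀ i, 0 ≤ baryOfFree x i}
    (fun x => eval (baryOfFree x) (pderiv 0 U - pderiv 3 U))
    ((MeasurableEquiv.piFinSuccAbove (fun _ : Fin 3 => ℝ) 0).symm z) with hg
  by_cases hi : Integrable g ((volume : Measure ℝ).prod volume)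
  · have := integral_prod_symm g hi
    refine this.trans ?_
    have h0 : ∀ y, ∫ s, g (s, y) = 0 := fun y => by
      have := setIntegral_deriv_line_eq_zero hU y
      simpa [hg, MeasurableEquiv.piFinSuccAbove, Fin.consEquiv] using this
    simp [h0]
  -- A non-integrable function has integral zero by convention, so integrability need not be
  -- checked.
  · exact integral_undef hi

/-- The affine map `φ` from the reference simplex has constant Jacobian, which reduces the claim to
the integral over the free coordinates. -/
theorem Bary.integral_edge_eq_zero_std (hb : Bary p G h) {U : MvPolynomial (Fin 4) ℝ}
    (hU : ∀ w : Fin 4 → ℝ, w 0 = 0 ∨ w 3 = 0 → eval w U = 0) :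
    tetraIntegral p (baryHom G h (pderiv 0 U - pderiv 3 U)) = 0 := by
  let A : (Fin 3 → ℝ) →L[ℝ] (Fin 3 → ℝ) :=
    LinearMap.toContinuousLinearMap (Fintype.linearCombination ℝ fun i : Fin 3 => p i.castSucc - p 3)
  let φ : (Fin 3 → ℝ) → Fin 3 → ℝ := fun y => A y + p 3
  have hφ : ∀ y, φ y = ∑ i, baryOfFree y i • p i := by
    intro y
    simp only [φ, A, LinearMap.coe_toContinuousLinearMap', Fintype.linearCombination_apply]
    ext l
    simp [baryOfFree, Fin.sum_univ_four, Fin.sum_univ_three]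
    ring
  have hcoord : ∀ y i, G i ⬝ᵥ φ y + h i = baryOfFree y i := fun y i => by
    rw [hφ, hb.coord_sum_smul _ (sum_baryOfFree y)]
  have hinj : Function.Injective φ := by
    intro y z hyz
    have hc : ∀ i, baryOfFree y i = baryOfFree z i := fun i => by
      rw [← hcoord, ← hcoord, hyz]
    ext i
    fin_cases i
    · exact hc 0
    · exact hc 1
    · exact hc 2
  have himg : tetra p = φ '' {y | ∀ i, 0 ≤ baryOfFree y i} := by
    ext x
    rw [hb.mem_tetra_iff]
    constructor
    · intro hx
      have hbx : baryOfFree (fun i => G i.castSucc ⬝ᵥ x + h i.castSucc) =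
          fun i => G i ⬝ᵥ x + h i := by
        have hs := hb.sum_coord x
        rw [Fin.sum_univ_four] at hs
        ext i
        fin_cases i
        · rfl
        · rfl
        · rfl
        · change 1 - (G 0 ⬝ᵥ x + h 0) - (G 1 ⬝ᵥ x + h 1) - (G 2 ⬝ᵥ x + h 2) = G 3 ⬝ᵥ x + h 3
          linarith
      refine ⟨fun i => G i.castSucc ⬝ᵥ x + h i.castSucc, ?_, ?_⟩
      · intro i
        rw [hbx]
        exact hx i
      · rw [hφ, hbx, hb.sum_coord_smul]
    · rintro ⟨y, hy, rfl⟩ i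
      rw [hcoord]
      exact hy i
  have hmeas : MeasurableSet {y : Fin 3 → ℝ | ∀ i, 0 ≤ baryOfFree y i} := by
    have : {y : Fin 3 → ℝ | ∀ i, 0 ≤ baryOfFree y i} = φ ⁻¹' (tetra p) := by
      rw [himg, Set.preimage_image_eq _ hinj]
    rw [this]
    exact (isCompact_tetra p).isClosed.measurableSet.preimage
      (A.continuous.add continuous_const).measurable
  change ∫ x in tetra p, _ = 0
  rw [himg, integral_image_eq_integral_abs_det_fderiv_smul volume hmeas (f' := fun _ => A)
    (fun y _ => (A.hasFDerivAt.add_const _).hasFDerivWithinAt) hinj.injOn]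
  have hcoord' : ∀ y i, G i ⬝ᵥ (A y + p 3) + h i = baryOfFree y i := hcoord
  simp only [eval_baryHom, hcoord']
  rw [integral_smul, setIntegral_free_eq_zero hU, smul_zero]

theorem exists_perm_ends : ∀ i j : Fin 4, i ≠ j → ∃ σ : Equiv.Perm (Fin 4), σ 0 = i ∧ σ 3 = j := by
  decide

/-- The derivative along an edge of a polynomial vanishing at the two faces opposite to its ends
integrates to zero. -/
theorem Bary.integral_edge_eq_zero (hb : Bary p G h) {i j : Fin 4} (hij : i ≠ j)
    {U : MvPolynomial (Fin 4) ℝ} (hU : ∀ w : Fin 4 → ℝ, w i = 0 ∨ w j = 0 → eval w U = 0) :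
    tetraIntegral p (baryHom G h (pderiv i U - pderiv j U)) = 0 := by
  obtain ⟨σ, rfl, rfl⟩ := exists_perm_ends i j hij
  have hren : ∀ W, baryHom (G ∘ σ) (h ∘ σ) (rename σ.symm W) = baryHom G h W := fun W => by
    rw [baryHom, aeval_rename, baryHom]
    congr 2
    ext1 l
    simp [baryPoly]
  have htetra : tetraIntegral (p ∘ σ) = tetraIntegral p := by
    refine LinearMap.ext fun u => ?_
    change ∫ x in tetra (p ∘ σ), eval x u = ∫ x in tetra p, eval x u
    rw [tetra, EquivLike.range_comp, tetra]
  have := (hb.comp_perm σ).integral_edge_eq_zero_std (U := rename σ.symm U) fun w hw => by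
    rw [eval_rename]
    exact hU _ (by simpa using hw)
  have e0 := pderiv_rename σ.symm.injective (σ 0) U
  have e3 := pderiv_rename σ.symm.injective (σ 3) U
  rw [Equiv.symm_apply_apply] at e0 e3
  rwa [e0, e3, ← map_sub, hren, htetra] at this

/-- The normalised monomial with exponent `α`. -/
noncomputable def normMonomial (α : Fin 4 → ℤ) : MvPolynomial (Fin 4) ℝ :=
  monomial (Finsupp.equivFunOnFinite.symm fun i => (α i).toNat)
    (∏ i, ((α i).toNat.factorial : ℝ))⁻¹

theorem X_mul_normMonomial {α : Fin 4 → ℤ} {i : Fin 4} (hi : 0 ≤ α i) :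
    X i * normMonomial α = ((α i : ℝ) + 1) • normMonomial (α + Pi.single i 1) := by
  have hα : ∀ j, (α + Pi.single i 1 : Fin 4 → ℤ) j = if j = i then α i + 1 else α j := fun j => by
    rw [Pi.add_apply, Pi.single_apply]
    split_ifs with e <;> simp [e]
  rw [normMonomial, normMonomial, X, monomial_mul, smul_monomial, one_mul]
  congr 1
  · congr 1
    ext j
    simp only [Finsupp.add_apply, Finsupp.equivFunOnFinite_symm_apply_apply, hα,
      Finsupp.single_apply, eq_comm (a := i)]
    split_ifs with e
    · subst e; omega
    · simp
  · simp only [hα]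
    rw [← Finset.mul_prod_erase _ _ (Finset.mem_univ i),
      ← Finset.mul_prod_erase (a := i) _ _ (Finset.mem_univ i)]
    have hne : ∀ j ∈ Finset.univ.erase i, ((if j = i then α i + 1 else α j).toNat.factorial : ℝ) =
        ((α j).toNat.factorial : ℝ) := fun j hj => by rw [if_neg (Finset.ne_of_mem_erase hj)]
    rw [Finset.prod_congr rfl hne, if_pos rfl, show (α i + 1).toNat = (α i).toNat + 1 by omega,
      Nat.factorial_succ]
    have hc : ((α i : ℤ) : ℝ) = ((α i).toNat : ℝ) := by
      exact_mod_cast (Int.toNat_of_nonneg hi).symm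
    rw [hc]
    push_cast
    have : ((α i).toNat : ℝ) + 1 ≠ 0 := by positivity
    rw [mul_assoc, mul_inv (((α i).toNat : ℝ) + 1), smul_eq_mul, mul_inv_cancel_left₀ this]

/-- The factor `1 / α!` makes differentiation a plain shift of exponents. The bound `1 ≤ α i`
matters: at `α i = 0` the truncation by `toNat` would give a nonzero right-hand side. -/
theorem pderiv_normMonomial {α : Fin 4 → ℤ} {i : Fin 4} (hi : 1 ≤ α i) :
    pderiv i (normMonomial α) = normMonomial (α - Pi.single i 1) := by
  have hα : ∀ j, (α - Pi.single i 1 : Fin 4 → ℤ) j = if j = i then α i - 1 else α j := fun j => by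
    rw [Pi.sub_apply, Pi.single_apply]
    split_ifs with e <;> simp [e]
  rw [normMonomial, normMonomial, pderiv_monomial]
  congr 1
  · congr 1
    ext j
    simp only [Finsupp.tsub_apply, Finsupp.equivFunOnFinite_symm_apply_apply, hα,
      Finsupp.single_apply, eq_comm (a := i)]
    split_ifs with e
    · subst e; omega
    · simp
  · simp only [hα, Finsupp.equivFunOnFinite_symm_apply_apply]
    rw [← Finset.mul_prod_erase _ _ (Finset.mem_univ i),
      ← Finset.mul_prod_erase (a := i) _ _ (Finset.mem_univ i)]
    have hne : ∀ j ∈ Finset.univ.erase i, ((if j = i then α i - 1 else α j).toNat.factorial : ℝ) =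
        ((α j).toNat.factorial : ℝ) := fun j hj => by rw [if_neg (Finset.ne_of_mem_erase hj)]
    rw [Finset.prod_congr rfl hne, if_pos rfl]
    obtain ⟨n, hn⟩ : ∃ n : ℕ, (α i).toNat = n + 1 := ⟨(α i).toNat - 1, by omega⟩
    rw [show (α i - 1).toNat = n by omega, hn, Nat.factorial_succ]
    push_cast
    have : (n : ℝ) + 1 ≠ 0 := by positivity
    rw [mul_assoc, mul_inv ((n : ℝ) + 1), mul_comm, mul_inv_cancel_left₀ this]

theorem eval_normMonomial_eq_zero {α : Fin 4 → ℤ} {i : Fin 4} (hi : 1 ≤ α i) {w : Fin 4 → ℝ}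
    (hw : w i = 0) : eval w (normMonomial α) = 0 := by
  rw [normMonomial, eval_monomial, Finsupp.prod_fintype _ _ fun _ => pow_zero _]
  refine mul_eq_zero_of_right _ (Finset.prod_eq_zero (Finset.mem_univ i) ?_)
  rw [hw, Finsupp.equivFunOnFinite_symm_apply_apply, zero_pow (by omega)]

theorem normMonomial_isHomogeneous {α : Fin 4 → ℤ} (h0 : ∀ i, 0 ≤ α i) {k : ℕ}
    (hk : ∑ i, α i = k) : (normMonomial α).IsHomogeneous k := by
  refine isHomogeneous_monomial _ ?_
  rw [Finsupp.degree_eq_sum]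
  simp only [Finsupp.equivFunOnFinite_symm_apply_apply]
  zify
  rw [← hk]
  exact Finset.sum_congr rfl fun i _ => Int.toNat_of_nonneg (h0 i)

theorem eq_sum_normMonomial (U : MvPolynomial (Fin 4) ℝ) :
    U = ∑ d ∈ U.support, (coeff d U * ∏ i, ((d i).factorial : ℝ)) •
      normMonomial fun i => (d i : ℤ) := by
  conv_lhs => rw [U.as_sum]
  refine Finset.sum_congr rfl fun d _ => ?_
  have hne : ∏ i, ((d i).factorial : ℝ) ≠ 0 :=
    Finset.prod_ne_zero_iff.mpr fun i _ => by positivity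
  simp only [normMonomial, Int.toNat_natCast, smul_monomial, smul_eq_mul]
  rw [mul_assoc, mul_inv_cancel₀ hne, mul_one]
  congr 1
  congr 1
  ext i
  simp

/-- The difference of the two monomials is the edge derivative of the one with exponent `α + eᵢ +
eⱼ`, which vanishes on both faces opposite to the ends. -/
theorem Bary.integral_move (hb : Bary p G h) {α : Fin 4 → ℤ} (h0 : ∀ i, 0 ≤ α i) (i j : Fin 4) :
    tetraIntegral p (baryHom G h (normMonomial (α + Pi.single i 1))) =
      tetraIntegral p (baryHom G h (normMonomial (α + Pi.single j 1))) := by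
  rcases eq_or_ne i j with rfl | hij
  · rfl
  have hi : 1 ≤ (α + Pi.single i 1 + Pi.single j 1 : Fin 4 → ℤ) i := by
    have := h0 i
    simp [hij]
    omega
  have hj : 1 ≤ (α + Pi.single i 1 + Pi.single j 1 : Fin 4 → ℤ) j := by
    have := h0 j
    simp [hij.symm]
    omega
  have := hb.integral_edge_eq_zero hij (U := normMonomial (α + Pi.single i 1 + Pi.single j 1))
    fun w hw => hw.elim (eval_normMonomial_eq_zero hi) (eval_normMonomial_eq_zero hj)
  rw [pderiv_normMonomial hi, pderiv_normMonomial hj, add_sub_cancel_right, map_sub, map_sub,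
    add_right_comm, add_sub_cancel_right] at this
  linarith

/-- The integrals of normalised Bernstein monomials only depend on the degree. -/
theorem Bary.integral_normMonomial (hb : Bary p G h) (n : ℕ) : ∀ α : Fin 4 → ℤ, (∀ i, 0 ≤ α i) →
    α 1 + α 2 + α 3 = n → tetraIntegral p (baryHom G h (normMonomial α)) =
      tetraIntegral p (baryHom G h (normMonomial (Pi.single 0 (∑ i, α i)))) := by
  induction n with
  | zero =>
    intro α h0 hn
    have h1 := h0 1
    have h2 := h0 2
    have h3 := h0 3
    have : α = Pi.single 0 (∑ i, α i) := by
      rw [Fin.sum_univ_four]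
      ext i
      fin_cases i <;> simp <;> push_cast at hn <;> omega
    rw [← this]
  | succ n ih =>
    intro α h0 hn
    obtain ⟨i, hi0, hi⟩ : ∃ i : Fin 4, i ≠ 0 ∧ 1 ≤ α i := by
      by_contra! hall
      have h1 := hall 1 (by decide)
      have h2 := hall 2 (by decide)
      have h3 := hall 3 (by decide)
      push_cast at hn
      omega
    have h0' : ∀ j, 0 ≤ (α - Pi.single i 1 : Fin 4 → ℤ) j := fun j => by
      have := h0 j
      rw [Pi.sub_apply, Pi.single_apply]
      split_ifs with e
      · subst e; omega
      · omega
    have hmv := hb.integral_move h0' i 0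
    rw [sub_add_cancel] at hmv
    rw [hmv, ih]
    · congr 4
      simp only [Pi.add_apply, Pi.sub_apply, Finset.sum_add_distrib, Finset.sum_sub_distrib,
        sum_single_one]
      ring
    · intro j
      have := h0' j
      have := single_one_bounds 0 j
      simp only [Pi.add_apply]
      omega
    · have hs := sum_single_one i
      rw [Fin.sum_univ_four, Pi.single_eq_of_ne hi0.symm] at hs
      simp only [Pi.add_apply, Pi.sub_apply]
      push_cast at hn
      simp
      omega

/-- The common integral of the normalised Bernstein monomials of degree `n`. -/
noncomputable def bernsteinIntegral (p G : Fin 4 → Fin 3 → ℝ) (h : Fin 4 → ℝ) (n : ℤ) : ℝ :=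
  tetraIntegral p (baryHom G h (normMonomial (Pi.single 0 n)))

theorem Bary.integral_eq (hb : Bary p G h) {α : Fin 4 → ℤ} (h0 : ∀ i, 0 ≤ α i) {n : ℤ}
    (hn : ∑ i, α i = n) :
    tetraIntegral p (baryHom G h (normMonomial α)) = bernsteinIntegral p G h n := by
  rw [hb.integral_normMonomial (α 1 + α 2 + α 3).toNat α h0, hn, bernsteinIntegral]
  have h1 := h0 1
  have h2 := h0 2
  have h3 := h0 3
  omega

theorem add_single_nonneg {α : Fin 4 → ℤ} (h0 : ∀ i, 0 ≤ α i) (j i : Fin 4) :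
    0 ≤ (α + Pi.single j 1 : Fin 4 → ℤ) i :=
  add_nonneg (h0 i) (single_one_bounds j i).1

theorem sum_add_single (α : Fin 4 → ℤ) (j : Fin 4) :
    ∑ i, (α + Pi.single j 1 : Fin 4 → ℤ) i = ∑ i, α i + 1 := by
  simp only [Pi.add_apply, Finset.sum_add_distrib, sum_single_one]

/-- Multiplication by `∑ λᵢ = 1` writes the integral in degree `n` as a multiple of the one in
degree `n + 1`; in degree zero it is the volume. -/
theorem Bary.bernsteinIntegral_ne_zero (hb : Bary p G h) (n : ℕ) :
    bernsteinIntegral p G h n ≠ 0 := by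
  induction n with
  | zero =>
    have : normMonomial (Pi.single 0 ((0 : ℕ) : ℤ)) = 1 := by
      have h0 : (Finsupp.equivFunOnFinite.symm fun _ : Fin 4 => 0) = (0 : Fin 4 →₀ ℕ) := by
        ext; simp
      simp [normMonomial, h0]
    rw [bernsteinIntegral, this, map_one]
    exact tetraIntegral_one_ne_zero hb
  | succ n ih =>
    intro hz
    apply ih
    have h0 : ∀ i, 0 ≤ (Pi.single 0 (n : ℤ) : Fin 4 → ℤ) i := fun i => by
      rw [Pi.single_apply]
      split_ifs <;> simp
    have hX : ∀ i, baryHom G h (X i) = baryPoly G h i := fun i => by simp [baryHom]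
    have h1 : baryHom G h (∑ i, X i) = 1 := by
      simp only [map_sum, hX, hb.sum_baryPoly]
    have : bernsteinIntegral p G h n =
        tetraIntegral p (baryHom G h ((∑ i, X i) * normMonomial (Pi.single 0 (n : ℤ)))) := by
      rw [map_mul, h1, one_mul, bernsteinIntegral]
    rw [this, Finset.sum_mul, map_sum, map_sum]
    refine Finset.sum_eq_zero fun i _ => ?_
    rw [X_mul_normMonomial (h0 i), map_smul, map_smul,
      hb.integral_eq (add_single_nonneg h0 i) (n := ((n + 1 : ℕ) : ℤ)) ?_, hz, smul_zero]
    rw [sum_add_single]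
    simp

/-- Writing `x = ∑ λᵢ pᵢ`, each `λᵢ` raises `αᵢ` and produces the weight `αᵢ + 1`; this is the
origin of the weights in `moment₁`. -/
theorem Bary.integral_mul_X (hb : Bary p G h) {α : Fin 4 → ℤ} (h0 : ∀ i, 0 ≤ α i) {n : ℤ}
    (hn : ∑ i, α i = n) (l : Fin 3) :
    tetraIntegral p (baryHom G h (normMonomial α) * X l) =
      bernsteinIntegral p G h (n + 1) * moment₁ p α l := by
  have hX : ∀ i, baryHom G h (X i) = baryPoly G h i := fun i => by simp [baryHom]
  rw [← hb.sum_smul_baryPoly l, Finset.mul_sum, map_sum, moment₁, Finset.mul_sum]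
  refine Finset.sum_congr rfl fun i _ => ?_
  rw [mul_smul_comm, map_smul, ← hX, ← map_mul, mul_comm (normMonomial α),
    X_mul_normMonomial (h0 i), map_smul, map_smul,
    hb.integral_eq (add_single_nonneg h0 i) (n := n + 1) (by rw [sum_add_single, hn])]
  simp only [smul_eq_mul]
  ring

theorem moment₁_add_single (p : Fin 4 → Fin 3 → ℝ) (α : Fin 4 → ℤ) (i : Fin 4) (k : Fin 3) :
    moment₁ p (α + Pi.single i 1) k = moment₁ p α k + p i k := by
  have := moment₁_sub_single p (α + Pi.single i 1) i k
  rw [add_sub_cancel_right] at this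
  linarith

theorem Bary.integral_mul_X_mul_X (hb : Bary p G h) {α : Fin 4 → ℤ} (h0 : ∀ i, 0 ≤ α i) {n : ℤ}
    (hn : ∑ i, α i = n) (l m : Fin 3) :
    tetraIntegral p (baryHom G h (normMonomial α) * (X l * X m)) =
      bernsteinIntegral p G h (n + 2) * moment₂ p α l m := by
  have hX : ∀ i, baryHom G h (X i) = baryPoly G h i := fun i => by simp [baryHom]
  have : tetraIntegral p (baryHom G h (normMonomial α) * (X l * X m)) =
      ∑ i, p i l * (((α i : ℝ) + 1) * (bernsteinIntegral p G h (n + 2) *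
        (moment₁ p α m + p i m))) := by
    rw [← mul_assoc, ← hb.sum_smul_baryPoly l, Finset.mul_sum, Finset.sum_mul, map_sum]
    refine Finset.sum_congr rfl fun i _ => ?_
    rw [mul_smul_comm, smul_mul_assoc, map_smul, ← hX, ← map_mul, mul_comm (normMonomial α),
      X_mul_normMonomial (h0 i), map_smul, smul_mul_assoc, map_smul,
      hb.integral_mul_X (add_single_nonneg h0 i) (n := n + 1) (by rw [sum_add_single, hn]),
      moment₁_add_single]
    simp only [smul_eq_mul, show n + 1 + 1 = n + 2 by ring]
  rw [this, moment₂]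
  nth_rewrite 2 [moment₁]
  rw [mul_add, Finset.mul_sum, Finset.sum_mul, Finset.mul_sum, ← Finset.sum_add_distrib]
  exact Finset.sum_congr rfl fun i _ => by ring

/-- The components of a conformal Killing field as polynomials. -/
noncomputable def ckPoly (a c d : Fin 3 → ℝ) (b : ℝ) (n : Fin 3) : Poly3 :=
  a n • (∑ l, X l * X l) - (2 : ℝ) • (∑ l, a l • (X n * X l)) + b • X n +
    (c (n + 1) • X (n + 2) - c (n + 2) • X (n + 1)) + C (d n)

theorem cross_apply_cyclic (c x : Fin 3 → ℝ) (n : Fin 3) :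
    crossProduct c x n = c (n + 1) * x (n + 2) - c (n + 2) * x (n + 1) := by
  rw [cross_apply]
  fin_cases n <;> rfl

theorem eval_ckPoly (a c d : Fin 3 → ℝ) (b : ℝ) (x : Fin 3 → ℝ) (n : Fin 3) :
    eval x (ckPoly a c d b n) =
      ((x ⬝ᵥ x) • a - (2 * (a ⬝ᵥ x)) • x + b • x + crossProduct c x + d) n := by
  simp only [ckPoly, Pi.add_apply, Pi.sub_apply, Pi.smul_apply, cross_apply_cyclic, map_add,
    map_sub, smul_eval, map_mul, eval_X, eval_C, smul_eq_mul, dotProduct,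
    Fin.sum_univ_three]
  ring

/-- The moments of a conformal Killing field against Bernstein monomials are the values of a
discrete one. -/
theorem Bary.integral_mul_ckPoly (hb : Bary p G h) {α : Fin 4 → ℤ} (h0 : ∀ i, 0 ≤ α i) {n : ℤ}
    (hn : ∑ i, α i = n) (a c d : Fin 3 → ℝ) (b : ℝ) (l : Fin 3) :
    tetraIntegral p (baryHom G h (normMonomial α) * ckPoly a c d b l) =
      discCK p (bernsteinIntegral p G h (n + 2) • a) (bernsteinIntegral p G h (n + 1) • c)
        (bernsteinIntegral p G h n • d) (bernsteinIntegral p G h (n + 1) * b) α l := by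
  simp only [ckPoly, mul_add, mul_sub, mul_smul_comm, Finset.mul_sum, map_add, map_sub, map_smul,
    map_sum, hb.integral_mul_X h0 hn, hb.integral_mul_X_mul_X h0 hn, discCK,
    LinearMap.smul_apply, cross_apply_cyclic, Pi.smul_apply, smul_eq_mul]
  rw [mul_comm _ (C (d l)), ← smul_eq_C_mul, map_smul, hb.integral_eq h0 hn]
  simp only [Fin.sum_univ_three, smul_eq_mul]
  ring

end Integral

/-! ### Edge tensors and surjectivity of the divergence -/

section Tensor

variable {p G : Fin 4 → Fin 3 → ℝ} {h : Fin 4 → ℝ}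

/-- The tensor `U t tᵀ` where `t` is the edge from `p j` to `p i`. -/
noncomputable def edgeTensor (p G : Fin 4 → Fin 3 → ℝ) (h : Fin 4 → ℝ) (i j : Fin 4) :
    MvPolynomial (Fin 4) ℝ →ₗ[ℝ] Matrix (Fin 3) (Fin 3) Poly3 where
  toFun U := Matrix.of fun a b => ((p i - p j) a * (p i - p j) b) • baryHom G h U
  map_add' U W := by
    ext1 a b
    simp [smul_add]
  map_smul' c U := by
    ext1 a b
    simp [smul_comm c]

theorem edgeTensor_apply (i j : Fin 4) (U : MvPolynomial (Fin 4) ℝ) (a b : Fin 3) :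
    edgeTensor p G h i j U a b = ((p i - p j) a * (p i - p j) b) • baryHom G h U := rfl

theorem Bary.rowDiv_edgeTensor (hb : Bary p G h) (i j : Fin 4) (U : MvPolynomial (Fin 4) ℝ)
    (a : Fin 3) : rowDiv (edgeTensor p G h i j U) a =
      (p i - p j) a • baryHom G h (pderiv i U - pderiv j U) := by
  rw [← hb.sum_pderiv_edge i j U, Finset.smul_sum]
  change ∑ b, pderiv b (edgeTensor p G h i j U a b) = _
  simp only [edgeTensor_apply, Derivation.map_smul, mul_smul]

theorem trace_edgeTensor (i j : Fin 4) (U : MvPolynomial (Fin 4) ℝ) :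
    (edgeTensor p G h i j U).trace = ((p i - p j) ⬝ᵥ (p i - p j)) • baryHom G h U := by
  simp only [Matrix.trace, Matrix.diag, edgeTensor_apply, dotProduct, Finset.sum_smul]

theorem isSymm_edgeTensor (i j : Fin 4) (U : MvPolynomial (Fin 4) ℝ) :
    (edgeTensor p G h i j U).IsSymm := by
  ext1 a b
  rw [Matrix.transpose_apply, edgeTensor_apply, edgeTensor_apply, mul_comm]

/-- The values of a functional on the Bernstein basis. -/
noncomputable def bernsteinDual (G : Fin 4 → Fin 3 → ℝ) (h : Fin 4 → ℝ)
    (f : (Fin 3 → Poly3) →ₗ[ℝ] ℝ) (α : Fin 4 → ℤ) (l : Fin 3) : ℝ :=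
  f (Pi.single l (baryHom G h (normMonomial α)))

theorem Bary.apply_rowDiv_edgeTensor (hb : Bary p G h) (f : (Fin 3 → Poly3) →ₗ[ℝ] ℝ)
    {β : Fin 4 → ℤ} {i j : Fin 4} (hi : 1 ≤ β i) (hj : 1 ≤ β j) :
    f (rowDiv (edgeTensor p G h i j (normMonomial β))) =
      (bernsteinDual G h f (β - Pi.single i 1) - bernsteinDual G h f (β - Pi.single j 1)) ⬝ᵥ
        (p i - p j) := by
  have : rowDiv (edgeTensor p G h i j (normMonomial β)) = ∑ l, (p i - p j) l •
      (Pi.single l (baryHom G h (normMonomial (β - Pi.single i 1))) -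
        Pi.single l (baryHom G h (normMonomial (β - Pi.single j 1))) : Fin 3 → Poly3) := by
    ext1 a
    rw [hb.rowDiv_edgeTensor, pderiv_normMonomial hi, pderiv_normMonomial hj, map_sub,
      Finset.sum_apply, Finset.sum_eq_single a]
    · simp
    · intro l _ hl
      simp [Pi.single_eq_of_ne hl.symm]
    · simp
  rw [this, map_sum]
  simp only [map_smul, map_sub, smul_eq_mul, dotProduct, Pi.sub_apply, bernsteinDual]
  exact Finset.sum_congr rfl fun l _ => mul_comm _ _

theorem isAdm_of_mem_support_normMonomial {k F E V : ℤ} {β : Fin 4 → ℤ} (hβ : IsAdm k F E V β)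
    (h0 : ∀ i, 0 ≤ β i) {d : Fin 4 →₀ ℕ} (hd : d ∈ (normMonomial β).support) :
    IsAdm k F E V fun i => (d i : ℤ) := by
  have := Finset.mem_singleton.mp (support_monomial_subset hd)
  have e : (fun i => (d i : ℤ)) = β := by
    ext i
    rw [this, Finsupp.equivFunOnFinite_symm_apply_apply, Int.toNat_of_nonneg (h0 i)]
  rwa [e]

/-- If `l` is an end of the edge, `λ^β` vanishes on the face opposite to `l`; otherwise the edge
lies in that face and is orthogonal to the normal. -/
theorem Bary.edgeTensor_mulVec (hb : Bary p G h) {β : Fin 4 → ℤ} {i j : Fin 4} (hi : 1 ≤ β i)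
    (hj : 1 ≤ β j) {l : Fin 4} {n : Fin 3 → ℝ} (hn : IsUnitNormal p l n) {x : Fin 3 → ℝ}
    (hx : x ∈ tetraFace p l) :
    (edgeTensor p G h i j (normMonomial β)).map (eval x) *ᵥ n = 0 := by
  have hx0 : G l ⬝ᵥ x + h l = 0 := by
    refine hb.coord_eq_zero (S := {l}ᶜ) (by simp) ?_
    rwa [Finset.coe_compl, Finset.coe_singleton, Set.compl_singleton_eq]
  have key : eval x (baryHom G h (normMonomial β)) * (n ⬝ᵥ (p i - p j)) = 0 := by
    rcases eq_or_ne i l with rfl | hil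
    · rw [eval_baryHom, eval_normMonomial_eq_zero hi hx0, zero_mul]
    rcases eq_or_ne j l with rfl | hjl
    · rw [eval_baryHom, eval_normMonomial_eq_zero hj hx0, zero_mul]
    · rw [hn.2 i j hil hjl, mul_zero]
  ext a
  have : ((edgeTensor p G h i j (normMonomial β)).map (eval x) *ᵥ n) a =
      (p i - p j) a * (eval x (baryHom G h (normMonomial β)) * (n ⬝ᵥ (p i - p j))) := by
    simp only [Matrix.mulVec, dotProduct, Matrix.map_apply, edgeTensor_apply, smul_eval,
      Finset.mul_sum]
    exact Finset.sum_congr rfl fun b _ => by ring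
  rw [this, key, mul_zero, Pi.zero_apply]

theorem Bary.edgeTensor_combination_mem (hb : Bary p G h) {k : ℕ} {r : SmoothVec}
    {β : Fin 4 → ℤ} (hβ : IsAdm k (r.f + 1) (r.e + 1) (r.v + 1) β) (h0 : ∀ i, 0 ≤ β i)
    {i j i' j' : Fin 4} (hi : 1 ≤ β i) (hj : 1 ≤ β j) (hi' : 1 ≤ β i') (hj' : 1 ≤ β j') :
    ((p i' - p j') ⬝ᵥ (p i' - p j')) • edgeTensor p G h i j (normMonomial β) -
      ((p i - p j) ⬝ᵥ (p i - p j)) • edgeTensor p G h i' j' (normMonomial β) ∈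
        bubbleDivST p k r := by
  have hmem : baryHom G h (normMonomial β) ∈ bubble p k r :=
    (hb.mem_bubble_iff r (normMonomial_isHomogeneous h0 hβ.1)).mpr fun d hd =>
      isAdm_of_mem_support_normMonomial hβ h0 hd
  refine ⟨⟨fun a b => ?_, ?_, ?_⟩, fun l n hn x hx => ?_⟩
  · exact Submodule.sub_mem _ (Submodule.smul_mem _ _ (Submodule.smul_mem _ _ hmem))
      (Submodule.smul_mem _ _ (Submodule.smul_mem _ _ hmem))
  · exact ((isSymm_edgeTensor i j _).smul _).sub ((isSymm_edgeTensor i' j' _).smul _)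
  · rw [Matrix.trace_sub, Matrix.trace_smul, Matrix.trace_smul, trace_edgeTensor,
      trace_edgeTensor, smul_smul, smul_smul, mul_comm, sub_self]
  · have e : ∀ (c c' : ℝ) (σ σ' : Matrix (Fin 3) (Fin 3) Poly3),
        (c • σ - c' • σ').map (eval x) =
        c • σ.map (eval x) - c' • σ'.map (eval x) := fun c c' σ σ' => by
      ext a b
      simp
    rw [e, Matrix.sub_mulVec, Matrix.smul_mulVec, Matrix.smul_mulVec,
      hb.edgeTensor_mulVec hi hj hn hx, hb.edgeTensor_mulVec hi' hj' hn hx]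
    simp

/-- A functional that annihilates the divergences is a discrete conformal Killing field. -/
theorem Bary.confAt_bernsteinDual (hb : Bary p G h) {k : ℕ} {r : SmoothVec}
    {f : (Fin 3 → Poly3) →ₗ[ℝ] ℝ} (hf : ∀ τ ∈ bubbleDivST p k r, f (rowDiv τ) = 0)
    {β : Fin 4 → ℤ} (hβ : IsAdm k (r.f + 1) (r.e + 1) (r.v + 1) β) (h0 : ∀ i, 0 ≤ β i) :
    ConfAt p (bernsteinDual G h f) β := by
  by_cases hex : ∃ i j, i ≠ j ∧ 1 ≤ β i ∧ 1 ≤ β j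
  · obtain ⟨i', j', hne, hi', hj'⟩ := hex
    have hℓ := hb.edge_sq_ne_zero hne
    -- The conformal factor is read off from one reference edge; the trace-free combinations compare
    -- every other edge with it.
    refine ⟨(bernsteinDual G h f (β - Pi.single i' 1) - bernsteinDual G h f (β - Pi.single j' 1))
      ⬝ᵥ (p i' - p j') / ((p i' - p j') ⬝ᵥ (p i' - p j')), fun i j hi hj => ?_⟩
    have := hf _ (hb.edgeTensor_combination_mem hβ h0 hi hj hi' hj')
    rw [map_sub, map_sub, map_smul, map_smul, map_smul, map_smul,
      hb.apply_rowDiv_edgeTensor f hi hj, hb.apply_rowDiv_edgeTensor f hi' hj'] at this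
    simp only [smul_eq_mul] at this
    rw [div_mul_eq_mul_div, eq_div_iff hℓ]
    linarith
  -- Here `β` has at most one positive entry, so only `i = j` occurs.
  · refine ⟨0, fun i j hi hj => ?_⟩
    obtain rfl : i = j := by
      by_contra hne
      exact hex ⟨i, j, hne, hi, hj⟩
    simp

/-- Functionals with the same values on the Bernstein basis agree. -/
theorem Bary.apply_eq_of_bernsteinDual_eq (hb : Bary p G h) {n : ℕ} {s : SmoothVec}
    {f g : (Fin 3 → Poly3) →ₗ[ℝ] ℝ}
    (hfg : ∀ α, (∀ i, 0 ≤ α i) → IsAdm n (s.f + 1) (s.e + 1) (s.v + 1) α →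
      bernsteinDual G h f α = bernsteinDual G h g α) {v : Fin 3 → Poly3}
    (hv : v ∈ bubbleVec p n s) : f v = g v := by
  have hs : ∀ l, f (Pi.single l (v l)) = g (Pi.single l (v l)) := fun l => by
    obtain ⟨U, hU, hUv⟩ := hb.exists_homogeneous
      ((mem_restrictTotalDegree _ _ _).mp (hv l).1.1.1)
    have hA := (hb.mem_bubble_iff s hU).mp (hUv ▸ hv l)
    let S : Poly3 →ₗ[ℝ] Fin 3 → Poly3 := LinearMap.single ℝ (fun _ => Poly3) l
    change f (S (v l)) = g (S (v l))
    rw [← hUv, eq_sum_normMonomial U]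
    simp only [map_sum, map_smul]
    exact Finset.sum_congr rfl fun d hd => congrArg _
      (congrFun (hfg _ (fun i => Int.natCast_nonneg _) (hA d hd)) l)
  rw [← Finset.univ_sum_single v, map_sum, map_sum]
  exact Finset.sum_congr rfl fun l _ => hs l

/-- The `L²` pairing with a conformal Killing field. -/
noncomputable def ckPairing (p : Fin 4 → Fin 3 → ℝ) (a c d : Fin 3 → ℝ) (b : ℝ) :
    (Fin 3 → Poly3) →ₗ[ℝ] ℝ :=
  ∑ l, (tetraIntegral p ∘ₗ LinearMap.mulRight ℝ (ckPoly a c d b l)) ∘ₗ LinearMap.proj l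

theorem ckPairing_apply (a c d : Fin 3 → ℝ) (b : ℝ) (v : Fin 3 → Poly3) :
    ckPairing p a c d b v = ∑ l, tetraIntegral p (v l * ckPoly a c d b l) := by
  simp [ckPairing]

theorem ckPairing_eq_integral (a c d : Fin 3 → ℝ) (b : ℝ) (v : Fin 3 → Poly3) :
    ckPairing p a c d b v = ∫ x in tetra p, evalVec v x ⬝ᵥ
      ((x ⬝ᵥ x) • a - (2 * (a ⬝ᵥ x)) • x + b • x + crossProduct c x + d) := by
  rw [ckPairing_apply, ← map_sum]
  change ∫ x in tetra p, eval x (∑ l, v l * ckPoly a c d b l) = _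
  congr 1
  ext x
  simp only [map_sum, map_mul, eval_ckPoly]
  rfl

theorem Bary.bernsteinDual_ckPairing (hb : Bary p G h) (a c d : Fin 3 → ℝ) (b : ℝ)
    {α : Fin 4 → ℤ} (h0 : ∀ i, 0 ≤ α i) {n : ℤ} (hn : ∑ i, α i = n) :
    bernsteinDual G h (ckPairing p a c d b) α =
      discCK p (bernsteinIntegral p G h (n + 2) • a) (bernsteinIntegral p G h (n + 1) • c)
        (bernsteinIntegral p G h n • d) (bernsteinIntegral p G h (n + 1) * b) α := by
  ext l
  rw [← hb.integral_mul_ckPoly h0 hn, bernsteinDual, ckPairing_apply, Finset.sum_eq_single l]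
  · simp
  · intro m _ hm
    simp [Pi.single_eq_of_ne hm]
  · simp

/-- Every field orthogonal to the conformal Killing fields is a divergence. -/
theorem Bary.exists_rowDiv_eq (hb : Bary p G h) {k : ℕ} {r : SmoothVec} (hf : -1 ≤ r.f)
    (he : 2 * r.f + 3 ≤ r.e) (hv : 2 * r.e + 2 ≤ r.v) (hk : 2 * r.v + 2 ≤ (k : ℤ))
    {v : Fin 3 → Poly3} (hvm : v ∈ bubbleVecModCK p (k - 1) (r.ominus 1)) :
    ∃ τ ∈ bubbleDivST p k r, rowDiv τ = v := by
  by_contra hnot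
  have hnot' : v ∉ (bubbleDivST p k r).map rowDiv := fun ⟨τ, hτ, e⟩ => hnot ⟨τ, hτ, e⟩
  -- A vector outside a subspace is detected by a functional that vanishes on the subspace.
  obtain ⟨f, hfv, hle⟩ := Submodule.exists_le_ker_of_notMem hnot'
  have hf0 : ∀ τ ∈ bubbleDivST p k r, f (rowDiv τ) = 0 := fun τ hτ =>
    hle (Submodule.mem_map_of_mem hτ)
  obtain ⟨a, c, d, b, hck⟩ := SimField.exists_discCK (q := bernsteinDual G h f)
    ⟨⟨G, h, hb⟩, fun β hβ => hb.confAt_bernsteinDual hf0 hβ fun i =>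
      le_trans (by omega) (hβ.2.1 i)⟩ (by omega) (by omega) (by omega) (by omega)
  have hk1 : ((k - 1 : ℕ) : ℤ) = k - 1 := by omega
  have hB : ∀ m : ℕ, bernsteinIntegral p G h ((k : ℤ) - 1 + m) ≠ 0 := fun m => by
    have := hb.bernsteinIntegral_ne_zero (k - 1 + m)
    rwa [Nat.cast_add, hk1] at this
  have hB0 := hB 0
  have hB1 := hB 1
  have hB2 := hB 2
  rw [Nat.cast_zero, add_zero] at hB0
  rw [Nat.cast_one] at hB1
  rw [Nat.cast_two] at hB2
  -- The inverse factors cancel the Bernstein integrals of degrees `k - 1`, `k` and `k + 1`, so that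
  -- `Φ` has exactly the discrete field of `f`.
  set Φ := ckPairing p ((bernsteinIntegral p G h ((k : ℤ) - 1 + 2))⁻¹ • a)
    ((bernsteinIntegral p G h ((k : ℤ) - 1 + 1))⁻¹ • c)
    ((bernsteinIntegral p G h ((k : ℤ) - 1))⁻¹ • d)
    ((bernsteinIntegral p G h ((k : ℤ) - 1 + 1))⁻¹ * b) with hΦ
  apply hfv
  have : f v = Φ v := by
    refine hb.apply_eq_of_bernsteinDual_eq (fun α h0 hα => ?_) hvm.1
    rw [hΦ, hb.bernsteinDual_ckPairing _ _ _ _ h0 (hα.1.trans hk1)]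
    simp only [smul_smul, mul_inv_cancel₀ hB0, mul_inv_cancel₀ hB1, mul_inv_cancel₀ hB2,
      one_smul, mul_inv_cancel_left₀ hB1]
    refine hck α ?_
    rw [hk1] at hα
    refine hα.mono ?_ ?_ ?_ <;> simp only [SmoothVec.ominus] <;> push_cast <;> omega
  rw [this, hΦ, ckPairing_eq_integral]
  exact hvm.2 _ ⟨_, _, _, _, fun x => rfl⟩

end Tensor

/-! ### Divergences of tensor bubbles are orthogonal to CK -/

section Divergence

variable {p G : Fin 4 → Fin 3 → ℝ} {h : Fin 4 → ℝ}

theorem pderiv_mem_vanishing_max {F : Set (Fin 3 → ℝ)} {m : ℤ} {u : Poly3}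
    (hu : u ∈ vanishing F m) (i : Fin 3) : pderiv i u ∈ vanishing F (max (m - (1 : ℕ)) (-1)) := by
  rcases le_total (m - 1) (-1) with hm | hm
  · exact mem_vanishing_of_neg (by push_cast; omega) _
  · rw [Nat.cast_one, max_eq_left hm]
    exact pderiv_mem_vanishing hu i

theorem Bary.pderiv_mem_bubble (hb : Bary p G h) {k : ℕ} {r : SmoothVec} {u : Poly3}
    (hu : u ∈ bubble p k r) (l : Fin 3) : pderiv l u ∈ bubble p (k - 1) (r.ominus 1) := by
  have hdeg : pderiv l u ∈ restrictTotalDegree (Fin 3) ℝ (k - 1) := by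
    obtain ⟨U, hU, rfl⟩ := hb.exists_homogeneous ((mem_restrictTotalDegree _ _ _).mp hu.1.1.1)
    rw [pderiv_baryHom]
    exact Submodule.sum_mem _ fun i _ => Submodule.smul_mem _ _
      ((mem_restrictTotalDegree _ _ _).mpr (totalDegree_baryHom_le (pderiv_isHomogeneous hU i)))
  simp only [bubble, Submodule.mem_inf, Submodule.mem_iInf] at hu ⊢
  exact ⟨⟨⟨hdeg, fun i => pderiv_mem_vanishing_max (hu.1.1.2 i) l⟩,
    fun i j hij => pderiv_mem_vanishing_max (hu.1.2 i j hij) l⟩,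
    fun i => pderiv_mem_vanishing_max (hu.2 i) l⟩

theorem Bary.grad_dot_self_pos (hb : Bary p G h) (i : Fin 4) : 0 < G i ⬝ᵥ G i := by
  refine lt_of_le_of_ne (Finset.sum_nonneg fun _ _ => mul_self_nonneg _) fun h0 => ?_
  have hz : G i = 0 := dotProduct_self_eq_zero.mp h0.symm
  have : ∀ j : Fin 4, i ≠ j → False := fun j hij => by
    have := hb.grad_dot_sub i i j
    simp [hz, hij] at this
  exact this (i + 1) (by clear * -; revert i; decide)

theorem Bary.isUnitNormal (hb : Bary p G h) (i : Fin 4) :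
    IsUnitNormal p i ((√(G i ⬝ᵥ G i))⁻¹ • G i) := by
  refine ⟨?_, fun j k hj hk => ?_⟩
  · have h1 := Real.mul_self_sqrt (hb.grad_dot_self_pos i).le
    have h2 := (Real.sqrt_pos.mpr (hb.grad_dot_self_pos i)).ne'
    rw [smul_dotProduct, dotProduct_smul, smul_eq_mul, smul_eq_mul]
    nth_rewrite 3 [← h1]
    field_simp
  · rw [smul_dotProduct, hb.grad_dot_sub, if_neg hj.symm, if_neg hk.symm, sub_self, smul_zero]

theorem Bary.mulVec_grad_eq_zero (hb : Bary p G h) {k : ℕ} {r : SmoothVec}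
    {τ : Matrix (Fin 3) (Fin 3) Poly3} (hτ : τ ∈ bubbleDivST p k r) {i : Fin 4} {x : Fin 3 → ℝ}
    (hx : x ∈ tetraFace p i) : τ.map (eval x) *ᵥ G i = 0 := by
  have := hτ.2 i _ (hb.isUnitNormal i) x hx
  rw [Matrix.mulVec_smul] at this
  exact (smul_eq_zero.mp this).resolve_left
    (inv_ne_zero (Real.sqrt_pos.mpr (hb.grad_dot_self_pos i)).ne')

/-- The component of a tensor along a pair of barycentric gradients. -/
noncomputable def gradComponent (G : Fin 4 → Fin 3 → ℝ) (τ : Matrix (Fin 3) (Fin 3) Poly3)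
    (i j : Fin 4) : Poly3 := ∑ c, ∑ d, (G i c * G j d) • τ c d

/-- After expansion, every term containing a bare sum of gradients vanishes, and the mixed terms are
first moments. -/
theorem Bary.sum_edge_grad (hb : Bary p G h) (a b c d : Fin 3) :
    ∑ i, ∑ j, (p i - p j) a * (p i - p j) b * (G i c * G j d) =
      -((if c = a then 1 else 0) * (if d = b then 1 else 0) +
        (if c = b then 1 else 0) * (if d = a then 1 else 0)) := by
  have e : ∀ i j, (p i - p j) a * (p i - p j) b * (G i c * G j d) =
      (p i a * p i b * G i c) * G j d + G i c * (p j a * p j b * G j d) -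
        ((G i c * p i a) * (G j d * p j b) + (G i c * p i b) * (G j d * p j a)) := fun i j => by
    simp only [Pi.sub_apply]
    ring
  simp only [e, Finset.sum_add_distrib, Finset.sum_sub_distrib, ← Finset.mul_sum,
    ← Finset.sum_mul, hb.moment, hb.sum_grad]
  ring

/-- A symmetric tensor is a combination of the tensors `t tᵀ` with `t` an edge. -/
theorem Bary.sum_gradComponent (hb : Bary p G h) {τ : Matrix (Fin 3) (Fin 3) Poly3}
    (hτ : τ.IsSymm) (a b : Fin 3) :
    ∑ i, ∑ j, ((p i - p j) a * (p i - p j) b) • gradComponent G τ i j = (-2 : ℝ) • τ a b := by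
  have : ∑ i, ∑ j, ((p i - p j) a * (p i - p j) b) • gradComponent G τ i j =
      ∑ c, ∑ d, (∑ i, ∑ j, (p i - p j) a * (p i - p j) b * (G i c * G j d)) • τ c d := by
    simp only [gradComponent, Finset.smul_sum, smul_smul, Finset.sum_smul]
    exact (Finset.sum_congr rfl fun i _ => Finset.sum_comm_cycle.trans Finset.sum_comm_cycle).trans
      (Finset.sum_comm.trans (Finset.sum_congr rfl fun c _ => Finset.sum_comm))
  rw [this]
  simp only [hb.sum_edge_grad, neg_smul, add_smul, Finset.sum_neg_distrib, Finset.sum_add_distrib]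
  have h1 : ∀ a b : Fin 3, ∑ c, ∑ d,
      ((if c = a then (1 : ℝ) else 0) * (if d = b then 1 else 0)) • τ c d = τ a b := fun a b => by
    simp [ite_smul]
  rw [h1, h1, hτ.apply, two_smul]

/-- `G l` is normal to the face opposite to `l`, so `τ G l` vanishes there; symmetry of `τ` covers
the other slot. -/
theorem Bary.eval_gradComponent_eq_zero (hb : Bary p G h) {k : ℕ} {r : SmoothVec}
    {τ : Matrix (Fin 3) (Fin 3) Poly3} (hτ : τ ∈ bubbleDivST p k r) {i j l : Fin 4}
    (hl : l = i ∨ l = j) {x : Fin 3 → ℝ} (hx : x ∈ tetraFace p l) :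
    eval x (gradComponent G τ i j) = 0 := by
  have h0 : ∀ a, ∑ b, eval x (τ a b) * G l b = 0 := fun a =>
    congrFun (hb.mulVec_grad_eq_zero hτ hx) a
  simp only [gradComponent, map_sum, smul_eval]
  rcases hl with rfl | rfl
  · rw [Finset.sum_comm]
    refine Finset.sum_eq_zero fun d _ => ?_
    rw [← mul_zero (G j d), ← h0 d, Finset.mul_sum]
    refine Finset.sum_congr rfl fun c _ => ?_
    rw [hτ.1.2.1.apply c d]
    ring
  · refine Finset.sum_eq_zero fun c _ => ?_
    rw [← mul_zero (G i c), ← h0 c, Finset.mul_sum]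
    exact Finset.sum_congr rfl fun d _ => by ring

/-- The edge representation of a tensor bubble. -/
theorem Bary.exists_edgeTensor_eq (hb : Bary p G h) {k : ℕ} {r : SmoothVec}
    {τ : Matrix (Fin 3) (Fin 3) Poly3} (hτ : τ ∈ bubbleDivST p k r) :
    ∃ T : Fin 4 → Fin 4 → MvPolynomial (Fin 4) ℝ, (∀ i j, (T i j).IsHomogeneous k) ∧
      (∀ i j, ∀ β ∈ (T i j).support, 1 ≤ β i ∧ 1 ≤ β j) ∧
      ∑ i, ∑ j, edgeTensor p G h i j (T i j) = (-2 : ℝ) • τ ∧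
      ∑ i, ∑ j, ((p i - p j) ⬝ᵥ (p i - p j)) • T i j = 0 := by
  have hdeg : ∀ i j, (gradComponent G τ i j).totalDegree ≤ k := fun i j => by
    refine (mem_restrictTotalDegree _ _ _).mp (Submodule.sum_mem _ fun c _ =>
      Submodule.sum_mem _ fun d _ => Submodule.smul_mem _ _ (hτ.1.1 c d).1.1.1)
  choose T hT hTτ using fun i j => hb.exists_homogeneous (hdeg i j)
  have hsum : ∑ i, ∑ j, edgeTensor p G h i j (T i j) = (-2 : ℝ) • τ := by
    ext1 a b
    simp only [Matrix.sum_apply, edgeTensor_apply, hTτ, hb.sum_gradComponent hτ.1.2.1]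
    rfl
  refine ⟨T, hT, fun i j β hβ => ?_, hsum, ?_⟩
  · have hface : ∀ l, l = i ∨ l = j → 1 ≤ β l := fun l hl => by
      have hne : ({l} : Finset (Fin 4))ᶜ.Nonempty := by
        rw [← Finset.card_pos, Finset.card_compl]
        simp
      have := hb.one_le_of_eval_eq_zero hne (hT i j) (fun x hx => ?_) hβ
      · simpa using this
      · rw [hTτ]
        refine hb.eval_gradComponent_eq_zero hτ hl ?_
        rwa [Finset.coe_compl, Finset.coe_singleton, Set.compl_singleton_eq] at hx
    exact ⟨hface i (.inl rfl), hface j (.inr rfl)⟩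
  -- The zero trace is lifted from polynomials on the simplex to forms of degree `k`, where it can
  -- be compared coefficientwise.
  · refine hb.baryHom_injOn (k := k) (IsHomogeneous.sum _ _ _ fun i _ =>
      IsHomogeneous.sum _ _ _ fun j _ =>
        (homogeneousSubmodule (Fin 4) ℝ k).smul_mem _ (hT i j)) ?_
    have := congrArg Matrix.trace hsum
    rw [Matrix.trace_smul, hτ.1.2.2, smul_zero] at this
    simpa only [Matrix.trace_sum, trace_edgeTensor, map_sum, map_smul] using this

/-- A functional that is a discrete conformal Killing field annihilates the divergences. -/
theorem Bary.apply_rowDiv_eq_zero (hb : Bary p G h) {k : ℕ} {r : SmoothVec}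
    {f : (Fin 3 → Poly3) →ₗ[ℝ] ℝ}
    (hf : ∀ β : Fin 4 → ℤ, (∀ i, 0 ≤ β i) → ∑ i, β i = k → ConfAt p (bernsteinDual G h f) β)
    {τ : Matrix (Fin 3) (Fin 3) Poly3} (hτ : τ ∈ bubbleDivST p k r) : f (rowDiv τ) = 0 := by
  obtain ⟨T, hT, hsupp, hsum, htr⟩ := hb.exists_edgeTensor_eq hτ
  choose! μ hμ using hf
  -- `M` sends `λ^β / β!` to the conformal factor `μ β`. Thus `f` of the divergence of an edge
  -- tensor is `M` of its trace, and the total trace is zero.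
  let M : MvPolynomial (Fin 4) ℝ →ₗ[ℝ] ℝ := (basisMonomials (Fin 4) ℝ).constr ℝ fun d =>
    μ (fun i => (d i : ℤ)) * ∏ i, ((d i).factorial : ℝ)
  have hM : ∀ d : Fin 4 →₀ ℕ, M (normMonomial fun i => (d i : ℤ)) = μ fun i => (d i : ℤ) := by
    intro d
    have e : normMonomial (fun i => (d i : ℤ)) =
        (∏ i, ((d i).factorial : ℝ))⁻¹ • basisMonomials (Fin 4) ℝ d := by
      rw [coe_basisMonomials, smul_monomial, smul_eq_mul, mul_one, normMonomial]
      simp only [Int.toNat_natCast]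
      congr 1
      ext i
      simp
    have hne : ∏ i, ((d i).factorial : ℝ) ≠ 0 :=
      Finset.prod_ne_zero_iff.mpr fun i _ => by positivity
    rw [e, map_smul, Module.Basis.constr_basis, smul_eq_mul, mul_comm, mul_assoc,
      mul_inv_cancel₀ hne, mul_one]
  have key : ∀ i j, f (rowDiv (edgeTensor p G h i j (T i j))) =
      M (((p i - p j) ⬝ᵥ (p i - p j)) • T i j) := fun i j => by
    conv_lhs => rw [eq_sum_normMonomial (T i j)]
    conv_rhs => rw [eq_sum_normMonomial (T i j)]
    simp only [map_smul, map_sum, Finset.smul_sum]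
    refine Finset.sum_congr rfl fun d hd => ?_
    obtain ⟨hi, hj⟩ := hsupp i j d hd
    rw [hM, hb.apply_rowDiv_edgeTensor f (by exact_mod_cast hi) (by exact_mod_cast hj),
      hμ _ (fun i => Int.natCast_nonneg _)
        (by exact_mod_cast sum_eq_of_mem_support (hT i j) hd) i j (by exact_mod_cast hi)
        (by exact_mod_cast hj)]
    simp only [smul_eq_mul]
    ring
  have h2 : f (rowDiv ((-2 : ℝ) • τ)) = 0 := by
    rw [← hsum]
    simp only [map_sum, key]
    simp only [← map_sum, htr, map_zero]
  rw [map_smul, map_smul, smul_eq_mul] at h2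
  linarith

theorem Bary.rowDiv_mem (hb : Bary p G h) {k : ℕ} {r : SmoothVec}
    {τ : Matrix (Fin 3) (Fin 3) Poly3} (hτ : τ ∈ bubbleDivST p k r) :
    rowDiv τ ∈ bubbleVecModCK p (k - 1) (r.ominus 1) := by
  refine ⟨fun a => Submodule.sum_mem _ fun b _ => hb.pderiv_mem_bubble (hτ.1.1 a b) b, ?_⟩
  rintro q ⟨a, c, d, b, hq⟩
  simp only [hq]
  rw [← ckPairing_eq_integral]
  refine hb.apply_rowDiv_eq_zero (fun β h0 hβ => ?_) hτ
  obtain ⟨μ, hμ⟩ := confAt_discCK p (bernsteinIntegral p G h ((k : ℤ) - 1 + 2) • a)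
    (bernsteinIntegral p G h ((k : ℤ) - 1 + 1) • c) (bernsteinIntegral p G h ((k : ℤ) - 1) • d)
    (bernsteinIntegral p G h ((k : ℤ) - 1 + 1) * b) β
  refine ⟨μ, fun i j hi hj => ?_⟩
  have e : ∀ l, 1 ≤ β l → _ := fun l hl => hb.bernsteinDual_ckPairing a c d b
    (α := β - Pi.single l 1) (n := (k : ℤ) - 1) (fun m => by
      have := h0 m
      rw [Pi.sub_apply, Pi.single_apply]
      split_ifs with em
      · subst em; omega
      · omega) (by simp only [Pi.sub_apply, Finset.sum_sub_distrib, hβ, sum_single_one])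
  rw [e i hi, e j hj]
  exact hμ i j hi hj

end Divergence

theorem mainTheorem12 (p : Fin 4 → Fin 3 → ℝ) (hp : AffineIndependent ℝ p)
    (r : SmoothVec) (hr : (⟨4, 1, -1⟩ : SmoothVec) ≤ r)
    (h0 : r.DivTensorStable) (h1 : (r.shift 1).DivTensorStable)
    (k : ℕ) (hk : 2 * r.v + 2 ≤ (k : ℤ)) :
    rowDiv '' (bubbleDivST p k r : Set (Matrix (Fin 3) (Fin 3) Poly3)) =
      bubbleVecModCK p (k - 1) (r.ominus 1) := by
  obtain ⟨G, h, hb⟩ := exists_bary p hp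
  obtain ⟨hf, -, -⟩ := h0.1
  have he := hr.2.1
  have hs := h1.2
  -- Since `1 ≤ r.e`, only the first alternative of stability is possible for `r + 1`; it gives `2
  -- r.f + 3 ≤ r.e` and `2 r.e + 2 ≤ r.v`.
  simp only [SmoothVec.shift] at he hs
  refine Set.Subset.antisymm ?_ fun v hv =>
    hb.exists_rowDiv_eq hf (by omega) (by omega) hk hv
  rintro _ ⟨τ, hτ, rfl⟩
  exact hb.rowDiv_mem hτ
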